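/- All graphs are finite, nonempty, undirected, without loops or multiple edges. A matching cut of a graph $G$ is a (possibly empty) set $M\subseteq E(G)$ that is a matching and has the form $M=E_G(A,B)$ for a partition $\{A,B\}$ of $V(G)$ into two nonempty sets; it is minimal if no proper subset of $M$ is a matching cut of $G$. The modular width $\mathsf{mw}(G)$ is the least positive integer $k$ such that $G$ is isomorphic to a graph built from single-vertex graphs by substitutions, where a substitution takes a graph $Q$ with vertices $v_1,\dots,v_r$, $2\le r\le k$, and disjoint graphs $G_1,\dots,G_r$ already built, and forms the union of $G_1,\dots,G_r$ with all edges between $V(G_i)$ and $V(G_j)$ added whenever $v_iv_j\in E(Q)$. Enum Minimal MC, parameterized by modular width, is the following parameterized enumeration problem $(\mathsf{Sol},\kappa)$. Graphs on $\{0,\dots,n-1\}$, $n\ge 1$, and sets of edges of them are encoded by the $n^2$ bits of their adjacency matrices. If a binary word $x$ encodes a graph $G$, then $\mathsf{Sol}(x)$ is the set of the encodings of all minimal matching cuts of $G$, and $\kappa(x)=\mathsf{mw}(G)$; for every other word, $\mathsf{Sol}(x)=\emptyset$ and $\kappa(x)=0$. Theorem. Enum Minimal MC parameterized by the modular width admits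 a fully-polynomial enumeration kernel with at most $6k$ vertices. That is, there are deterministic algorithms $\mathcal A$ and $\mathcal A'$ such that (i) for every instance $x$, $\mathcal A$ computes in time polynomial in $|x|+\kappa(x)$ an instance $y$ with $|y|+\kappa(y)\le f(\kappa(x))$, where $f$ is a fixed computable function; (ii) for every instance $x$, with $y$ the output of $\mathcal A$ on $x$, and for every $s\in\mathsf{Sol}(y)$, $\mathcal A'$ computes from $x$, $y$ and $s$, in time polynomial in $|x|+|y|+\kappa(x)+\kappa(y)$, a list without repetition of a nonempty set $S_s\subseteq\mathsf{Sol}(x)$, such that the sets $S_s$, $s\in\mathsf{Sol}(y)$, are pairwise disjoint and their union is $\mathsf{Sol}(x)$; (iii) if $x$ encodes a graph $G$, then $y$ encodes a graph $H$ with $1\le|V(H)|\le 6\,\mathsf{mw}(G)$. -/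

import Mathlib

/-! ## Words and a random access machine with step count -/

/-- Words over the alphabet `{0, 1}`. -/
abbrev Word := List Bool

/-- Programs of a random access machine.  A machine has registers `r 0, r 1, …` and arrays
`a 0, a 1, …` of natural numbers, and an output on which it writes words bit by bit.
A program is finite, hence uses only finitely many registers and arrays. -/
inductive Prog where
  /-- `r z := c` -/
  | const (z c : ℕ)
  /-- `r z := r x + r y` -/
  | add (z x y : ℕ)
  /-- `r z := max (r x - r y) 0` -/
  | sub (z x y : ℕ)
  /-- `r z := a b [r x]` -/
  | load (z b x : ℕ)
  /-- `a b [r x] := r y` -/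
  | store (b x y : ℕ)
  /-- write the bit `[r x ≠ 0]` at the end of the word that is being written -/
  | print (x : ℕ)
  /-- finish the word that is being written, and begin a new one -/
  | endWord
  /-- `p`, then `q` -/
  | seq (p q : Prog)
  /-- if `r x ≠ 0` then `p` else `q` -/
  | ite (x : ℕ) (p q : Prog)
  /-- while `r x ≠ 0` do `p` -/
  | while (x : ℕ) (p : Prog)

/-- The memory and the output of a machine. -/
structure MState where
  reg : ℕ → ℕ
  arr : ℕ → ℕ → ℕ
  /-- the finished output words, in the order in which they were written -/
  out : List Word
  /-- the bits, written so far, of the next output word -/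
  cur : Word

/-- `Runs p s t s'`: started in the state `s`, the program `p` stops after exactly `t` steps,
in the state `s'`.  Each elementary instruction and each test of a register is one step.
(There is no multiplication, so after `t` steps all numbers in the memory have `O(t)` bits more
than those at the start, and polynomial time is the polynomial time of Turing machines.) -/
inductive Runs : Prog → MState → ℕ → MState → Prop where
  | const (z c : ℕ) (s : MState) :
      Runs (.const z c) s 1 { s with reg := Function.update s.reg z c }
  | add (z x y : ℕ) (s : MState) :
      Runs (.add z x y) s 1 { s with reg := Function.update s.reg z (s.reg x + s.reg y) }
  | sub (z x y : ℕ) (s : MState) :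
      Runs (.sub z x y) s 1 { s with reg := Function.update s.reg z (s.reg x - s.reg y) }
  | load (z b x : ℕ) (s : MState) :
      Runs (.load z b x) s 1 { s with reg := Function.update s.reg z (s.arr b (s.reg x)) }
  | store (b x y : ℕ) (s : MState) :
      Runs (.store b x y) s 1
        { s with arr := Function.update s.arr b
                          (Function.update (s.arr b) (s.reg x) (s.reg y)) }
  | print (x : ℕ) (s : MState) :
      Runs (.print x) s 1 { s with cur := s.cur ++ [decide (s.reg x ≠ 0)] }
  | endWord (s : MState) :
      Runs .endWord s 1 { s with out := s.out ++ [s.cur], cur := [] }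
  | seq {p q : Prog} {s s' s'' : MState} {t t' : ℕ} :
      Runs p s t s' → Runs q s' t' s'' → Runs (.seq p q) s (t + t') s''
  | ite_true {x : ℕ} {p q : Prog} {s s' : MState} {t : ℕ} :
      s.reg x ≠ 0 → Runs p s t s' → Runs (.ite x p q) s (t + 1) s'
  | ite_false {x : ℕ} {p q : Prog} {s s' : MState} {t : ℕ} :
      s.reg x = 0 → Runs q s t s' → Runs (.ite x p q) s (t + 1) s'
  | while_stop {x : ℕ} {p : Prog} {s : MState} :
      s.reg x = 0 → Runs (.while x p) s 1 s
  | while_step {x : ℕ} {p : Prog} {s s' s'' : MState} {t t' : ℕ} :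
      s.reg x ≠ 0 → Runs p s t s' → Runs (.while x p) s' t' s'' →
      Runs (.while x p) s (t + t' + 1) s''

/-- The initial state for the input words `w₀, w₁, …`: the register `i` holds the length of `wᵢ`,
the array `i` holds the bits of `wᵢ`, everything else is `0`, nothing is written. -/
def MState.init (ws : List Word) : MState where
  reg i := (ws.getD i []).length
  arr i j := ((ws.getD i []).getD j false).toNat
  out := []
  cur := []

/-- On the input words `ws` the program `p` stops within `T` steps, and the words it has
written are exactly `vs`, in this order. -/
def Prog.OutputsWithin (p : Prog) (ws vs : List Word) (T : ℕ) : Prop :=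
  ∃ t s, Runs p (MState.init ws) t s ∧ t ≤ T ∧ s.out = vs ∧ s.cur = []

/-- On the input words `ws` the program `p` stops, and the words it has written are `vs`. -/
def Prog.Outputs (p : Prog) (ws vs : List Word) : Prop :=
  ∃ T, p.OutputsWithin ws vs T

/-! ## Parameterized enumeration problems and enumeration kernels -/

/-- A parameterized enumeration problem over the alphabet `{0, 1}`: every word `x` is an instance,
`Sol x` is its finite set of solutions, `L` is the set of the instances that have a solution,
and `κ` is the parameterization. -/
structure ParamEnumProblem where
  L : Set Word
  Sol : Word → Set Word
  κ : Word → ℕ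
  finite_Sol : ∀ x, (Sol x).Finite
  mem_L_iff : ∀ x, x ∈ L ↔ (Sol x).Nonempty
  decidable_L : ComputablePred (fun x => x ∈ L)
  computable_Sol : ∃ g : Word → List Word, Computable g ∧ ∀ x, {w | w ∈ g x} = Sol x

/-- `A` (the kernelization algorithm) and `A'` (the solution-lifting algorithm) form a
fully-polynomial enumeration kernel for `P`.  Here `K x` is the instance that `A` computes from
the instance `x`, and `S x s` lists, without repetition, the set of solutions of `x` that `A'`
computes from `x`, `K x` and the solution `s` of `K x`. -/
def IsFullyPolynomialEnumKernel (P : ParamEnumProblem) (A A' : Prog) : Prop :=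
  ∃ (K : Word → Word) (S : Word → Word → List Word) (p q : Polynomial ℕ) (f : ℕ → ℕ),
    Computable f ∧
    (∀ x, A.OutputsWithin [x] [K x] (p.eval (x.length + P.κ x)) ∧
      (K x).length + P.κ (K x) ≤ f (P.κ x)) ∧
    ∀ x,
      (∀ s ∈ P.Sol (K x),
        A'.OutputsWithin [x, K x, s] (S x s)
          (q.eval (x.length + (K x).length + P.κ x + P.κ (K x))) ∧
        (S x s).Nodup ∧ S x s ≠ [] ∧ ∀ w ∈ S x s, w ∈ P.Sol x) ∧
      (∀ s ∈ P.Sol (K x), ∀ s' ∈ P.Sol (K x), s ≠ s' → List.Disjoint (S x s) (S x s')) ∧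
      ∀ w ∈ P.Sol x, ∃ s ∈ P.Sol (K x), w ∈ S x s

/-! ## Matching cuts -/

section Graphs

variable {V : Type}

/-- The set of the edges of `G` between `A` and its complement. -/
def edgeCut (G : SimpleGraph V) (A : Set V) : Set (Sym2 V) :=
  {e | ∃ u ∈ A, ∃ v ∉ A, G.Adj u v ∧ e = s(u, v)}

/-- A set of edges is a matching if no two of them have a common end-vertex. -/
def IsEdgeMatching (M : Set (Sym2 V)) : Prop :=
  ∀ e ∈ M, ∀ f ∈ M, ∀ v, v ∈ e → v ∈ f → e = f

/-- A matching cut is a possibly empty matching of the form `E(A, B)` for a partition `{A, B}`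
of the vertex set into two nonempty parts. -/
def IsMatchingCut (G : SimpleGraph V) (M : Set (Sym2 V)) : Prop :=
  (∃ A : Set V, A.Nonempty ∧ Aᶜ.Nonempty ∧ M = edgeCut G A) ∧ IsEdgeMatching M

/-- An inclusion minimal matching cut. -/
def IsMinimalMatchingCut (G : SimpleGraph V) (M : Set (Sym2 V)) : Prop :=
  Minimal (IsMatchingCut G) M

end Graphs

/-! ## Modular width -/

/-- The graph obtained by substituting the disjoint graphs `H i` for the vertices `i` of `Q`. -/
def substGraph {r : ℕ} (Q : SimpleGraph (Fin r)) {W : Fin r → Type}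
    (H : ∀ i, SimpleGraph (W i)) : SimpleGraph (Σ i, W i) where
  Adj a b := Q.Adj a.1 b.1 ∨ ∃ h : a.1 = b.1, (H b.1).Adj (h ▸ a.2) b.2
  symm := ⟨by
    rintro ⟨i, x⟩ ⟨j, y⟩ (h | ⟨h, h'⟩)
    · exact Or.inl h.symm
    · obtain rfl : i = j := h
      exact Or.inr ⟨rfl, h'.symm⟩⟩
  loopless := ⟨by
    rintro ⟨i, x⟩ (h | ⟨_, h'⟩)
    · exact Q.irrefl h
    · exact (H i).irrefl h'⟩

/-- The graphs that are isomorphic to a graph constructed from single vertices by substitutions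
into graphs with at least `2` and at most `k` vertices. -/
inductive ModularConstructible (k : ℕ) : (V : Type) → SimpleGraph V → Prop where
  | single (V : Type) [Unique V] (G : SimpleGraph V) : ModularConstructible k V G
  | subst {r : ℕ} (two_le : 2 ≤ r) (le : r ≤ k) (Q : SimpleGraph (Fin r)) (W : Fin r → Type)
      (H : ∀ i, SimpleGraph (W i)) :
      (∀ i, ModularConstructible k (W i) (H i)) →
      ModularConstructible k (Σ i, W i) (substGraph Q H)
  | iso {V V' : Type} {G : SimpleGraph V} {G' : SimpleGraph V'} :
      G ≃g G' → ModularConstructible k V G → ModularConstructible k V' G'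

/-- The modular width of a (finite, nonempty) graph. -/
noncomputable def modularWidth {V : Type} (G : SimpleGraph V) : ℕ :=
  sInf {k | 0 < k ∧ ModularConstructible k V G}

/-! ## Encodings -/

open Classical in
/-- A set of edges on the vertices `0, …, n - 1` is encoded by the `n ^ 2` bits of its adjacency
matrix, row by row. -/
noncomputable def encodeEdges {n : ℕ} (M : Set (Sym2 (Fin n))) : Word :=
  List.ofFn fun t : Fin (n * n) => decide (s(t.divNat, t.modNat) ∈ M)

/-- A graph is encoded by its adjacency matrix. -/
noncomputable def encodeGraph {n : ℕ} (G : SimpleGraph (Fin n)) : Word :=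
  encodeEdges G.edgeSet

/-- The encodings of the minimal matching cuts of the graph that is encoded by `x`.
The set is empty if `x` is not the encoding of a (nonempty) graph. -/
def minimalMCSol (x : Word) : Set Word :=
  {w | ∃ (n : ℕ) (G : SimpleGraph (Fin n)) (M : Set (Sym2 (Fin n))),
    0 < n ∧ x = encodeGraph G ∧ IsMinimalMatchingCut G M ∧ w = encodeEdges M}

/-- The modular width of the (nonempty) graph that is encoded by `x`, and `0` if there is no such
graph. -/
noncomputable def modularWidthParam (x : Word) : ℕ :=
  sInf {k | ∃ (n : ℕ) (G : SimpleGraph (Fin n)),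
    0 < n ∧ x = encodeGraph G ∧ k = modularWidth G}

/-! ## The instances and the solutions can be computed

The following facts, about the bits of the words, are needed only to see that the problem defined
at the end is a parameterized enumeration problem. -/

namespace MCComputable

/-- the list of all words of length `n` -/
def words (n : ℕ) : List Word :=
  Nat.rec [[]] (fun _ l => l.flatMap fun w => [false :: w, true :: w]) n

theorem mem_words {n : ℕ} {w : Word} : w ∈ words n ↔ w.length = n := by
  induction n generalizing w with
  | zero => simp [words]
  | succ n ih =>
    have h : words (n + 1) = (words n).flatMap fun w => [false :: w, true :: w] := rfl
    rw [h]
    cases w with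
    | nil => simp
    | cons b w => cases b <;> simp [ih]

theorem primrec_words : Primrec words := by
  have hh : Primrec₂ (fun (_ : ℕ) (q : ℕ × List Word) =>
      q.2.flatMap fun w => [false :: w, true :: w]) := by
    apply Primrec.list_flatMap (Primrec.snd.comp Primrec.snd)
    exact Primrec.list_cons.comp
      (Primrec.list_cons.comp (Primrec.const false) Primrec.snd)
      (Primrec.list_cons.comp (Primrec.list_cons.comp (Primrec.const true) Primrec.snd)
        (Primrec.const []))
  exact (Primrec.nat_rec' Primrec.id (Primrec.const [[]]) hh).of_eq fun n => rfl

/-- the bit `t` of a word -/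
def bit (x : Word) (t : ℕ) : Bool := x.getD t false

theorem primrec_bit {α : Type} [Primcodable α] {f : α → Word} {g : α → ℕ} (hf : Primrec f)
    (hg : Primrec g) : Primrec fun a => bit (f a) (g a) :=
  (Primrec.list_getD false).comp hf hg

/-- `x` is the encoding of a nonempty graph on `n` vertices -/
def IsGraphWord (n : ℕ) (x : Word) : Prop :=
  x.length = n * n ∧ 0 < n ∧ (∀ i < n, bit x (i * n + i) = false) ∧
    ∀ i < n, ∀ j < n, bit x (i * n + j) = bit x (j * n + i)

/-- `w` is the encoding of a matching cut of the graph on `n` vertices encoded by `x` -/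
def IsCutWord (n : ℕ) (x w : Word) : Prop :=
  w.length = n * n ∧
  (∃ a ∈ words n, (∃ i < n, bit a i = true) ∧ (∃ i < n, bit a i = false) ∧
    ∀ i < n, ∀ j < n, bit w (i * n + j) = (bit x (i * n + j) && (bit a i != bit a j))) ∧
  ∀ i < n, ∀ j < n, ∀ k < n, bit w (i * n + j) = false ∨ bit w (i * n + k) = false ∨ j = k

/-- `w` is a solution of the instance `x` -/
def IsSolWord (x w : Word) : Prop :=
  ∃ n < x.length + 1, IsGraphWord n x ∧ IsCutWord n x w ∧
    ∀ w' ∈ words (n * n), ¬ IsCutWord n x w' ∨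
      (∃ t < n * n, bit w' t = true ∧ bit w t = false) ∨ w' = w

section Primrec

variable {α β : Type} [Primcodable α] [Primcodable β]

theorem ball_mem {f : α → List β} {R : α → β → Prop} (hf : Primrec f)
    (hR : PrimrecPred fun q : α × β => R q.1 q.2) : PrimrecPred fun a => ∀ i ∈ f a, R a i :=
  PrimrecRel.comp (PrimrecRel.forall_mem_list (R := fun i a => R a i)
    (hR.primrecRel.swap)) hf Primrec.id

theorem bex_mem {f : α → List β} {R : α → β → Prop} (hf : Primrec f)
    (hR : PrimrecPred fun q : α × β => R q.1 q.2) : PrimrecPred fun a => ∃ i ∈ f a, R a i :=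
  PrimrecRel.comp (PrimrecRel.exists_mem_list (R := fun i a => R a i)
    (hR.primrecRel.swap)) hf Primrec.id

theorem ball_lt {f : α → ℕ} {R : α → ℕ → Prop} (hf : Primrec f)
    (hR : PrimrecPred fun q : α × ℕ => R q.1 q.2) : PrimrecPred fun a => ∀ i < f a, R a i :=
  (ball_mem (Primrec.list_range.comp hf) hR).of_eq (by simp)

theorem bex_lt {f : α → ℕ} {R : α → ℕ → Prop} (hf : Primrec f)
    (hR : PrimrecPred fun q : α × ℕ => R q.1 q.2) : PrimrecPred fun a => ∃ i < f a, R a i :=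
  (bex_mem (Primrec.list_range.comp hf) hR).of_eq (by simp)

theorem primrec_idx {n i j : α → ℕ} (hn : Primrec n) (hi : Primrec i) (hj : Primrec j) :
    Primrec fun a => i a * n a + j a :=
  Primrec.nat_add.comp (Primrec.nat_mul.comp hi hn) hj

theorem eq_pred {f g : α → β} (hf : Primrec f) (hg : Primrec g) :
    PrimrecPred fun a => f a = g a := PrimrecRel.comp Primrec.eq hf hg

theorem lt_pred {f g : α → ℕ} (hf : Primrec f) (hg : Primrec g) :
    PrimrecPred fun a => f a < g a := PrimrecRel.comp Primrec.nat_lt hf hg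

theorem primrec_isGraphWord {n : α → ℕ} {x : α → Word} (hn : Primrec n) (hx : Primrec x) :
    PrimrecPred fun a => IsGraphWord (n a) (x a) := by
  refine (eq_pred (Primrec.list_length.comp hx) (Primrec.nat_mul.comp hn hn)).and
    ((lt_pred (Primrec.const 0) hn).and ((ball_lt hn ?_).and (ball_lt hn (ball_lt ?_ ?_))))
  · exact eq_pred (primrec_bit (hx.comp .fst) (primrec_idx (hn.comp .fst) .snd .snd)) (.const _)
  · exact hn.comp .fst
  · have n' := hn.comp ((Primrec.fst (α := α) (β := ℕ)).comp (Primrec.fst (β := ℕ)))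
    have x' := hx.comp ((Primrec.fst (α := α) (β := ℕ)).comp (Primrec.fst (β := ℕ)))
    have i := (Primrec.snd (α := α) (β := ℕ)).comp (Primrec.fst (β := ℕ))
    exact eq_pred (primrec_bit x' (primrec_idx n' i .snd)) (primrec_bit x' (primrec_idx n' .snd i))

theorem primrec_isCutWord {n : α → ℕ} {x w : α → Word} (hn : Primrec n) (hx : Primrec x)
    (hw : Primrec w) : PrimrecPred fun a => IsCutWord (n a) (x a) (w a) := by
  refine (eq_pred (Primrec.list_length.comp hw) (Primrec.nat_mul.comp hn hn)).and
    (PrimrecPred.and (bex_mem (primrec_words.comp hn) ?_) ?_)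
  · have hn' := hn.comp (Primrec.fst (α := α) (β := Word))
    refine (bex_lt hn' ?_).and ((bex_lt hn' ?_).and (ball_lt hn' (ball_lt (hn'.comp .fst) ?_)))
    · exact eq_pred (primrec_bit (Primrec.snd.comp .fst) .snd) (.const _)
    · exact eq_pred (primrec_bit (Primrec.snd.comp .fst) .snd) (.const _)
    · have e := (Primrec.fst (α := α) (β := Word)).comp ((Primrec.fst (β := ℕ)).comp
        (Primrec.fst (β := ℕ)))
      have a := (Primrec.snd (α := α) (β := Word)).comp ((Primrec.fst (β := ℕ)).comp
        (Primrec.fst (β := ℕ)))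
      have i := (Primrec.snd (α := α × Word) (β := ℕ)).comp (Primrec.fst (β := ℕ))
      have ij := primrec_idx (hn.comp e) i .snd
      refine eq_pred (primrec_bit (hw.comp e) ij) (Primrec.and.comp (primrec_bit (hx.comp e) ij) ?_)
      exact (Primrec.dom_finite (fun q : Bool × Bool => q.1 != q.2)).comp
        (Primrec.pair (primrec_bit a i) (primrec_bit a .snd))
  · refine ball_lt hn (ball_lt (hn.comp .fst) (ball_lt (hn.comp (Primrec.fst.comp .fst)) ?_))
    have e := (Primrec.fst (α := α) (β := ℕ)).comp ((Primrec.fst (β := ℕ)).comp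
        (Primrec.fst (β := ℕ)))
    have i := (Primrec.snd (α := α) (β := ℕ)).comp ((Primrec.fst (β := ℕ)).comp
        (Primrec.fst (β := ℕ)))
    have j := (Primrec.snd (α := α × ℕ) (β := ℕ)).comp (Primrec.fst (β := ℕ))
    exact (eq_pred (primrec_bit (hw.comp e) (primrec_idx (hn.comp e) i j)) (.const _)).or
      ((eq_pred (primrec_bit (hw.comp e) (primrec_idx (hn.comp e) i .snd)) (.const _)).or
        (eq_pred j .snd))

theorem primrec_isSolWord {x w : α → Word} (hx : Primrec x) (hw : Primrec w) :
    PrimrecPred fun a => IsSolWord (x a) (w a) := by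
  refine bex_lt (Primrec.succ.comp (Primrec.list_length.comp hx)) ?_
  have x' := hx.comp (Primrec.fst (α := α) (β := ℕ))
  have w' := hw.comp (Primrec.fst (α := α) (β := ℕ))
  refine (primrec_isGraphWord .snd x').and ((primrec_isCutWord .snd x' w').and
    (ball_mem (primrec_words.comp (Primrec.nat_mul.comp .snd .snd)) ?_))
  have n2 := (Primrec.snd (α := α) (β := ℕ)).comp (Primrec.fst (β := Word))
  refine (primrec_isCutWord n2 (x'.comp .fst) .snd).not.or
    ((bex_lt (Primrec.nat_mul.comp n2 n2) ?_).or (eq_pred .snd (w'.comp .fst)))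
  exact (eq_pred (primrec_bit (Primrec.snd.comp .fst) .snd) (.const _)).and
    (eq_pred (primrec_bit ((w'.comp .fst).comp .fst) .snd) (.const _))

end Primrec

open Classical in
/-- the list of the solutions of `x` -/
noncomputable def solList (x : Word) : List Word :=
  (words x.length).flatMap fun w => if IsSolWord x w then [w] else []

theorem primrec_solList : Primrec solList := by
  classical
  refine Primrec.list_flatMap (primrec_words.comp .list_length) ?_
  exact Primrec.ite (primrec_isSolWord .fst .snd)
    (Primrec.list_cons.comp .snd (.const [])) (.const [])

theorem idx_lt {n i j : ℕ} (hi : i < n) (hj : j < n) : i * n + j < n * n := by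
  calc i * n + j < i * n + n := by omega
    _ = (i + 1) * n := by ring
    _ ≤ n * n := Nat.mul_le_mul_right n hi

open Classical in
theorem bit_encodeEdges {n : ℕ} (M : Set (Sym2 (Fin n))) (i j : Fin n) :
    bit (encodeEdges M) (i * n + j) = decide (s(i, j) ∈ M) := by
  have h := idx_lt i.2 j.2
  have hn : 0 < n := i.pos
  have h1 : (⟨i * n + j, h⟩ : Fin (n * n)).divNat = i := by
    ext
    simp only [Fin.coe_divNat]
    rw [mul_comm, Nat.mul_add_div hn, Nat.div_eq_of_lt j.2, add_zero]
  have h2 : (⟨i * n + j, h⟩ : Fin (n * n)).modNat = j := by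
    ext
    simp only [Fin.coe_modNat]
    rw [mul_comm, Nat.mul_add_mod, Nat.mod_eq_of_lt j.2]
  unfold bit encodeEdges
  rw [List.getD_eq_getElem _ _ (by simpa using h)]
  simp [List.getElem_ofFn, h1, h2]

@[simp] theorem length_encodeEdges {n : ℕ} (M : Set (Sym2 (Fin n))) :
    (encodeEdges M).length = n * n := by simp [encodeEdges]

theorem word_ext {n : ℕ} {x y : Word} (hx : x.length = n * n) (hy : y.length = n * n)
    (h : ∀ i < n, ∀ j < n, bit x (i * n + j) = bit y (i * n + j)) : x = y := by
  apply List.ext_getElem (by rw [hx, hy])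
  intro t h1 h2
  have ht : t < n * n := hx ▸ h1
  have hn : 0 < n := by
    rcases Nat.eq_zero_or_pos n with rfl | hn
    · simp at ht
    · exact hn
  have := h (t / n) (Nat.div_lt_of_lt_mul ht) (t % n) (Nat.mod_lt _ hn)
  rw [Nat.div_add_mod'] at this
  simpa [bit, List.getD_eq_getElem, h1, h2] using this

/-- the set of edges encoded by a word -/
def decodeEdges (n : ℕ) (w : Word) : Set (Sym2 (Fin n)) :=
  {e | ∃ i j : Fin n, e = s(i, j) ∧ bit w (i * n + j) = true}

theorem encode_decode {n : ℕ} {w : Word} (hl : w.length = n * n)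
    (hs : ∀ i < n, ∀ j < n, bit w (i * n + j) = bit w (j * n + i)) :
    encodeEdges (decodeEdges n w) = w := by
  classical
  refine word_ext (length_encodeEdges _) hl fun i hi j hj => ?_
  rw [bit_encodeEdges _ ⟨i, hi⟩ ⟨j, hj⟩, Bool.eq_iff_iff, decide_eq_true_iff]
  constructor
  · rintro ⟨a, b, h, hb⟩
    rw [Sym2.eq_iff] at h
    rcases h with ⟨rfl, rfl⟩ | ⟨rfl, rfl⟩
    · exact hb
    · rw [hs i hi j hj]; exact hb
  · exact fun h => ⟨_, _, rfl, h⟩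

theorem isGraphWord_iff {n : ℕ} {x : Word} :
    IsGraphWord n x ↔ 0 < n ∧ ∃ G : SimpleGraph (Fin n), x = encodeGraph G := by
  constructor
  · rintro ⟨hl, hn, hd, hs⟩
    refine ⟨hn, SimpleGraph.fromEdgeSet (decodeEdges n x), ?_⟩
    rw [encodeGraph, SimpleGraph.edgeSet_fromEdgeSet]
    conv_lhs => rw [← encode_decode hl hs]
    congr 1
    symm
    rw [sdiff_eq_left, Set.disjoint_left]
    rintro e ⟨i, j, rfl, hb⟩ h
    have : i = j := by simpa using h
    subst this
    rw [hd i i.2] at hb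
    exact absurd hb (by simp)
  · rintro ⟨hn, G, rfl⟩
    refine ⟨length_encodeEdges _, hn, fun i hi => ?_, fun i hi j hj => ?_⟩
    · rw [encodeGraph, bit_encodeEdges _ ⟨i, hi⟩ ⟨i, hi⟩]; simp
    · rw [encodeGraph, bit_encodeEdges _ ⟨i, hi⟩ ⟨j, hj⟩, bit_encodeEdges _ ⟨j, hj⟩ ⟨i, hi⟩,
        Sym2.eq_swap]

theorem mem_edgeCut {V : Type} (G : SimpleGraph V) (A : Set V) (u v : V) :
    s(u, v) ∈ edgeCut G A ↔ G.Adj u v ∧ ¬ (u ∈ A ↔ v ∈ A) := by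
  constructor
  · rintro ⟨a, ha, b, hb, h, he⟩
    rw [Sym2.eq_iff] at he
    rcases he with ⟨rfl, rfl⟩ | ⟨rfl, rfl⟩
    · exact ⟨h, by tauto⟩
    · exact ⟨h.symm, by tauto⟩
  · rintro ⟨h, h'⟩
    by_cases hu : u ∈ A
    · exact ⟨u, hu, v, by tauto, h, rfl⟩
    · exact ⟨v, by tauto, u, hu, h.symm, Sym2.eq_swap⟩

theorem isCutWord_encode {n : ℕ} {G : SimpleGraph (Fin n)} {M : Set (Sym2 (Fin n))}
    (h : IsMatchingCut G M) : IsCutWord n (encodeGraph G) (encodeEdges M) := by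
  classical
  obtain ⟨⟨A, ⟨u, hu⟩, ⟨v, hv⟩, rfl⟩, hM⟩ := h
  have hb : ∀ i (hi : i < n), bit (List.ofFn fun t : Fin n => decide (t ∈ A)) i
      = decide ((⟨i, hi⟩ : Fin n) ∈ A) := by
    intro i hi
    rw [bit, List.getD_eq_getElem _ _ (by simpa using hi)]
    simp
  refine ⟨length_encodeEdges _, ⟨List.ofFn fun t => decide (t ∈ A), ?_, ⟨u, u.2, ?_⟩,
    ⟨v, v.2, ?_⟩, fun i hi j hj => ?_⟩, fun i hi j hj k hk => ?_⟩
  · rw [mem_words]; simp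
  · rw [hb u u.2]; simpa using hu
  · rw [hb v v.2]; simpa using hv
  · rw [hb i hi, hb j hj, encodeGraph, bit_encodeEdges _ ⟨i, hi⟩ ⟨j, hj⟩,
      bit_encodeEdges _ ⟨i, hi⟩ ⟨j, hj⟩, Bool.eq_iff_iff, decide_eq_true_iff, mem_edgeCut]
    simp
  · rw [bit_encodeEdges _ ⟨i, hi⟩ ⟨j, hj⟩, bit_encodeEdges _ ⟨i, hi⟩ ⟨k, hk⟩]
    by_contra! hc
    obtain ⟨h1, h2, h3⟩ := hc
    have := hM _ (by simpa using h1) _ (by simpa using h2) ⟨i, hi⟩ (by simp) (by simp)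
    simp only [Sym2.eq_iff, Fin.mk.injEq, true_and] at this
    omega

theorem exists_of_isCutWord {n : ℕ} {G : SimpleGraph (Fin n)} {w : Word}
    (h : IsCutWord n (encodeGraph G) w) : ∃ M, IsMatchingCut G M ∧ w = encodeEdges M := by
  classical
  obtain ⟨hl, ⟨a, -, ⟨u, hu, hu'⟩, ⟨v, hv, hv'⟩, hw⟩, hm⟩ := h
  have hA : w = encodeEdges (edgeCut G {i : Fin n | bit a i = true}) := by
    refine word_ext hl (length_encodeEdges _) fun i hi j hj => ?_
    rw [hw i hi j hj, encodeGraph, bit_encodeEdges _ ⟨i, hi⟩ ⟨j, hj⟩,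
      bit_encodeEdges _ ⟨i, hi⟩ ⟨j, hj⟩, Bool.eq_iff_iff, decide_eq_true_iff, mem_edgeCut]
    simp
  refine ⟨_, ⟨⟨_, ⟨⟨u, hu⟩, hu'⟩, ⟨⟨v, hv⟩, by simp [hv']⟩, rfl⟩, ?_⟩, hA⟩
  intro e he f hf i hie hif
  obtain ⟨j, rfl⟩ := Sym2.mem_iff_exists.1 hie
  obtain ⟨k, rfl⟩ := Sym2.mem_iff_exists.1 hif
  have := hm i i.2 j j.2 k k.2
  rw [hA, bit_encodeEdges, bit_encodeEdges] at this
  rcases this with h | h | h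
  · exact absurd he (by simpa using h)
  · exact absurd hf (by simpa using h)
  · rw [Fin.ext h]

theorem subset_iff {n : ℕ} {M M' : Set (Sym2 (Fin n))} :
    M' ⊆ M ↔ ¬ ∃ t < n * n, bit (encodeEdges M') t = true ∧ bit (encodeEdges M) t = false := by
  constructor
  · rintro h ⟨t, ht, h1, h2⟩
    have hn : 0 < n := by
      rcases Nat.eq_zero_or_pos n with rfl | hn
      · simp at ht
      · exact hn
    have e : t = ((⟨t / n, Nat.div_lt_of_lt_mul ht⟩ : Fin n) : ℕ) * n
      + ((⟨t % n, Nat.mod_lt _ hn⟩ : Fin n) : ℕ) := (Nat.div_add_mod' t n).symm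
    rw [e, bit_encodeEdges] at h1 h2
    simp only [decide_eq_true_iff, decide_eq_false_iff_not] at h1 h2
    exact h2 (h h1)
  · intro h e
    induction e using Sym2.ind with
    | _ i j =>
      intro he
      by_contra hc
      exact h ⟨_, idx_lt i.2 j.2, by rw [bit_encodeEdges]; simpa using he,
        by rw [bit_encodeEdges]; simpa using hc⟩

theorem isSolWord_iff {x w : Word} : IsSolWord x w ↔ w ∈ minimalMCSol x := by
  constructor
  · rintro ⟨n, -, hG, hw, hmin⟩
    obtain ⟨hn, G, rfl⟩ := isGraphWord_iff.1 hG
    obtain ⟨M, hM, rfl⟩ := exists_of_isCutWord hw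
    refine ⟨n, G, M, hn, rfl, ⟨hM, fun M' hM' hle => ?_⟩, rfl⟩
    rcases hmin (encodeEdges M') (mem_words.2 (length_encodeEdges _)) with h | h | h
    · exact absurd (isCutWord_encode hM') h
    · exact absurd h (subset_iff.1 hle)
    · refine subset_iff.2 ?_
      rw [h]
      rintro ⟨t, -, h1, h2⟩
      rw [h1] at h2
      exact absurd h2 (by simp)
  · rintro ⟨n, G, M, hn, rfl, hM, rfl⟩
    refine ⟨n, ?_, isGraphWord_iff.2 ⟨hn, G, rfl⟩, isCutWord_encode hM.1, ?_⟩
    · rw [encodeGraph, length_encodeEdges]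
      exact Nat.lt_succ_of_le (Nat.le_mul_of_pos_left n hn)
    · intro w' _
      by_cases hw' : IsCutWord n (encodeGraph G) w'
      · obtain ⟨M', hM', rfl⟩ := exists_of_isCutWord hw'
        by_cases hs : M' ⊆ M
        · exact Or.inr (Or.inr (by rw [hM.eq_of_subset hM' hs]))
        · exact Or.inr (Or.inl (by rw [subset_iff] at hs; simpa using hs))
      · exact Or.inl hw'

theorem mem_solList (x w : Word) : w ∈ solList x ↔ w ∈ minimalMCSol x := by
  classical
  rw [← isSolWord_iff]
  simp only [solList, List.mem_flatMap, mem_words]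
  constructor
  · rintro ⟨v, -, hv⟩
    split_ifs at hv with h
    · rw [List.mem_singleton.1 hv]; exact h
    · simp at hv
  · intro h
    refine ⟨w, ?_, by simp [h]⟩
    obtain ⟨n, -, hG, hw, -⟩ := h
    rw [hG.1, hw.1]

end MCComputable

/-- The problem of enumerating the minimal matching cuts of a graph, parameterized by the modular
width. -/
noncomputable def enumMinimalMC : ParamEnumProblem where
  L := {x | (minimalMCSol x).Nonempty}
  Sol := minimalMCSol
  κ := modularWidthParam
  finite_Sol x := (List.finite_toSet (MCComputable.solList x)).subset
    fun w hw => (MCComputable.mem_solList x w).2 hw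
  mem_L_iff _ := Iff.rfl
  decidable_L := by
    classical
    refine ⟨Classical.decPred _, (PrimrecPred.decide ?_).to_comp⟩
    refine ((MCComputable.eq_pred MCComputable.primrec_solList (.const [])).not).of_eq fun x => ?_
    exact ⟨fun h => (List.exists_mem_of_ne_nil _ h).imp
        fun w => (MCComputable.mem_solList x w).1,
      fun ⟨w, hw⟩ => List.ne_nil_of_mem ((MCComputable.mem_solList x w).2 hw)⟩
  computable_Sol := ⟨MCComputable.solList, MCComputable.primrec_solList.to_comp,
    fun x => Set.ext fun w => MCComputable.mem_solList x w⟩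

/-! ## Total correctness with time bounds -/

namespace Prog

/-! Describe a cut by a two-colouring of the vertices. It is a matching cut iff both colours occur
and every vertex has at most one neighbour of the other colour (`Good`). Such colourings are rigid:
a vertex with two neighbours of one colour has that colour, triangles are monochromatic, and two
vertices with three common neighbours have equal colours. Hence vertices that are forced to agree
with all their neighbours can be deleted without changing the family of matching cuts, as sets of
edges of one ambient graph (`isMC_iff_of_anchor`). Two deletion rules of this kind suffice
(`isMC_step`); a disconnected graph, whose only minimal matching cut is empty, is first cut down to
two vertices of different components (`start_cases`). Exhaustive deletion yields `core`, which has
exactly the minimal matching cuts of the input (`sol_core`).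

Afterwards each vertex keeps only its least pendant neighbour (`trim`). A minimal matching cut that
contains a pendant edge consists of this edge alone, so the only solutions lost are `{vp}` with `p`
surplus. Each is recovered from `{vq}`, where `q` is the pendant neighbour that `v` has kept; the
other solutions are lifted to themselves (`sol_trim`, `exists_of_mem_sol`, `Lifts.unique`).

For the size, let the core be connected with at least two vertices. The construction of the graph by
substitutions yields at most `mw` modules that cover the core, none containing it
(`exists_modules`). A module with two outer neighbours in the core has at most three core vertices,
because of four vertices one would be removable by means of the `K_{2,3}` formed by the other three
and the two outer neighbours. If there is only one outer neighbour, the absorption rule leaves only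
vertices pendant at it, and trimming leaves one (`ncard_module_le`). This bounds the kernel by `3
mw`, well within `6 mw`; the remaining cases have at most two vertices.

For the running time, every set involved is obtained by polynomially many comprehensions with fixed
first-order formulas. A formula is evaluated by exhaustive search (`ev_ok`), in time polynomial in
the number of vertices (`exists_cost_le`). So both programs are assembled from loops, comprehensions
and printing of definable matrices. -/

/-- Started in `s`, the program `p` stops within `T` steps, in a state that satisfies `Q`. -/
def Ok (p : Prog) (s : MState) (T : ℕ) (Q : MState → Prop) : Prop :=
  ∃ t s', Runs p s t s' ∧ t ≤ T ∧ Q s'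

theorem Ok.mono {p : Prog} {s : MState} {T T' : ℕ} {Q Q' : MState → Prop} (h : p.Ok s T Q)
    (hT : T ≤ T') (hQ : ∀ s', Q s' → Q' s') : p.Ok s T' Q' := by
  obtain ⟨t, s', hr, ht, hq⟩ := h
  exact ⟨t, s', hr, ht.trans hT, hQ _ hq⟩

theorem Ok.imp {p : Prog} {s : MState} {T : ℕ} {Q Q' : MState → Prop} (h : p.Ok s T Q)
    (hQ : ∀ s', Q s' → Q' s') : p.Ok s T Q' := h.mono le_rfl hQ

theorem Ok.le {p : Prog} {s : MState} {T T' : ℕ} {Q : MState → Prop} (h : p.Ok s T Q)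
    (hT : T ≤ T') : p.Ok s T' Q := h.mono hT fun _ h => h

/-! ### Proof rules for single instructions and control structures -/

section rules

variable {s : MState} {Q : MState → Prop}

theorem Ok.const {z c : ℕ} (h : Q { s with reg := Function.update s.reg z c }) :
    (const z c).Ok s 1 Q := ⟨1, _, .const z c s, le_rfl, h⟩

theorem Ok.add {z x y : ℕ} (h : Q { s with reg := Function.update s.reg z (s.reg x + s.reg y) }) :
    (add z x y).Ok s 1 Q := ⟨1, _, .add z x y s, le_rfl, h⟩

theorem Ok.sub {z x y : ℕ} (h : Q { s with reg := Function.update s.reg z (s.reg x - s.reg y) }) :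
    (sub z x y).Ok s 1 Q := ⟨1, _, .sub z x y s, le_rfl, h⟩

theorem Ok.load {z b x : ℕ} (h : Q { s with reg := Function.update s.reg z (s.arr b (s.reg x)) }) :
    (load z b x).Ok s 1 Q := ⟨1, _, .load z b x s, le_rfl, h⟩

theorem Ok.store {b x y : ℕ}
    (h : Q { s with arr := Function.update s.arr b
                      (Function.update (s.arr b) (s.reg x) (s.reg y)) }) :
    (store b x y).Ok s 1 Q := ⟨1, _, .store b x y s, le_rfl, h⟩

theorem Ok.print {x : ℕ} (h : Q { s with cur := s.cur ++ [decide (s.reg x ≠ 0)] }) :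
    (print x).Ok s 1 Q := ⟨1, _, .print x s, le_rfl, h⟩

theorem Ok.endWord (h : Q { s with out := s.out ++ [s.cur], cur := [] }) :
    endWord.Ok s 1 Q := ⟨1, _, .endWord s, le_rfl, h⟩

theorem Ok.seq {p q : Prog} {T T' : ℕ} (h : p.Ok s T fun s' => q.Ok s' T' Q) :
    (seq p q).Ok s (T + T') Q := by
  obtain ⟨t, s', hr, ht, t', s'', hr', ht', hq⟩ := h
  exact ⟨_, _, .seq hr hr', by omega, hq⟩

theorem Ok.ite {x : ℕ} {p q : Prog} {T : ℕ} (h1 : s.reg x ≠ 0 → p.Ok s T Q)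
    (h2 : s.reg x = 0 → q.Ok s T Q) : (ite x p q).Ok s (T + 1) Q := by
  by_cases h : s.reg x = 0
  · obtain ⟨t, s', hr, ht, hq⟩ := h2 h
    exact ⟨_, _, .ite_false h hr, by omega, hq⟩
  · obtain ⟨t, s', hr, ht, hq⟩ := h1 h
    exact ⟨_, _, .ite_true h hr, by omega, hq⟩

theorem Ok.while_exit {x : ℕ} {p : Prog} (h : s.reg x = 0) (hq : Q s) : (Prog.while x p).Ok s 1 Q :=
  ⟨1, s, by constructor; exact h, le_rfl, hq⟩

theorem Ok.while_step {x : ℕ} {p : Prog} {T T' : ℕ} (h : s.reg x ≠ 0)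
    (hp : p.Ok s T fun s' => (Prog.while x p).Ok s' T' Q) :
    (Prog.while x p).Ok s (T + T' + 1) Q := by
  obtain ⟨t, s', hr, ht, t', s'', hr', ht', hq⟩ := hp
  exact ⟨_, _, .while_step h hr hr', by omega, hq⟩

end rules

/-! ### Register conventions

Register `3` holds the bound `n` of all loops, `4` is scratch and the test register of loops,
`5` receives the truth values of formulas, and the variable `d` lives in the register `10 + d`. -/

/-- `for z = 0, …, r 3 - 1 do c` -/
def loop (z : ℕ) (c : Prog) : Prog :=
  .seq (.const z 0) (.seq (.sub 4 3 z) (.while 4 (.seq c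
    (.seq (.const 4 1) (.seq (.add z z 4) (.sub 4 3 z))))))

/-- The invariant rule for counting loops. Between two runs of the body the loop itself writes the
counter and register `4`, so `hst` asks that the invariant does not depend on them. A round costs
four steps beyond the body: three instructions that advance the counter, and the test. -/
theorem loop_ok {z : ℕ} {c : Prog} {s : MState} {n Tb : ℕ} (hz : 5 < z) (hn : s.reg 3 = n)
    (Inv : ℕ → MState → Prop) (h0 : Inv 0 s)
    (hst : ∀ i s' a b, Inv i s' →
      Inv i { s' with reg := Function.update (Function.update s'.reg z a) 4 b })
    (hb : ∀ i < n, ∀ s', Inv i s' → s'.reg z = i → s'.reg 3 = n →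
      c.Ok s' Tb fun s'' => s''.reg z = i ∧ s''.reg 3 = n ∧ Inv (i + 1) s'') :
    (loop z c).Ok s (n * (Tb + 4) + 3) fun s' => Inv n s' ∧ s'.reg 3 = n := by
  have hz4 : z ≠ 4 := by omega
  have hz3 : (3 : ℕ) ≠ z := by omega
  -- Induction on the number `k` of rounds that are left, which is the content of the test register
  -- `4`.
  have key : ∀ k i s', i + k = n → Inv i s' → s'.reg z = i → s'.reg 3 = n → s'.reg 4 = k →
      (Prog.while 4 (.seq c (.seq (.const 4 1) (.seq (.add z z 4) (.sub 4 3 z))))).Ok s'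
        (k * (Tb + 4) + 1) fun s' => Inv n s' ∧ s'.reg 3 = n := by
    intro k
    induction k with
    | zero =>
      intro i s' hi hI _ h3 h4
      obtain rfl : i = n := by omega
      exact (Ok.while_exit h4 ⟨hI, h3⟩).le (by omega)
    | succ k ih =>
      intro i s' hi hI hzi h3 h4
      have : (Prog.while 4 (.seq c (.seq (.const 4 1) (.seq (.add z z 4) (.sub 4 3 z))))).Ok s'
        ((Tb + (1 + (1 + 1))) + (k * (Tb + 4) + 1) + 1) fun s' => Inv n s' ∧ s'.reg 3 = n := by
        refine Ok.while_step (by omega) (Ok.seq ((hb i (by omega) s' hI hzi h3).imp ?_))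
        rintro s'' ⟨h1, h2, h3⟩
        refine Ok.seq (Ok.const (Ok.seq (Ok.add (Ok.sub ?_))))
        have e := hst (i + 1) s'' (i + 1) k h3
        -- The intermediate value `1` of register `4` is overwritten, so the three instructions
        -- amount to an update of the form in `hst`.
        have : (Function.update (Function.update s''.reg z (i + 1)) 4 k) =
            Function.update (Function.update (Function.update s''.reg 4 1) z (i + 1)) 4 k := by
          funext r
          by_cases hr : r = 4
          · subst hr; simp
          · by_cases hr' : r = z
            · subst hr'; simp [hr]
            · simp [hr, hr']
        rw [this] at e
        have hk : n - (i + 1) = k := by omega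
        simp only [Function.update_self, Function.update_of_ne hz4, Function.update_of_ne hz3,
          Function.update_of_ne (show (3:ℕ) ≠ 4 by omega), h1, h2, hk]
        refine ih (i + 1) _ (by omega) e ?_ ?_ ?_
        · simp [hz4]
        · simp [hz3, h2]
        · simp
      refine this.le ?_
      ring_nf; omega
  have : (loop z c).Ok s (1 + (1 + (n * (Tb + 4) + 1))) fun s' => Inv n s' ∧ s'.reg 3 = n := by
    refine Ok.seq (Ok.const (Ok.seq (Ok.sub ?_)))
    have e := hst 0 s 0 n h0
    simp only [Function.update_self, Function.update_of_ne hz3, hn, Nat.sub_zero]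
    exact key n 0 _ (by omega) e (by simp [hz4]) (by simp [hz3, hn]) (by simp)
  exact this.le (by omega)

end Prog

/-! ## First-order formulas over arrays -/

/-- First-order formulas about the arrays of a machine, with de Bruijn levels as variables. -/
inductive Fm where
  | lt (i j : ℕ)
  /-- `a b [i] ≠ 0` -/
  | mem (b i : ℕ)
  /-- `a b [a r [i] + a c [j]] ≠ 0` -/
  | mat (b r c i j : ℕ)
  | not (φ : Fm)
  | and (φ ψ : Fm)
  | ex (φ : Fm)

namespace Fm

/-- All free variables are less than `d`. -/
def wf : ℕ → Fm → Bool
  | d, lt i j => decide (i < d ∧ j < d)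
  | d, mem _ i => decide (i < d)
  | d, mat _ _ _ i j => decide (i < d ∧ j < d)
  | d, not φ => wf d φ
  | d, and φ ψ => wf d φ && wf d ψ
  | d, ex φ => wf (d + 1) φ

/-- The formula does not read the array `a`. -/
def avoids (a : ℕ) : Fm → Bool
  | lt _ _ => true
  | mem b _ => decide (b ≠ a)
  | mat b r c _ _ => decide (b ≠ a ∧ r ≠ a ∧ c ≠ a)
  | not φ => avoids a φ
  | and φ ψ => avoids a φ && avoids a ψ
  | ex φ => avoids a φ

/-- Truth of a formula, with quantifiers over `{0, …, n - 1}`, for the arrays `A` and the values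
`e` of the variables. -/
def sat (A : ℕ → ℕ → ℕ) (n : ℕ) : ℕ → Fm → (ℕ → ℕ) → Prop
  | _, lt i j, e => e i < e j
  | _, mem b i, e => A b (e i) ≠ 0
  | _, mat b r c i j, e => A b (A r (e i) + A c (e j)) ≠ 0
  | d, not φ, e => ¬ sat A n d φ e
  | d, and φ ψ, e => sat A n d φ e ∧ sat A n d ψ e
  | d, ex φ, e => ∃ x < n, sat A n (d + 1) φ (Function.update e d x)

/-- Truth depends only on the free variables and on the arrays that are read. This makes it harmless
that registers of higher variables contain leftovers, and that the target array of a comprehension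
changes while the formula is still being evaluated. -/
theorem sat_congr {A B : ℕ → ℕ → ℕ} {n : ℕ} {φ : Fm} : ∀ {d : ℕ} {e e' : ℕ → ℕ},
    φ.wf d → (∀ b, φ.avoids b = true ∨ A b = B b) → (∀ i < d, e i = e' i) →
    (sat A n d φ e ↔ sat B n d φ e') := by
  induction φ with
  | lt i j =>
    intro d e e' h _ he
    simp only [wf, decide_eq_true_eq] at h
    simp only [sat, he i h.1, he j h.2]
  | mem b i =>
    intro d e e' h hA he
    simp only [wf, decide_eq_true_eq] at h
    have := hA b
    simp only [avoids, decide_eq_true_eq] at this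
    simp only [sat, he i h, this.resolve_left (by simp)]
  | mat b r c i j =>
    intro d e e' h hA he
    simp only [wf, decide_eq_true_eq] at h
    have h1 := hA b
    have h2 := hA r
    have h3 := hA c
    simp only [avoids, decide_eq_true_eq] at h1 h2 h3
    simp only [sat, he i h.1, he j h.2, h1.resolve_left (by simp), h2.resolve_left (by simp),
      h3.resolve_left (by simp)]
  | not φ ih =>
    intro d e e' h hA he
    simp only [sat]
    rw [ih h hA he]
  | and φ ψ ih ih' =>
    intro d e e' h hA he
    simp only [wf, Bool.and_eq_true] at h
    simp only [avoids, Bool.and_eq_true] at hA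
    simp only [sat]
    rw [ih h.1 (fun b => (hA b).imp_left And.left) he,
      ih' h.2 (fun b => (hA b).imp_left And.right) he]
  | ex φ ih =>
    intro d e e' h hA he
    simp only [sat]
    refine exists_congr fun x => and_congr_right fun _ => ih h hA fun i hi => ?_
    by_cases hd : i = d
    · subst hd; simp
    · simp [hd, he i (by omega)]

/-- The program that evaluates a formula, and puts a number that is not `0` into the register `5`
iff the formula holds. -/
def ev : ℕ → Fm → Prog
  | _, lt i j => .sub 5 (10 + j) (10 + i)
  | _, mem b i => .load 5 b (10 + i)
  | _, mat b r c i j => .seq (.load 4 r (10 + i)) (.seq (.load 5 c (10 + j))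
      (.seq (.add 4 4 5) (.load 5 b 4)))
  | d, not φ => .seq (ev d φ) (.ite 5 (.const 5 0) (.const 5 1))
  | d, and φ ψ => .seq (ev d φ) (.ite 5 (ev d ψ) (.const 5 0))
  | d, ex φ => .seq (.const (10 + d) 0) (.seq (.const 5 0) (.seq (.sub 4 3 (10 + d))
      (.while 4 (.seq (ev (d + 1) φ) (.ite 5 (.const 4 0)
        (.seq (.const 4 1) (.seq (.add (10 + d) (10 + d) 4) (.sub 4 3 (10 + d)))))))))

/-- A bound for the time of the evaluation. -/
def cost (n : ℕ) : Fm → ℕ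
  | lt _ _ => 1
  | mem _ _ => 1
  | mat _ _ _ _ _ => 4
  | not φ => cost n φ + 2
  | and φ ψ => cost n φ + cost n ψ + 2
  | ex φ => n * (cost n φ + 5) + 4

theorem cost_pos (n : ℕ) (φ : Fm) : 0 < cost n φ := by
  cases φ <;> simp [cost]

end Fm

/-- `s'` differs from `s` at most in the values of the registers `4`, `5`, and of those of the
variables `d, d + 1, …`. -/
structure MState.Same (d : ℕ) (s s' : MState) : Prop where
  arr : s'.arr = s.arr
  out : s'.out = s.out
  cur : s'.cur = s.cur
  reg : ∀ r < 10 + d, r ≠ 4 → r ≠ 5 → s'.reg r = s.reg r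

theorem MState.Same.refl (d : ℕ) (s : MState) : s.Same d s := ⟨rfl, rfl, rfl, fun _ _ _ _ => rfl⟩

theorem MState.Same.trans {d : ℕ} {s s' s'' : MState} (h : s.Same d s') (h' : s'.Same d s'') :
    s.Same d s'' :=
  ⟨h'.arr.trans h.arr, h'.out.trans h.out, h'.cur.trans h.cur,
    fun r h1 h2 h3 => (h'.reg r h1 h2 h3).trans (h.reg r h1 h2 h3)⟩

theorem MState.Same.mono {d d' : ℕ} {s s' : MState} (h : s.Same d s') (hd : d' ≤ d) :
    s.Same d' s' :=
  ⟨h.arr, h.out, h.cur, fun r h1 h2 h3 => h.reg r (by omega) h2 h3⟩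

theorem MState.Same.update {d r v : ℕ} {s s' : MState} (h : s.Same d s')
    (hr : r = 4 ∨ r = 5 ∨ 10 + d ≤ r) :
    s.Same d { s' with reg := Function.update s'.reg r v } :=
  ⟨h.arr, h.out, h.cur, fun x h1 h2 h3 =>
    (Function.update_of_ne (by omega) _ _).trans (h.reg x h1 h2 h3)⟩

/-- The values of the variables in a state. -/
def MState.env (s : MState) : ℕ → ℕ := fun i => s.reg (10 + i)

namespace Fm

/-- Induction on the formula. The variables below `d` survive every evaluation; a quantifier uses
the register of variable `d` as the counter of its search, and `Same d` permits this to be lost. -/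
theorem ev_ok {φ : Fm} : ∀ {d : ℕ} {s : MState}, φ.wf d →
    (φ.ev d).Ok s (φ.cost (s.reg 3)) fun s' => s.Same d s' ∧
      (s'.reg 5 ≠ 0 ↔ φ.sat s.arr (s.reg 3) d s.env) := by
  induction φ with
  | lt i j =>
    intro d s _
    refine Prog.Ok.sub ⟨(MState.Same.refl d s).update (by omega), ?_⟩
    simp only [Function.update_self, sat, MState.env]
    omega
  | mem b i =>
    intro d s _
    refine Prog.Ok.load ⟨(MState.Same.refl d s).update (by omega), ?_⟩
    simp [sat, MState.env]
  | mat b r c i j =>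
    intro d s _
    refine Prog.Ok.seq (T := 1) (T' := 3) (Prog.Ok.load (Prog.Ok.seq (T := 1) (T' := 2)
      (Prog.Ok.load (Prog.Ok.seq (Prog.Ok.add (Prog.Ok.load ⟨?_, ?_⟩))))))
    · exact ((((MState.Same.refl d s).update (by omega)).update (by omega)).update
        (by omega)).update (by omega)
    · have h : 10 + j ≠ 4 := by omega
      simp [sat, MState.env, h]
  | not φ ih =>
    intro d s h
    refine Prog.Ok.seq ((ih (d := d) (s := s) h).imp ?_)
    rintro s' ⟨h1, h2⟩
    refine Prog.Ok.ite (fun h5 => Prog.Ok.const ⟨h1.update (by omega), ?_⟩)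
      (fun h5 => Prog.Ok.const ⟨h1.update (by omega), ?_⟩)
    · simp only [sat, ← h2, Function.update_self]; simp [h5]
    · simp only [sat, ← h2, Function.update_self]; simp [h5]
  | and φ ψ ih ih' =>
    intro d s h
    simp only [wf, Bool.and_eq_true] at h
    refine (Prog.Ok.seq (T' := cost (s.reg 3) ψ + 1) ((ih (d := d) (s := s) h.1).imp ?_)).le
      (by simp only [cost]; omega)
    rintro s' ⟨h1, h2⟩
    have h3 : s'.reg 3 = s.reg 3 := h1.reg 3 (by omega) (by omega) (by omega)
    refine Prog.Ok.ite (fun h5 => ?_) (fun h5 => (Prog.Ok.const (Q := _)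
      ⟨h1.update (by omega), ?_⟩).le (cost_pos _ _))
    · rw [← h3]
      refine (ih' (d := d) (s := s') h.2).imp ?_
      rintro s'' ⟨h4, h6⟩
      refine ⟨h1.trans h4, ?_⟩
      rw [h6]
      simp only [sat]
      rw [h3, ← h2, h1.arr]
      simp only [ne_eq, h5, not_false_eq_true, true_and]
      exact sat_congr h.2 (fun _ => Or.inr rfl) fun i hi =>
        h1.reg _ (by omega) (by omega) (by omega)
    · simp only [sat, ← h2, h5, Function.update_self]; simp
  | ex φ ih =>
    intro d s h
    have hd4 : 10 + d ≠ 4 := by omega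
    have hd5 : 10 + d ≠ 5 := by omega
    have hd3 : 3 ≠ 10 + d := by omega
    -- With `k` candidates left, beginning with `z`, the claim concerns only witnesses `x ≥ z`.
    -- Register `5` is `0` on entry, which is the right answer when no candidate is left.
    have key : ∀ k z s', z + k = s.reg 3 → s'.reg (10 + d) = z → s'.reg 4 = k → s'.reg 5 = 0 →
        s.Same d s' →
        (Prog.while 4 (.seq (ev (d + 1) φ) (.ite 5 (.const 4 0)
          (.seq (.const 4 1) (.seq (.add (10 + d) (10 + d) 4) (.sub 4 3 (10 + d))))))).Ok s'
          (k * (cost (s.reg 3) φ + 5) + 1) fun s'' => s.Same d s'' ∧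
            (s''.reg 5 ≠ 0 ↔ ∃ x < s.reg 3, z ≤ x ∧
              φ.sat s.arr (s.reg 3) (d + 1) (Function.update s.env d x)) := by
      intro k
      induction k with
      | zero =>
        intro z s' hz _ h4 h5 hs
        refine (Prog.Ok.while_exit h4 ⟨hs, ?_⟩).le (by omega)
        simp only [h5, ne_eq, not_true_eq_false, false_iff]
        rintro ⟨x, hx, hx', _⟩
        omega
      | succ k ihk =>
        intro z s' hz hz' h4 h5 hs
        have h3 : s'.reg 3 = s.reg 3 := hs.reg 3 (by omega) (by omega) (by omega)
        have hsat : ∀ u, u = z → (φ.sat s'.arr (s'.reg 3) (d + 1) s'.env ↔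
            φ.sat s.arr (s.reg 3) (d + 1) (Function.update s.env d u)) := by
          rintro u rfl
          rw [h3, hs.arr]
          refine sat_congr h (fun _ => Or.inr rfl) fun i hi => ?_
          by_cases hid : i = d
          · subst hid; simp [MState.env, hz']
          · rw [Function.update_of_ne hid]
            exact hs.reg _ (by omega) (by omega) (by omega)
        have main : (Prog.while 4 (.seq (ev (d + 1) φ) (.ite 5 (.const 4 0)
          (.seq (.const 4 1) (.seq (.add (10 + d) (10 + d) 4) (.sub 4 3 (10 + d))))))).Ok s'
          ((cost (s'.reg 3) φ + (3 + 1)) + (k * (cost (s.reg 3) φ + 5) + 1) + 1)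
          fun s'' => s.Same d s'' ∧
            (s''.reg 5 ≠ 0 ↔ ∃ x < s.reg 3, z ≤ x ∧
              φ.sat s.arr (s.reg 3) (d + 1) (Function.update s.env d x)) := by
          refine Prog.Ok.while_step (by omega) (Prog.Ok.seq ((ih (d := d + 1) (s := s') h).imp ?_))
          rintro s1 ⟨h1, h2⟩
          rw [hsat z rfl] at h2
          have hz1 : s1.reg (10 + d) = z := by
            rw [h1.reg _ (by omega) (by omega) (by omega), hz']
          have h31 : s1.reg 3 = s.reg 3 := by
            rw [h1.reg _ (by omega) (by omega) (by omega), h3]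
          refine Prog.Ok.ite (fun h51 => ?_) (fun h51 => ?_)
          -- A witness is found: clearing the test register ends the search, and register `5` keeps
          -- its nonzero value.
          · refine (Prog.Ok.const (Q := _) (?_)).le (by omega : 1 ≤ 3)
            refine (Prog.Ok.while_exit (by simp) ⟨?_, ?_⟩).le (by omega)
            · exact (hs.trans (h1.mono (by omega))).update (by omega)
            · simp only [Function.update_of_ne (show (5 : ℕ) ≠ 4 by omega)]
              exact ⟨fun _ => ⟨z, by omega, le_rfl, h2.1 h51⟩, fun _ => h51⟩
          · refine Prog.Ok.seq (T := 1) (T' := 2) (Prog.Ok.const (Prog.Ok.seq (Prog.Ok.add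
              (Prog.Ok.sub ?_))))
            refine (ihk (z + 1) _ (by omega) ?_ ?_ ?_ ?_).imp ?_
            · simp [hd4, hz1]
            · simp [hd4, hd3, hz1, h31]; omega
            · simp [hd5.symm, h51]
            · exact (((hs.trans (h1.mono (by omega))).update (by omega)).update
                (by omega)).update (by omega)
            · rintro s2 ⟨h6, h7⟩
              refine ⟨h6, h7.trans ?_⟩
              constructor
              · rintro ⟨x, hx, hx', hxs⟩
                exact ⟨x, hx, by omega, hxs⟩
              · rintro ⟨x, hx, hx', hxs⟩
                refine ⟨x, hx, ?_, hxs⟩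
                rcases hx'.eq_or_lt with rfl | hlt
                · exact absurd h51 (h2.2 hxs)
                · exact hlt
        refine main.le ?_
        rw [h3]; ring_nf; omega
    have main : ((ex φ).ev d).Ok s (1 + (1 + (1 + (s.reg 3 * (cost (s.reg 3) φ + 5) + 1))))
        fun s' => s.Same d s' ∧ (s'.reg 5 ≠ 0 ↔ (ex φ).sat s.arr (s.reg 3) d s.env) := by
      refine Prog.Ok.seq (Prog.Ok.const (Prog.Ok.seq (Prog.Ok.const (Prog.Ok.seq
        (Prog.Ok.sub ?_)))))
      refine (key (s.reg 3) 0 _ (by omega) ?_ ?_ ?_ ?_).imp ?_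
      · simp [hd4, hd5]
      · simp [hd5, hd3]
      · simp
      · exact (((MState.Same.refl d s).update (by omega)).update (by omega)).update (by omega)
      · rintro s' ⟨h1, h2⟩
        refine ⟨h1, h2.trans ?_⟩
        simp [sat]
    exact main.le (by simp only [cost]; omega)

theorem ev_ok_of_eq {φ : Fm} {d n : ℕ} {s : MState} (hφ : φ.wf d) (hn : s.reg 3 = n) :
    (φ.ev d).Ok s (φ.cost n) fun s' => s.Same d s' ∧
      (s'.reg 5 ≠ 0 ↔ φ.sat s.arr n d s.env) := by
  subst hn
  exact ev_ok hφ

/-- The costs of a formula are polynomial in the size of the domain. -/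
theorem exists_cost_le (φ : Fm) : ∃ p : Polynomial ℕ, ∀ n, φ.cost n = p.eval n := by
  induction φ with
  | lt i j => exact ⟨1, fun n => by simp [cost]⟩
  | mem b i => exact ⟨1, fun n => by simp [cost]⟩
  | mat b r c i j => exact ⟨Polynomial.C 4, fun n => by simp [cost]⟩
  | not φ ih =>
    obtain ⟨p, hp⟩ := ih
    exact ⟨p + Polynomial.C 2, fun n => by simp [cost, hp]⟩
  | and φ ψ ih ih' =>
    obtain ⟨p, hp⟩ := ih
    obtain ⟨q, hq⟩ := ih'
    exact ⟨p + q + Polynomial.C 2, fun n => by simp [cost, hp, hq]⟩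
  | ex φ ih =>
    obtain ⟨p, hp⟩ := ih
    exact ⟨Polynomial.X * (p + Polynomial.C 5) + Polynomial.C 4, fun n => by simp [cost, hp]⟩

end Fm

/-! ## Comprehension, ranking and output -/

/-- `s'` and `s` agree in all arrays and all registers, except for the registers `4`, `5`, and
those of the variables `d, d + 1, …`. -/
structure MState.Quiet (d : ℕ) (s s' : MState) : Prop where
  arr : s'.arr = s.arr
  reg : ∀ r < 10 + d, r ≠ 4 → r ≠ 5 → s'.reg r = s.reg r

/-- `s'` differs from `s` at most in the arrays in `B`, the values of the registers `4, …, 8`, and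
of those of the variables `d, d + 1, …`. -/
structure MState.SameOff (d : ℕ) (B : List ℕ) (s s' : MState) : Prop where
  arr : ∀ b ∉ B, s'.arr b = s.arr b
  out : s'.out = s.out
  cur : s'.cur = s.cur
  reg : ∀ r < 10 + d, r < 4 ∨ 8 < r → s'.reg r = s.reg r

namespace MState

theorem Same.quiet {d : ℕ} {s s' : MState} (h : s.Same d s') : s.Quiet d s' := ⟨h.arr, h.reg⟩

theorem Quiet.refl (d : ℕ) (s : MState) : s.Quiet d s := ⟨rfl, fun _ _ _ _ => rfl⟩

theorem Quiet.trans {d : ℕ} {s s' s'' : MState} (h : s.Quiet d s') (h' : s'.Quiet d s'') :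
    s.Quiet d s'' :=
  ⟨h'.arr.trans h.arr, fun r h1 h2 h3 => (h'.reg r h1 h2 h3).trans (h.reg r h1 h2 h3)⟩

theorem Quiet.mono {d d' : ℕ} {s s' : MState} (h : s.Quiet d s') (hd : d' ≤ d) : s.Quiet d' s' :=
  ⟨h.arr, fun r h1 h2 h3 => h.reg r (by omega) h2 h3⟩

theorem Quiet.update {d r v : ℕ} {s s' : MState} (h : s.Quiet d s')
    (hr : r = 4 ∨ r = 5 ∨ 10 + d ≤ r) :
    s.Quiet d { s' with reg := Function.update s'.reg r v } :=
  ⟨h.arr, fun x h1 h2 h3 =>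
    (Function.update_of_ne (by omega) _ _).trans (h.reg x h1 h2 h3)⟩

theorem Same.sameOff {d : ℕ} {s s' : MState} (B : List ℕ) (h : s.Same d s') : s.SameOff d B s' :=
  ⟨fun _ _ => by rw [h.arr], h.out, h.cur, fun r h1 h2 => h.reg r h1 (by omega) (by omega)⟩

theorem SameOff.refl (d : ℕ) (B : List ℕ) (s : MState) : s.SameOff d B s :=
  ⟨fun _ _ => rfl, rfl, rfl, fun _ _ _ => rfl⟩

theorem SameOff.trans {d : ℕ} {B : List ℕ} {s s' s'' : MState} (h : s.SameOff d B s')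
    (h' : s'.SameOff d B s'') : s.SameOff d B s'' :=
  ⟨fun b hb => (h'.arr b hb).trans (h.arr b hb), h'.out.trans h.out, h'.cur.trans h.cur,
    fun r h1 h2 => (h'.reg r h1 h2).trans (h.reg r h1 h2)⟩

theorem SameOff.mono {d d' : ℕ} {B B' : List ℕ} {s s' : MState} (h : s.SameOff d B s')
    (hd : d' ≤ d) (hB : B ⊆ B') : s.SameOff d' B' s' :=
  ⟨fun b hb => h.arr b fun hb' => hb (hB hb'), h.out, h.cur, fun r h1 h2 => h.reg r (by omega) h2⟩

theorem SameOff.update {d r v : ℕ} {B : List ℕ} {s s' : MState} (h : s.SameOff d B s')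
    (hr : (4 ≤ r ∧ r ≤ 8) ∨ 10 + d ≤ r) :
    s.SameOff d B { s' with reg := Function.update s'.reg r v } :=
  ⟨h.arr, h.out, h.cur, fun x h1 h2 =>
    (Function.update_of_ne (by omega) _ _).trans (h.reg x h1 h2)⟩

theorem SameOff.store {d b : ℕ} {f : ℕ → ℕ} {B : List ℕ} {s s' : MState} (h : s.SameOff d B s')
    (hb : b ∈ B) : s.SameOff d B { s' with arr := Function.update s'.arr b f } :=
  ⟨fun c hc => (Function.update_of_ne (by rintro rfl; exact hc hb) _ _).trans (h.arr c hc),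
    h.out, h.cur, h.reg⟩

end MState

namespace Prog

/-- `a b [z] := [φ(z)]` for all `z < r 3`, where `z` is the variable `d` -/
def compr (d b : ℕ) (φ : Fm) : Prog :=
  loop (10 + d) (.seq (φ.ev (d + 1)) (.store b (10 + d) 5))

/-- The formula must avoid the array `b`, whose old content is destroyed entry by entry. Updates of
a set in terms of itself therefore go through an auxiliary array that is copied afterwards. -/
theorem compr_ok {d b n : ℕ} {φ : Fm} {s : MState} (hφ : φ.wf (d + 1)) (hb : φ.avoids b)
    (hn : s.reg 3 = n) :
    (compr d b φ).Ok s (n * (φ.cost n + 5) + 3) fun s' => s.SameOff d [b] s' ∧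
      ∀ x < n, (s'.arr b x ≠ 0 ↔ φ.sat s.arr n (d + 1) (Function.update s.env d x)) := by
  refine ((loop_ok (Tb := φ.cost n + 1) (by omega) hn (fun i s' => s.SameOff d [b] s' ∧
    ∀ x < i, (s'.arr b x ≠ 0 ↔ φ.sat s.arr n (d + 1) (Function.update s.env d x)))
    ⟨.refl _ _ _, by simp⟩ ?_ ?_).imp fun s' h => h.1)
  · rintro i s' x y ⟨h1, h2⟩
    exact ⟨(h1.update (v := x) (.inr le_rfl)).update (.inl (by omega)), h2⟩
  · rintro i hi s' ⟨h1, h2⟩ hz h3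
    refine Ok.seq ?_
    refine (Fm.ev_ok_of_eq hφ h3).imp ?_
    rintro s1 ⟨h4, h5⟩
    have hz1 : s1.reg (10 + d) = i := (h4.reg _ (by omega) (by omega) (by omega)).trans hz
    refine Ok.store ⟨hz1, ?_, ?_, ?_⟩
    · exact (h4.reg 3 (by omega) (by omega) (by omega)).trans h3
    · exact ((h1.trans ((h4.mono (by omega)).sameOff _)).store (by simp))
    · intro x hx
      simp only [Function.update_self, hz1]
      by_cases hxi : x = i
      · subst hxi
        rw [Function.update_self, h5]
        refine Fm.sat_congr hφ (fun c => ?_) fun j hj => ?_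
        · by_cases hc : c = b
          · subst hc; exact Or.inl hb
          · exact Or.inr (h1.arr c (by simpa using hc))
        · by_cases hjd : j = d
          · subst hjd; simp [MState.env, hz]
          · rw [Function.update_of_ne hjd]
            exact h1.reg _ (by omega) (by omega)
      · rw [Function.update_of_ne hxi, h4.arr]
        exact h2 x (by omega)

/-- Write into `a k [z]` the number of the `y < z` in the set given by the array `a`, and into
`a r [z]` that number times `r 8`. Afterwards `r 6` is the size of the set. -/
def rank (d a k r : ℕ) : Prog :=
  .seq (.const 6 0) (.seq (.const 7 0) (loop (10 + d) (.seq (.store k (10 + d) 6)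
    (.seq (.store r (10 + d) 7) (.seq (.load 5 a (10 + d)) (.ite 5
      (.seq (.const 4 1) (.seq (.add 6 6 4) (.add 7 7 8))) (.const 4 0)))))))

/-- In the absence of multiplication, register `7` accumulates `m` times the count by adding `m`
whenever the count in register `6` grows. Such multiples serve as row offsets of matrices. -/
theorem rank_ok {d a k r n m : ℕ} {s : MState} (hak : a ≠ k) (har : a ≠ r) (hkr : k ≠ r)
    (hn : s.reg 3 = n) (hm : s.reg 8 = m) :
    (rank d a k r).Ok s (n * 11 + 5) fun s' => s.SameOff d [k, r] s' ∧
      s'.reg 6 = Nat.count (fun x => s.arr a x ≠ 0) n ∧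
      ∀ x < n, s'.arr k x = Nat.count (fun x => s.arr a x ≠ 0) x ∧
        s'.arr r x = m * Nat.count (fun x => s.arr a x ≠ 0) x := by
  set p : ℕ → Prop := fun x => s.arr a x ≠ 0 with hp
  refine (Ok.seq (T := 1) (T' := 1 + (n * (7 + 4) + 3)) (Ok.const (Ok.seq (Ok.const ?_)))).le
    (by omega)
  refine ((loop_ok (Tb := 7) (by omega) (by simpa using hn) (fun i s' => s.SameOff d [k, r] s' ∧
    s'.reg 8 = m ∧ s'.reg 6 = Nat.count p i ∧ s'.reg 7 = m * Nat.count p i ∧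
      ∀ x < i, s'.arr k x = Nat.count p x ∧ s'.arr r x = m * Nat.count p x) ?_ ?_ ?_).imp
        fun s' h => ⟨h.1.1, h.1.2.2.1, h.1.2.2.2.2⟩)
  · refine ⟨((MState.SameOff.refl _ _ _).update (by omega)).update (by omega), ?_⟩
    simp [hm]
  · rintro i s' x y ⟨h1, h2, h3, h4, h5⟩
    refine ⟨(h1.update (v := x) (.inr le_rfl)).update (.inl (by omega)), ?_, ?_, ?_, h5⟩
    · rw [← h2]; simp; rw [Function.update_of_ne (by omega)]
    · rw [← h3]; simp; rw [Function.update_of_ne (by omega)]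
    · rw [← h4]; simp; rw [Function.update_of_ne (by omega)]
  · rintro i hi s' ⟨h1, h2, h3, h4, h5⟩ hz hn'
    have ha : s'.arr a = s.arr a := h1.arr a (by simp [hak, har])
    have hd4 : 10 + d ≠ 4 := by omega
    have hd5 : 10 + d ≠ 5 := by omega
    have hd6 : 10 + d ≠ 6 := by omega
    have hd7 : 10 + d ≠ 7 := by omega
    have harr : ∀ x < i + 1, Function.update (s'.arr k) i (Nat.count p i) x = Nat.count p x ∧
        Function.update (s'.arr r) i (m * Nat.count p i) x = m * Nat.count p x := by
      intro x hx
      by_cases hxi : x = i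
      · subst hxi; simp
      · simpa [hxi] using h5 x (by omega)
    refine Ok.seq (T := 1) (T' := 6) (Ok.store (Ok.seq (T := 1) (T' := 5) (Ok.store (Ok.seq
      (T := 1) (T' := 4) (Ok.load (Ok.ite (T := 3) (fun h => ?_) (fun h => ?_)))))))
    · simp only [Function.update_self, hz, Function.update_of_ne har, Function.update_of_ne hak,
        ha] at h
      have hpi : p i := h
      refine Ok.seq (T := 1) (T' := 2) (Ok.const (Ok.seq (Ok.add (Ok.add ⟨?_, ?_, ?_, ?_, ?_, ?_, ?_⟩))))
      · simp [hd4, hd5, hd6, hd7, hz]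
      · simp [hn']
      · refine ((((MState.SameOff.update ?_ (by omega)).update (by omega)).update (by omega)).update
          (by omega))
        exact (h1.store (b := k) (by simp)).store (b := r) (by simp)
      · simp [h2]
      · simp [h3, Nat.count_succ, hpi]
      · simp [h4, h2, Nat.count_succ, hpi, mul_add]
      · simpa [hz, h3, h4, hkr, hkr.symm] using harr
    · simp only [Function.update_self, hz, Function.update_of_ne har, Function.update_of_ne hak,
        ha] at h
      have hpi : ¬ p i := fun h' => h' h
      refine (Ok.const (Q := _) ⟨?_, ?_, ?_, ?_, ?_, ?_, ?_⟩).le (by omega)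
      · simp [hd4, hd5, hz]
      · simp [hn']
      · refine ((MState.SameOff.update ?_ (by omega)).update (by omega))
        exact (h1.store (b := k) (by simp)).store (b := r) (by simp)
      · simp [h2]
      · simp [h3, Nat.count_succ, hpi]
      · simp [h4, Nat.count_succ, hpi]
      · simpa [hz, h3, h4, hkr, hkr.symm] using harr

/-! ### Guarded loops and the printing of matrices -/

/-- `for` all `z < r 3` that satisfy `γ` `do c`, where `z` is the variable `d` -/
def gloop (d : ℕ) (γ : Fm) (c : Prog) : Prog :=
  loop (10 + d) (.seq (γ.ev (d + 1)) (.ite 5 c (.const 5 0)))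

-- The body leaves the arrays and the lower registers alone, so the guard can be read in the initial
-- state throughout. The only lasting effect is on the output, where the loop acts as a left fold of
-- `f` over the indices that pass the guard.
open Classical in
theorem gloop_ok {d n Tb : ℕ} {γ : Fm} {c : Prog} {s : MState} (hγ : γ.wf (d + 1))
    (hn : s.reg 3 = n) (hT : 0 < Tb) (f : ℕ → List Word × Word → List Word × Word)
    (hc : ∀ i < n, γ.sat s.arr n (d + 1) (Function.update s.env d i) → ∀ s', s.Quiet d s' →
      s'.reg (10 + d) = i → c.Ok s' Tb fun s'' => s'.Quiet (d + 1) s'' ∧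
        (s''.out, s''.cur) = f i (s'.out, s'.cur)) :
    (gloop d γ c).Ok s (n * (γ.cost n + Tb + 5) + 3) fun s' => s.Quiet d s' ∧
      (s'.out, s'.cur) = ((List.range n).filter fun i =>
        γ.sat s.arr n (d + 1) (Function.update s.env d i)).foldl (fun oc i => f i oc)
          (s.out, s.cur) := by
  refine ((loop_ok (Tb := γ.cost n + (Tb + 1)) (by omega) hn (fun i s' => s.Quiet d s' ∧
    (s'.out, s'.cur) = ((List.range i).filter fun i =>
        γ.sat s.arr n (d + 1) (Function.update s.env d i)).foldl (fun oc i => f i oc)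
          (s.out, s.cur)) ⟨.refl _ _, by simp⟩ ?_ ?_).imp fun s' h => h.1).le
            (by ring_nf; omega)
  · rintro i s' x y ⟨h1, h2⟩
    exact ⟨(h1.update (v := x) (by omega)).update (by omega), h2⟩
  · rintro i hi s' ⟨h1, h2⟩ hz h3
    refine Ok.seq ?_
    refine (Fm.ev_ok_of_eq hγ h3).imp ?_
    rintro s1 ⟨h4, h5⟩
    have hsat : γ.sat s'.arr n (d + 1) s'.env ↔
        γ.sat s.arr n (d + 1) (Function.update s.env d i) := by
      rw [h1.arr]
      refine Fm.sat_congr hγ (fun c => Or.inr rfl) fun j hj => ?_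
      by_cases hjd : j = d
      · subst hjd; simp [MState.env, hz]
      · rw [Function.update_of_ne hjd]
        exact h1.reg _ (by omega) (by omega) (by omega)
    have hz1 : s1.reg (10 + d) = i := (h4.reg _ (by omega) (by omega) (by omega)).trans hz
    have h31 : s1.reg 3 = n := (h4.reg _ (by omega) (by omega) (by omega)).trans h3
    have hq : s.Quiet d s1 := h1.trans (h4.quiet.mono (by omega))
    refine Ok.ite (fun h => ?_) (fun h => (Ok.const (Q := _) ?_).le hT)
    · have hs := hsat.1 (h5.1 h)
      refine (hc i hi hs s1 hq hz1).imp ?_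
      rintro s2 ⟨h6, h7⟩
      refine ⟨(h6.reg _ (by omega) (by omega) (by omega)).trans hz1,
        (h6.reg _ (by omega) (by omega) (by omega)).trans h31,
        hq.trans (h6.mono (by omega)), ?_⟩
      rw [h7, h4.out, h4.cur, h2, List.range_succ, List.filter_append, List.foldl_append]
      simp [hs]
    · have hs : ¬ γ.sat s.arr n (d + 1) (Function.update s.env d i) :=
        fun hs => (h5.2 (hsat.2 hs)) h
      refine ⟨?_, ?_, hq.update (by omega), ?_⟩
      · simpa [show 10 + d ≠ 5 by omega] using hz1
      · simpa using h31
      · rw [List.range_succ, List.filter_append, List.foldl_append]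
        simp [hs, ← h2, h4.out, h4.cur]

/-- Write the bits `χ(i, j)`, for all `i` and all `j` that satisfy `γ`. -/
def printMat (d : ℕ) (γ γ' χ : Fm) : Prog :=
  gloop d γ (gloop (d + 1) γ' (.seq (χ.ev (d + 2)) (.print 5)))

/-- A time bound for `printMat`. -/
def printTime (n : ℕ) (γ γ' χ : Fm) : ℕ :=
  n * (γ.cost n + (n * (γ'.cost n + (χ.cost n + 1) + 5) + 3) + 5) + 3

theorem foldl_append_snd {α : Type} (l : List α) (f : α → Word) (oc : List Word × Word) :
    l.foldl (fun oc i => (oc.1, oc.2 ++ f i)) oc = (oc.1, oc.2 ++ l.flatMap f) := by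
  induction l generalizing oc with
  | nil => simp
  | cons a l ih => simp [ih]

-- Rows and columns range over the same set `g`; it is given by two formulas because the index is
-- variable `d` for rows and variable `d + 1` for columns.
open Classical in
theorem printMat_ok {d n : ℕ} {γ γ' χ : Fm} {s : MState} (hγ : γ.wf (d + 1))
    (hγ' : γ'.wf (d + 2)) (hχ : χ.wf (d + 2)) (hn : s.reg 3 = n) {g : ℕ → Prop}
    (hg : ∀ i < n, (γ.sat s.arr n (d + 1) (Function.update s.env d i) ↔ g i))
    (hg' : ∀ i < n, ∀ j < n, (γ'.sat s.arr n (d + 2)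
      (Function.update (Function.update s.env d i) (d + 1) j) ↔ g j)) :
    (printMat d γ γ' χ).Ok s (printTime n γ γ' χ) fun s' => s.Quiet d s' ∧ s'.out = s.out ∧
      s'.cur = s.cur ++ ((List.range n).filter fun i => g i).flatMap fun i =>
        ((List.range n).filter fun i => g i).map fun j =>
          decide (χ.sat s.arr n (d + 2)
            (Function.update (Function.update s.env d i) (d + 1) j)) := by
  have hl : (List.range n).filter (fun i => γ.sat s.arr n (d + 1) (Function.update s.env d i)) =
      (List.range n).filter fun i => g i :=
    List.filter_congr fun i hi => by simp [hg i (List.mem_range.1 hi)]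
  refine (gloop_ok (Tb := n * (γ'.cost n + (χ.cost n + 1) + 5) + 3) hγ hn (by omega) (fun i oc =>
    (oc.1, oc.2 ++ ((List.range n).filter fun i => g i).map fun j =>
          decide (χ.sat s.arr n (d + 2)
            (Function.update (Function.update s.env d i) (d + 1) j)))) ?_).imp ?_
  · intro i hi _ s1 h1 hz
    have h31 : s1.reg 3 = n := (h1.reg _ (by omega) (by omega) (by omega)).trans hn
    have henv : ∀ j < d + 1, s1.env j = Function.update s.env d i j := by
      intro j hj
      by_cases hjd : j = d
      · subst hjd; simp [MState.env, hz]
      · rw [Function.update_of_ne hjd]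
        exact h1.reg _ (by omega) (by omega) (by omega)
    have henv' : ∀ k, ∀ j < d + 2, Function.update s1.env (d + 1) k j =
        Function.update (Function.update s.env d i) (d + 1) k j := by
      intro k j hj
      by_cases hjd : j = d + 1
      · subst hjd; simp
      · rw [Function.update_of_ne hjd, Function.update_of_ne hjd]
        exact henv j (by omega)
    have hl' : (List.range n).filter (fun j => γ'.sat s1.arr n (d + 1 + 1)
        (Function.update s1.env (d + 1) j)) = (List.range n).filter fun i => g i := by
      refine List.filter_congr fun j hj => ?_
      rw [← hg' i hi j (List.mem_range.1 hj), h1.arr]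
      exact decide_eq_decide.2 (Fm.sat_congr hγ' (fun _ => Or.inr rfl) (henv' j))
    refine (gloop_ok (Tb := χ.cost n + 1) hγ' h31 (by omega) (fun j oc =>
      (oc.1, oc.2 ++ [decide (χ.sat s.arr n (d + 2)
            (Function.update (Function.update s.env d i) (d + 1) j))])) ?_).imp ?_
    · intro j _ _ s2 h2 hz2
      have h32 : s2.reg 3 = n := (h2.reg _ (by omega) (by omega) (by omega)).trans h31
      refine Ok.seq ?_
      refine (Fm.ev_ok_of_eq hχ h32).imp ?_
      rintro s3 ⟨h3, h4⟩
      refine Ok.print ⟨⟨h3.arr, h3.reg⟩, ?_⟩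
      simp only [h3.out, h3.cur]
      congr 3
      refine decide_eq_decide.2 ((h4.trans ?_))
      rw [h2.arr, h1.arr]
      refine Fm.sat_congr hχ (fun _ => Or.inr rfl) fun k hk => ?_
      rw [← henv' j k hk]
      by_cases hkd : k = d + 1
      · subst hkd; simp [MState.env]; exact hz2
      · rw [Function.update_of_ne hkd]
        exact h2.reg _ (by omega) (by omega) (by omega)
    · rintro s2 ⟨h2, h3⟩
      refine ⟨h2, ?_⟩
      rw [h3, foldl_append_snd, hl', List.map_eq_flatMap]
  · rintro s1 ⟨h1, h2⟩
    rw [foldl_append_snd, hl, Prod.mk.injEq] at h2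
    exact ⟨h1, h2.1, h2.2⟩

end Prog

/-! ## Matching cuts of induced subgraphs, by two-colourings -/

namespace MatchingCut

section General

variable {V W : Type} (G : SimpleGraph V)

/-- In the subgraph induced by `D`, each vertex has at most one neighbour of the other colour. -/
def Good (D : Set V) (c : V → Bool) : Prop :=
  ∀ u ∈ D, ∀ v ∈ D, ∀ w ∈ D, G.Adj u v → G.Adj u w → c u ≠ c v → c u ≠ c w → v = w

/-- The bichromatic edges of the subgraph induced by `D`. -/
def cutEdges (D : Set V) (c : V → Bool) : Set (Sym2 V) :=
  {e | ∃ u ∈ D, ∃ v ∈ D, G.Adj u v ∧ c u ≠ c v ∧ e = s(u, v)}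

/-- `M` is a matching cut of the subgraph induced by `D`. -/
def IsMC (D : Set V) (M : Set (Sym2 V)) : Prop :=
  ∃ c, Good G D c ∧ (∃ u ∈ D, ∃ v ∈ D, c u ≠ c v) ∧ M = cutEdges G D c

/-- The minimal matching cuts of the subgraph induced by `D`. -/
def Sol (D : Set V) : Set (Set (Sym2 V)) := {M | Minimal (IsMC G D) M}

variable {G}

theorem mem_cutEdges {D : Set V} {c : V → Bool} {u v : V} :
    s(u, v) ∈ cutEdges G D c ↔ u ∈ D ∧ v ∈ D ∧ G.Adj u v ∧ c u ≠ c v := by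
  constructor
  · rintro ⟨a, ha, b, hb, h, hc, he⟩
    rw [Sym2.eq_iff] at he
    rcases he with ⟨rfl, rfl⟩ | ⟨rfl, rfl⟩
    · exact ⟨ha, hb, h, hc⟩
    · exact ⟨hb, ha, h.symm, hc.symm⟩
  · rintro ⟨ha, hb, h, hc⟩
    exact ⟨u, ha, v, hb, h, hc, rfl⟩

theorem Good.mono {D D' : Set V} {c : V → Bool} (h : Good G D c) (hD : D' ⊆ D) : Good G D' c :=
  fun u hu v hv w hw => h u (hD hu) v (hD hv) w (hD hw)

theorem isEdgeMatching_cutEdges {D : Set V} {c : V → Bool} :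
    IsEdgeMatching (cutEdges G D c) ↔ Good G D c := by
  constructor
  · intro h u hu v hv w hw huv huw hcv hcw
    have := h s(u, v) (mem_cutEdges.2 ⟨hu, hv, huv, hcv⟩) s(u, w)
      (mem_cutEdges.2 ⟨hu, hw, huw, hcw⟩) u (by simp) (by simp)
    simp only [Sym2.eq_iff, true_and] at this
    rcases this with h | ⟨h, h'⟩
    · exact h
    · exact h'.trans h
  · intro h e he f hf u hue huf
    obtain ⟨v, rfl⟩ := Sym2.mem_iff_exists.1 hue
    obtain ⟨w, rfl⟩ := Sym2.mem_iff_exists.1 huf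
    rw [mem_cutEdges] at he hf
    rw [h u he.1 v he.2.1 w hf.2.1 he.2.2.1 hf.2.2.1 he.2.2.2 hf.2.2.2]

theorem isMatchingCut_iff {M : Set (Sym2 V)} : IsMatchingCut G M ↔ IsMC G Set.univ M := by
  classical
  have key : ∀ (A : Set V) (c : V → Bool), (∀ x, c x = true ↔ x ∈ A) →
      edgeCut G A = cutEdges G Set.univ c := by
    intro A c hc
    ext e
    induction e using Sym2.ind with
    | _ u v =>
      rw [MCComputable.mem_edgeCut, mem_cutEdges, ← hc, ← hc]
      cases c u <;> cases c v <;> simp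
  constructor
  · rintro ⟨⟨A, ⟨u, hu⟩, ⟨v, hv⟩, rfl⟩, hM⟩
    rw [key A (fun x => decide (x ∈ A)) (by simp)] at hM ⊢
    exact ⟨_, isEdgeMatching_cutEdges.1 hM, ⟨u, trivial, v, trivial, by
      have : v ∉ A := hv
      simp [hu, this]⟩, rfl⟩
  · rintro ⟨c, hc, ⟨u, -, v, -, huv⟩, rfl⟩
    refine ⟨⟨{x | c x = true}, ?_, ?_, (key _ c (by simp)).symm⟩, isEdgeMatching_cutEdges.2 hc⟩
    · cases hu : c u
      · refine ⟨v, ?_⟩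
        cases hv : c v
        · exact absurd (hu.trans hv.symm) huv
        · exact hv
      · exact ⟨u, hu⟩
    · cases hu : c u
      · exact ⟨u, by simp [hu]⟩
      · refine ⟨v, ?_⟩
        cases hv : c v
        · simp [hv]
        · exact absurd (hu.trans hv.symm) huv

/-- Reductions take place inside one ambient graph, so that edge sets before and after can be
compared literally; this carries cuts over to a graph on another vertex type. Colourings are pulled
back along `e`, and pushed forward with an arbitrary constant off the range. -/
theorem isMC_range {H : SimpleGraph W} {e : W → V} (he : Function.Injective e)
    (hH : ∀ a b, H.Adj a b ↔ G.Adj (e a) (e b)) {M : Set (Sym2 V)} :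
    IsMC G (Set.range e) M ↔ ∃ N, IsMC H Set.univ N ∧ M = Sym2.map e '' N := by
  have key : ∀ (c : V → Bool), cutEdges G (Set.range e) c =
      Sym2.map e '' cutEdges H Set.univ (c ∘ e) := by
    intro c
    ext f
    constructor
    · rintro ⟨_, ⟨a, rfl⟩, _, ⟨b, rfl⟩, h, hc, rfl⟩
      exact ⟨s(a, b), ⟨a, trivial, b, trivial, (hH a b).2 h, hc, rfl⟩, rfl⟩
    · rintro ⟨_, ⟨a, -, b, -, h, hc, rfl⟩, rfl⟩
      exact ⟨_, ⟨a, rfl⟩, _, ⟨b, rfl⟩, (hH a b).1 h, hc, rfl⟩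
  have good : ∀ (c : V → Bool), Good G (Set.range e) c ↔ Good H Set.univ (c ∘ e) := by
    intro c
    constructor
    · intro h u _ v _ w _ huv huw hcv hcw
      exact he (h _ ⟨u, rfl⟩ _ ⟨v, rfl⟩ _ ⟨w, rfl⟩ ((hH _ _).1 huv) ((hH _ _).1 huw) hcv hcw)
    · rintro h _ ⟨u, rfl⟩ _ ⟨v, rfl⟩ _ ⟨w, rfl⟩ huv huw hcv hcw
      rw [h u trivial v trivial w trivial ((hH _ _).2 huv) ((hH _ _).2 huw) hcv hcw]
  constructor
  · rintro ⟨c, hc, ⟨_, ⟨a, rfl⟩, _, ⟨b, rfl⟩, hab⟩, rfl⟩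
    exact ⟨_, ⟨c ∘ e, (good c).1 hc, ⟨a, trivial, b, trivial, hab⟩, rfl⟩, key c⟩
  · rintro ⟨_, ⟨c, hc, ⟨a, -, b, -, hab⟩, rfl⟩, rfl⟩
    have hc' : Function.extend e c (fun _ => false) ∘ e = c :=
      funext fun a => he.extend_apply c _ a
    refine ⟨Function.extend e c fun _ => false, ?_, ⟨e a, ⟨a, rfl⟩, e b, ⟨b, rfl⟩, ?_⟩, ?_⟩
    · rwa [good, hc']
    · simpa [he.extend_apply] using hab
    · rw [key, hc']

theorem mem_sol_range {H : SimpleGraph W} {e : W → V} (he : Function.Injective e)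
    (hH : ∀ a b, H.Adj a b ↔ G.Adj (e a) (e b)) {M : Set (Sym2 V)} :
    M ∈ Sol G (Set.range e) ↔ ∃ N, IsMinimalMatchingCut H N ∧ M = Sym2.map e '' N := by
  have hinj : Function.Injective (Sym2.map e) := Sym2.map.injective he
  constructor
  · rintro ⟨h, hmin⟩
    obtain ⟨N, hN, rfl⟩ := (isMC_range he hH).1 h
    refine ⟨N, ⟨isMatchingCut_iff.2 hN, fun N' hN' hle => ?_⟩, rfl⟩
    have := hmin ((isMC_range he hH).2 ⟨N', isMatchingCut_iff.1 hN', rfl⟩) (Set.image_mono hle)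
    exact (Set.image_subset_image_iff hinj).1 this
  · rintro ⟨N, ⟨hN, hmin⟩, rfl⟩
    refine ⟨(isMC_range he hH).2 ⟨N, isMatchingCut_iff.1 hN, rfl⟩, ?_⟩
    intro M' hM' hle
    obtain ⟨N', hN', rfl⟩ := (isMC_range he hH).1 hM'
    exact Set.image_mono (hmin (isMatchingCut_iff.2 hN')
      ((Set.image_subset_image_iff hinj).1 hle))

/-- The empty set lies below every other cut. This settles disconnected graphs. -/
theorem sol_eq_of_empty {D : Set V} (h : IsMC G D ∅) : Sol G D = {∅} := by
  ext M
  constructor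
  · rintro ⟨_, hmin⟩
    exact Set.subset_empty_iff.1 (hmin h (Set.empty_subset M))
  · rintro rfl
    exact ⟨h, fun _ _ _ => Set.empty_subset _⟩

/-! ### Reduction rules -/

/-- Each deleted vertex `x` has an anchor `a x` that survives. A good colouring of `D` gives both
the same colour by `h2`; conversely a good colouring of `D'` is extended by copying the colour of
the anchor. By `h1` and `h1'` no edge at a deleted vertex is then bichromatic, so the cut is the
same set of edges in `D` and in `D'`. -/
theorem isMC_iff_of_anchor {D D' : Set V} (hsub : D' ⊆ D) (a : V → V)
    (ha : ∀ x ∈ D, x ∉ D' → a x ∈ D')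
    (h1 : ∀ c, Good G D' c → ∀ x ∈ D, x ∉ D' → ∀ y ∈ D', G.Adj x y → c y = c (a x))
    (h1' : ∀ x ∈ D, x ∉ D' → ∀ y ∈ D, y ∉ D' → G.Adj x y → a x = a y)
    (h2 : ∀ c, Good G D c → ∀ x ∈ D, x ∉ D' → c x = c (a x)) (M : Set (Sym2 V)) :
    IsMC G D M ↔ IsMC G D' M := by
  classical
  have key : ∀ c, Good G D' c → (∀ x ∈ D, x ∉ D' → c x = c (a x)) →
      ∀ u ∈ D, ∀ v ∈ D, G.Adj u v → c u ≠ c v → u ∈ D' ∧ v ∈ D' := by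
    intro c hc hca u hu v hv huv hne
    by_cases hu' : u ∈ D' <;> by_cases hv' : v ∈ D'
    · exact ⟨hu', hv'⟩
    · exact absurd ((h1 c hc v hv hv' u hu' huv.symm).trans (hca v hv hv').symm) hne
    · exact absurd ((h1 c hc u hu hu' v hv' huv).trans (hca u hu hu').symm).symm hne
    · exact absurd (by rw [hca u hu hu', hca v hv hv', h1' u hu hu' v hv hv' huv]) hne
  have cut : ∀ c, Good G D' c → (∀ x ∈ D, x ∉ D' → c x = c (a x)) →
      cutEdges G D c = cutEdges G D' c := by
    intro c hc hca
    ext e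
    constructor
    · rintro ⟨u, hu, v, hv, h, hne, rfl⟩
      obtain ⟨hu', hv'⟩ := key c hc hca u hu v hv h hne
      exact ⟨u, hu', v, hv', h, hne, rfl⟩
    · rintro ⟨u, hu, v, hv, h, hne, rfl⟩
      exact ⟨u, hsub hu, v, hsub hv, h, hne, rfl⟩
  constructor
  · rintro ⟨c, hc, ⟨u, hu, v, hv, huv⟩, rfl⟩
    have hca := h2 c hc
    refine ⟨c, hc.mono hsub, ?_, cut c (hc.mono hsub) hca⟩
    -- Both colours still occur after deletion, since anchors retain the colours of the deleted
    -- vertices.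
    have : ∀ x ∈ D, ∃ x' ∈ D', c x' = c x := by
      intro x hx
      by_cases hx' : x ∈ D'
      · exact ⟨x, hx', rfl⟩
      · exact ⟨a x, ha x hx hx', (hca x hx hx').symm⟩
    obtain ⟨u', hu', hcu⟩ := this u hu
    obtain ⟨v', hv', hcv⟩ := this v hv
    exact ⟨u', hu', v', hv', by rwa [hcu, hcv]⟩
  · rintro ⟨c, hc, ⟨u, hu, v, hv, huv⟩, rfl⟩
    let c' : V → Bool := fun x => if x ∈ D' then c x else c (a x)
    have hcc : ∀ x ∈ D', c' x = c x := fun x hx => by simp [c', hx]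
    have hc' : Good G D' c' := by
      intro u hu v hv w hw
      rw [hcc u hu, hcc v hv, hcc w hw]
      exact hc u hu v hv w hw
    have hca : ∀ x ∈ D, x ∉ D' → c' x = c' (a x) := by
      intro x hx hx'
      rw [hcc _ (ha x hx hx')]
      simp [c', hx']
    refine ⟨c', ?_, ⟨u, hsub hu, v, hsub hv, by rwa [hcc u hu, hcc v hv]⟩, ?_⟩
    · intro u hu v hv w hw huv huw hcv hcw
      obtain ⟨hu', hv'⟩ := key c' hc' hca u hu v hv huv hcv
      obtain ⟨-, hw'⟩ := key c' hc' hca u hu w hw huw hcw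
      exact hc' u hu' v hv' w hw' huv huw hcv hcw
    · rw [cut c' hc' hca]
      ext e
      constructor
      · rintro ⟨u, hu, v, hv, h, hne, rfl⟩
        exact ⟨u, hu, v, hv, h, by rwa [hcc u hu, hcc v hv], rfl⟩
      · rintro ⟨u, hu, v, hv, h, hne, rfl⟩
        exact ⟨u, hu, v, hv, h, by rwa [hcc u hu, hcc v hv] at hne, rfl⟩

/-- Otherwise `y` would have two neighbours of the other colour. -/
theorem Good.eq_of_two {D : Set V} {c : V → Bool} (h : Good G D c) {y a b : V} (hy : y ∈ D)
    (ha : a ∈ D) (hb : b ∈ D) (hab : a ≠ b) (hya : G.Adj y a) (hyb : G.Adj y b)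
    (hc : c a = c b) : c y = c a := by
  by_contra hne
  exact hab (h y hy a ha b hb hya hyb hne (by rwa [← hc]))

/-- Two of the three vertices share a colour, which the third one sees twice. -/
theorem Good.eq_of_triangle {D : Set V} {c : V → Bool} (h : Good G D c) {x y z : V} (hx : x ∈ D)
    (hy : y ∈ D) (hz : z ∈ D) (hxy : G.Adj x y) (hxz : G.Adj x z) (hyz : G.Adj y z) :
    c x = c y := by
  by_cases hyz' : c y = c z
  · exact h.eq_of_two hx hy hz hyz.ne hxy hxz hyz'
  · by_cases hxz' : c x = c z
    · exact (h.eq_of_two hy hx hz hxz.ne hxy.symm hyz hxz').symm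
    · revert hyz' hxz'
      cases c x <;> cases c y <;> cases c z <;> simp

/-- Of three common neighbours two share a colour, and these two force it on both `p` and `q`. -/
theorem Good.eq_of_three {D : Set V} {c : V → Bool} (h : Good G D c) {p q x y z : V} (hp : p ∈ D)
    (hq : q ∈ D) (hx : x ∈ D) (hy : y ∈ D) (hz : z ∈ D) (hxy : x ≠ y) (hxz : x ≠ z) (hyz : y ≠ z)
    (hpx : G.Adj p x) (hpy : G.Adj p y) (hpz : G.Adj p z)
    (hqx : G.Adj q x) (hqy : G.Adj q y) (hqz : G.Adj q z) : c p = c q := by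
  have : c x = c y ∨ c x = c z ∨ c y = c z := by
    cases c x <;> cases c y <;> cases c z <;> simp
  rcases this with e | e | e
  · rw [h.eq_of_two hp hx hy hxy hpx hpy e, h.eq_of_two hq hx hy hxy hqx hqy e]
  · rw [h.eq_of_two hp hx hz hxz hpx hpz e, h.eq_of_two hq hx hz hxz hqx hqz e]
  · rw [h.eq_of_two hp hy hz hyz hpy hpz e, h.eq_of_two hq hy hz hyz hqy hqz e]

/-! ### The two deletion rules and their safety -/

variable (G)

/-- The vertices `p` and `q` have three common neighbours in `D \ {x}`. -/
def Linked (D : Set V) (x p q : V) : Prop :=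
  ∃ a ∈ D, ∃ b ∈ D, ∃ c ∈ D, a ≠ b ∧ a ≠ c ∧ b ≠ c ∧ a ≠ x ∧ b ≠ x ∧ c ≠ x ∧
    G.Adj p a ∧ G.Adj p b ∧ G.Adj p c ∧ G.Adj q a ∧ G.Adj q b ∧ G.Adj q c

/-- `a` is a vertex of `D \ {x}` that is `p` or `q` or a common neighbour of both. -/
def Near (D : Set V) (x p q a : V) : Prop :=
  a ∈ D ∧ a ≠ x ∧ (a = p ∨ a = q ∨ G.Adj a p ∧ G.Adj a q)

/-- The neighbours of `x` are at least two, and a complete bipartite graph in `D \ {x}` shows that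
they are on the same side of each matching cut. -/
def Removable (D : Set V) (x : V) : Prop :=
  (∃ y ∈ D, ∃ z ∈ D, y ≠ z ∧ G.Adj x y ∧ G.Adj x z) ∧
  ∃ p ∈ D, ∃ q ∈ D, p ≠ q ∧ p ≠ x ∧ q ≠ x ∧ Linked G D x p q ∧
    ∀ y ∈ D, G.Adj x y → ∃ a, Near G D x p q a ∧ ∃ b, Near G D x p q b ∧ a ≠ b ∧
      G.Adj y a ∧ G.Adj y b

/-- The neighbour `x` of `v` has a common neighbour with `v`, and all vertices at distance at
most two from `x` in `D \ {v}` are neighbours of `v`. -/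
def Absorbed (D : Set V) (v x : V) : Prop :=
  G.Adj v x ∧ (∃ z ∈ D, G.Adj v z ∧ G.Adj x z) ∧
    ∀ z ∈ D, G.Adj x z → z ≠ v → G.Adj v z ∧ ∀ w ∈ D, G.Adj z w → w ≠ v → G.Adj v w

/-- Remove `v` if possible, otherwise all vertices absorbed by `v`. -/
def step (v : V) (D : Set V) : Set V :=
  {x | x ∈ D ∧ ¬ (v ∈ D ∧ ((Removable G D v ∧ x = v) ∨ (¬ Removable G D v ∧ Absorbed G D v x)))}

variable {G}

theorem step_subset (v : V) (D : Set V) : step G v D ⊆ D := fun _ h => h.1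

theorem exists_mem_step {D : Set V} (v : V) (h : D.Nonempty) : (step G v D).Nonempty := by
  by_cases hv : v ∈ D
  · by_cases hR : Removable G D v
    · obtain ⟨y, hy, -, -, -, hvy, -⟩ := hR.1
      exact ⟨y, hy, by rintro ⟨-, ⟨-, rfl⟩ | ⟨h, -⟩⟩; exacts [hvy.ne rfl, h hR]⟩
    · exact ⟨v, hv, by rintro ⟨-, ⟨h, -⟩ | ⟨-, h⟩⟩; exacts [hR h, h.1.ne rfl]⟩
  · obtain ⟨x, hx⟩ := h
    exact ⟨x, hx, fun h => hv h.1⟩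

/-- Both rules are instances of `isMC_iff_of_anchor`. A removable vertex is anchored at one of its
neighbours, all of which get the colour of `p`; an absorbed vertex is anchored at `v`, with which it
lies in a triangle. All vertices absorbed by `v` go at once, so in the second case triangles that
survive have to be found. -/
theorem isMC_step (v : V) (D : Set V) (M : Set (Sym2 V)) : IsMC G (step G v D) M ↔ IsMC G D M := by
  by_cases hv : v ∈ D
  swap
  · rw [show step G v D = D from Set.ext fun x => ⟨fun h => h.1, fun h => ⟨h, fun h' => hv h'.1⟩⟩]
  symm
  by_cases hR : Removable G D v
  · have hmem : ∀ x, x ∈ step G v D ↔ x ∈ D ∧ x ≠ v := by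
      intro x
      simp [step, hv, hR]
    have hsub := step_subset (G := G) v D
    obtain ⟨⟨y, hy, z, hz, hyz, hvy, hvz⟩, p, hp, q, hq, hpq, hpv, hqv, hlink, hall⟩ := hR
    have hx : ∀ x ∈ D, x ∉ step G v D → x = v := by
      intro x hx hx'
      by_contra h
      exact hx' ((hmem x).2 ⟨hx, h⟩)
    -- All witnesses of removability differ from `v`, so the colours of the neighbours are already
    -- forced in `D` without `v`.
    have mono : ∀ c, Good G (step G v D) c → ∀ w ∈ D, G.Adj v w → c w = c p := by
      intro c hc w hw hvw
      obtain ⟨a, ha, b, hb, d, hd, hab, had, hbd, hav, hbv, hdv, h1, h2, h3, h4, h5, h6⟩ := hlink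
      have hp' := (hmem p).2 ⟨hp, hpv⟩
      have hq' := (hmem q).2 ⟨hq, hqv⟩
      have hcpq : c p = c q := hc.eq_of_three hp' hq' ((hmem a).2 ⟨ha, hav⟩)
        ((hmem b).2 ⟨hb, hbv⟩) ((hmem d).2 ⟨hd, hdv⟩) hab had hbd h1 h2 h3 h4 h5 h6
      have near : ∀ a, Near G D v p q a → c a = c p := by
        rintro a ⟨ha, hav, rfl | rfl | ⟨h7, h8⟩⟩
        · rfl
        · exact hcpq.symm
        · exact hc.eq_of_two ((hmem a).2 ⟨ha, hav⟩) hp' hq' hpq h7 h8 hcpq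
      obtain ⟨a, ha, b, hb, hab, hwa, hwb⟩ := hall w hw hvw
      rw [hc.eq_of_two ((hmem w).2 ⟨hw, hvw.ne'⟩) ((hmem a).2 ⟨ha.1, ha.2.1⟩)
        ((hmem b).2 ⟨hb.1, hb.2.1⟩) hab hwa hwb ((near a ha).trans (near b hb).symm), near a ha]
    refine isMC_iff_of_anchor hsub (fun _ => y) ?_ ?_ ?_ ?_ M
    · intro x _ _
      exact (hmem y).2 ⟨hy, hvy.ne'⟩
    · intro c hc x hxD hx' w hw hxw
      obtain rfl := hx x hxD hx'
      rw [mono c hc w hw.1 hxw, mono c hc y hy hvy]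
    · intros; rfl
    · intro c hc x hxD hx'
      obtain rfl := hx x hxD hx'
      have hm := mono c (hc.mono hsub)
      exact hc.eq_of_two hxD hy hz hyz hvy hvz ((hm y hy hvy).trans (hm z hz hvz).symm)
  · have hmem : ∀ x, x ∈ step G v D ↔ x ∈ D ∧ ¬ Absorbed G D v x := by
      intro x
      simp [step, hv, hR]
    have hv' : v ∈ step G v D := (hmem v).2 ⟨hv, fun h => h.1.ne rfl⟩
    have hx : ∀ x ∈ D, x ∉ step G v D → Absorbed G D v x := by
      intro x hx hx'
      by_contra h
      exact hx' ((hmem x).2 ⟨hx, h⟩)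
    refine isMC_iff_of_anchor (step_subset v D) (fun _ => v) (fun _ _ _ => hv') ?_ ?_ ?_ M
    · intro c hc x hxD hx' y hy hxy
      obtain ⟨hvx, ⟨z, hz, hvz, hxz⟩, hall⟩ := hx x hxD hx'
      by_cases hyv : y = v
      · rw [hyv]
      obtain ⟨hvy, hyall⟩ := hall y hy.1 hxy hyv
      have hna := ((hmem y).1 hy).2
      -- The surviving `y` is not absorbed although it has the common neighbour `x` with `v`. Its
      -- neighbours in `D` other than `v` are adjacent to `v`, being within distance two of `x`, so
      -- the failure occurs at distance two from `y`.
      have : ∃ w ∈ D, G.Adj y w ∧ w ≠ v ∧ ∃ u ∈ D, G.Adj w u ∧ u ≠ v ∧ ¬ G.Adj v u := by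
        by_contra hcon
        refine hna ⟨hvy, ⟨x, hxD, hvx, hxy.symm⟩, fun w hw hyw hwv => ⟨hyall w hw hyw hwv, ?_⟩⟩
        intro u hu hwu huv
        by_contra hvu
        exact hcon ⟨w, hw, hyw, hwv, u, hu, hwu, huv, hvu⟩
      obtain ⟨w, hw, hyw, hwv, u, hu, hwu, huv, hvu⟩ := this
      have hvw := hyall w hw hyw hwv
      -- The neighbour `u` of `w` is not a neighbour of `v`, so `w` is not absorbed either, and the
      -- triangle `y`, `v`, `w` survives.
      have hw' : w ∈ step G v D := by
        refine (hmem w).2 ⟨hw, fun h => hvu ?_⟩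
        exact (h.2.2 u hu hwu huv).1
      exact hc.eq_of_triangle hy hv' hw' hvy.symm hyw hvw
    · intros; rfl
    · intro c hc x hxD hx'
      obtain ⟨hvx, ⟨z, hz, hvz, hxz⟩, -⟩ := hx x hxD hx'
      exact hc.eq_of_triangle hxD hv hz hvx.symm hxz hvz

end General

end MatchingCut

namespace MatchingCut

/-! ### Fixed points of iterated maps -/

/-- Until a fixed point is reached the measure grows strictly, so after `i + 1` effective rounds it
exceeds `i`. As it is at most `n`, one of the first `n` iterates is fixed. -/
theorem iterate_fixed {α : Type} (f : α → α) (μ : α → ℕ) (P : α → Prop) (n : ℕ) {a : α} (ha : P a)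
    (hP : ∀ b, P b → P (f b)) (hn : ∀ b, P b → μ b ≤ n)
    (hμ : ∀ b, P b → f b ≠ b → μ b < μ (f b)) : f (f^[n] a) = f^[n] a := by
  have hPi : ∀ i, P (f^[i] a) := fun i => by
    induction i with
    | zero => exact ha
    | succ i ih => rw [Function.iterate_succ_apply']; exact hP _ ih
  have key : ∀ i, f (f^[i] a) = f^[i] a ∨ i < μ (f^[i + 1] a) := by
    intro i
    induction i with
    | zero =>
      by_cases h : f a = a
      · exact Or.inl h
      · exact Or.inr (by have := hμ a ha h; simp; omega)
    | succ i ih =>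
      by_cases h : f (f^[i + 1] a) = f^[i + 1] a
      · exact Or.inl h
      · right
        have h1 := hμ _ (hPi (i + 1)) h
        rw [← Function.iterate_succ_apply' f (i + 1)] at h1
        change _ < μ (f^[i + 1 + 1] a) at h1
        rcases ih with ih | ih
        · exact absurd (by rw [Function.iterate_succ_apply', ih, ih]) h
        · omega
  rcases key n with h | h
  · exact h
  · exact absurd (hn _ (hPi (n + 1))) (by omega)

section Nat

variable (G : SimpleGraph ℕ)

/-- The vertices `0, …, n - 1`. -/
def verts (n : ℕ) : Set ℕ := {x | x < n}

theorem finite_verts (n : ℕ) : (verts n).Finite := Set.finite_lt_nat n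

theorem ncard_verts (n : ℕ) : (verts n).ncard = n := by
  have : verts n = ((Finset.range n : Finset ℕ) : Set ℕ) := by ext; simp [verts]
  rw [this, Set.ncard_coe_finset, Finset.card_range]

/-! ### The connected component of `0` -/

/-- Add to `R` the neighbours of its vertices. -/
def reachStep (n : ℕ) (R : Set ℕ) : Set ℕ :=
  {x | x < n ∧ (x ∈ R ∨ ∃ u < n, u ∈ R ∧ G.Adj u x)}

/-- The vertices that can be reached from `0`. -/
def reach (n : ℕ) : Set ℕ := (reachStep G n)^[n] {x | x < n ∧ x = 0}

/-- All vertices if the graph is connected, and otherwise two in different components. -/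
def start (n : ℕ) : Set ℕ :=
  {x | x < n ∧ ((∀ z < n, z ∈ reach G n) ∨ x = 0 ∨ (x ∉ reach G n ∧ ∀ z < x, z ∈ reach G n))}

variable {G}

theorem reachStep_reach (n : ℕ) : reachStep G n (reach G n) = reach G n := by
  refine iterate_fixed _ Set.ncard (fun R => R ⊆ verts n) n (fun x hx => hx.1) (fun R _ x hx => hx.1)
    (fun R hR => ?_) (fun R hR hne => ?_)
  · rw [← ncard_verts n]
    exact Set.ncard_le_ncard hR (finite_verts n)
  · refine Set.ncard_lt_ncard (Set.ssubset_iff_subset_ne.2 ⟨fun x hx => ⟨hR hx, Or.inl hx⟩,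
      hne.symm⟩) ((finite_verts n).subset fun x hx => hx.1)

theorem zero_mem_reach {n : ℕ} (hn : 0 < n) : 0 ∈ reach G n := by
  have : ∀ i, 0 ∈ (reachStep G n)^[i] {x | x < n ∧ x = 0} := by
    intro i
    induction i with
    | zero => exact ⟨hn, rfl⟩
    | succ i ih =>
      rw [Function.iterate_succ_apply']
      exact ⟨hn, Or.inl ih⟩
  exact this n

theorem reach_closed {n u x : ℕ} (hu : u < n) (hx : x < n) (h : G.Adj u x) (hur : u ∈ reach G n) :
    x ∈ reach G n := by
  rw [← reachStep_reach]
  exact ⟨hx, Or.inr ⟨u, hu, hur, h⟩⟩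

/-- If no edge of the graph is bichromatic, then all that can be reached has the same colour. -/
theorem reach_colour {n : ℕ} {c : ℕ → Bool} (hc : ∀ u < n, ∀ v < n, G.Adj u v → c u = c v) :
    ∀ x ∈ reach G n, c x = c 0 := by
  have : ∀ i, ∀ x ∈ (reachStep G n)^[i] {x | x < n ∧ x = 0}, x < n ∧ c x = c 0 := by
    intro i
    induction i with
    | zero => rintro x ⟨hx, rfl⟩; exact ⟨hx, rfl⟩
    | succ i ih =>
      rw [Function.iterate_succ_apply']
      rintro x ⟨hx, h | ⟨u, hu, hur, h⟩⟩
      · exact ih x h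
      · exact ⟨hx, (hc u hu x hx h).symm.trans (ih u hur).2⟩
  exact fun x hx => (this n x hx).2

/-- The empty set is a cut iff the subgraph splits into two nonempty parts without an edge between
them, that is, iff it is disconnected. -/
theorem isMC_empty_iff {D : Set ℕ} : IsMC G D ∅ ↔
    ∃ c : ℕ → Bool, (∀ u ∈ D, ∀ v ∈ D, G.Adj u v → c u = c v) ∧ ∃ u ∈ D, ∃ v ∈ D, c u ≠ c v := by
  constructor
  · rintro ⟨c, -, hne, h⟩
    refine ⟨c, fun u hu v hv huv => ?_, hne⟩
    by_contra hcon
    have : s(u, v) ∈ (∅ : Set (Sym2 ℕ)) := by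
      rw [h]; exact mem_cutEdges.2 ⟨hu, hv, huv, hcon⟩
    exact this
  · rintro ⟨c, hc, hne⟩
    refine ⟨c, fun u hu v hv w hw huv _ hcv _ => absurd (hc u hu v hv huv) hcv, hne, ?_⟩
    symm
    rw [Set.eq_empty_iff_forall_notMem]
    rintro e ⟨u, hu, v, hv, huv, hcv, -⟩
    exact hcv (hc u hu v hv huv)

/-- If everything is reachable from `0`, a colouring without bichromatic edges is constant.
Otherwise reachability itself is such a colouring; it separates `0` from the least unreachable
vertex, so the whole graph and the subgraph on these two vertices both have `∅` as their only
minimal cut. -/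
theorem start_cases {n : ℕ} (hn : 0 < n) :
    (start G n = verts n ∧ ¬ IsMC G (verts n) ∅) ∨
      ((start G n).ncard ≤ 2 ∧ Sol G (start G n) = Sol G (verts n)) := by
  classical
  by_cases hall : ∀ z < n, z ∈ reach G n
  · refine Or.inl ⟨Set.ext fun x => ⟨fun h => h.1, fun h => ⟨h, Or.inl hall⟩⟩, ?_⟩
    rw [isMC_empty_iff]
    rintro ⟨c, hc, u, hu, v, hv, hne⟩
    exact hne ((reach_colour hc u (hall u hu)).trans (reach_colour hc v (hall v hv)).symm)
  · right
    have hex : ∃ z, z < n ∧ z ∉ reach G n := by simpa using hall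
    set u := Nat.find hex with hu
    obtain ⟨hun, hur⟩ := Nat.find_spec hex
    have hmin : ∀ z < u, z ∈ reach G n := fun z hz => by
      have := Nat.find_min hex hz
      by_contra h
      exact this ⟨hz.trans hun, h⟩
    have hs : start G n = {0, u} := by
      ext x
      constructor
      · rintro ⟨hx, h | h | ⟨h, h'⟩⟩
        · exact absurd h hall
        · exact Or.inl h
        · right
          have h1 : u ≤ x := Nat.find_min' hex ⟨hx, h⟩
          rcases h1.eq_or_lt with h2 | h2
          · exact h2.symm
          · exact absurd (h' u h2) hur
      · rintro (rfl | rfl)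
        · exact ⟨hn, Or.inr (Or.inl rfl)⟩
        · exact ⟨hun, Or.inr (Or.inr ⟨hur, hmin⟩)⟩
    have h0 : 0 ∈ reach G n := zero_mem_reach hn
    have hcl : ∀ a ∈ verts n, ∀ b ∈ verts n, G.Adj a b →
        decide (a ∈ reach G n) = decide (b ∈ reach G n) := fun a ha b hb hab =>
      decide_eq_decide.2 ⟨reach_closed ha hb hab, reach_closed hb ha hab.symm⟩
    have hne : decide (0 ∈ reach G n) ≠ decide (u ∈ reach G n) := by
      have : u ∉ reach G n := hur
      simp [h0, this]
    have hsub : start G n ⊆ verts n := fun x hx => hx.1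
    have h0s : 0 ∈ start G n := by rw [hs]; exact Or.inl rfl
    have hus : u ∈ start G n := by rw [hs]; exact Or.inr rfl
    refine ⟨?_, ?_⟩
    · rw [hs]; exact (Set.ncard_insert_le 0 {u}).trans (by simp)
    · rw [sol_eq_of_empty (isMC_empty_iff.2 ⟨fun x => decide (x ∈ reach G n),
          fun a ha b hb => hcl a (hsub ha) b (hsub hb), 0, h0s, u, hus, hne⟩),
        sol_eq_of_empty (isMC_empty_iff.2 ⟨fun x => decide (x ∈ reach G n), hcl, 0, hsub h0s, u,
          hsub hus, hne⟩)]

/-! ### Exhaustive reduction -/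

variable (G)

/-- One round of reductions, at all vertices. -/
def pass (n : ℕ) (D : Set ℕ) : Set ℕ := (List.range n).foldl (fun D v => step G v D) D

/-- The vertices that remain after exhaustive reduction. -/
def core (n : ℕ) : Set ℕ := (pass G n)^[n] (start G n)

variable {G}

theorem foldl_step_subset (l : List ℕ) (D : Set ℕ) :
    l.foldl (fun D v => step G v D) D ⊆ D := by
  induction l generalizing D with
  | nil => exact subset_rfl
  | cons v l ih => exact (ih _).trans (step_subset v D)

/-- Steps only shrink the set, so a round without a net effect has no effect at any single vertex.
-/
theorem foldl_step_eq (l : List ℕ) {D : Set ℕ} (h : l.foldl (fun D v => step G v D) D = D) :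
    ∀ v ∈ l, step G v D = D := by
  induction l with
  | nil => simp
  | cons v l ih =>
    have hv : step G v D = D := by
      refine (step_subset v D).antisymm ?_
      conv_lhs => rw [← h]
      exact foldl_step_subset l _
    rw [List.foldl_cons, hv] at h
    intro w hw
    rcases List.mem_cons.1 hw with rfl | hw
    · exact hv
    · exact ih h w hw

theorem foldl_step_induction {P : Set ℕ → Prop} (hP : ∀ v D, P D → P (step G v D)) (l : List ℕ)
    {D : Set ℕ} (hD : P D) : P (l.foldl (fun D v => step G v D) D) := by
  induction l generalizing D with
  | nil => exact hD
  | cons v l ih => exact ih (hP v D hD)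

theorem core_induction {n : ℕ} {P : Set ℕ → Prop} (h : P (start G n))
    (hP : ∀ v D, P D → P (step G v D)) : P (core G n) := by
  have : ∀ i, P ((pass G n)^[i] (start G n)) := by
    intro i
    induction i with
    | zero => exact h
    | succ i ih =>
      rw [Function.iterate_succ_apply']
      exact foldl_step_induction hP _ ih
  exact this n

theorem core_subset_start (n : ℕ) : core G n ⊆ start G n :=
  core_induction (P := fun D => D ⊆ start G n) subset_rfl fun v D h => (step_subset v D).trans h

theorem core_subset (n : ℕ) : core G n ⊆ verts n :=
  (core_subset_start n).trans fun _ h => h.1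

theorem core_nonempty {n : ℕ} (hn : 0 < n) : (core G n).Nonempty :=
  core_induction (P := Set.Nonempty) ⟨0, hn, Or.inr (Or.inl rfl)⟩ fun v _ h => exists_mem_step v h

theorem isMC_core {n : ℕ} (M : Set (Sym2 ℕ)) : IsMC G (core G n) M ↔ IsMC G (start G n) M :=
  core_induction (P := fun D => IsMC G D M ↔ IsMC G (start G n) M) Iff.rfl
    fun v D h => (isMC_step v D M).trans h

theorem sol_core {n : ℕ} (hn : 0 < n) : Sol G (core G n) = Sol G (verts n) := by
  have h : Sol G (core G n) = Sol G (start G n) := by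
    unfold Sol
    rw [show IsMC G (core G n) = IsMC G (start G n) from funext fun M => propext (isMC_core M)]
  rcases start_cases (G := G) hn with h' | h'
  · rw [h, h'.1]
  · rw [h, h'.2]

theorem pass_core (n : ℕ) : pass G n (core G n) = core G n := by
  -- The sets shrink, so the growing measure is the number of deleted vertices.
  refine iterate_fixed _ (fun D => n - D.ncard) (fun D => D ⊆ verts n) n (fun x hx => hx.1)
    (fun D hD => (foldl_step_subset _ _).trans hD) (fun D _ => Nat.sub_le _ _) (fun D hD hne => ?_)
  have hlt := Set.ncard_lt_ncard (Set.ssubset_iff_subset_ne.2 ⟨foldl_step_subset _ _, hne⟩)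
    ((finite_verts n).subset hD)
  have hle := Set.ncard_le_ncard hD (finite_verts n)
  rw [ncard_verts] at hle
  unfold pass at hlt ⊢
  omega

theorem step_core {n v : ℕ} (hv : v < n) : step G v (core G n) = core G n :=
  foldl_step_eq _ (pass_core n) v (List.mem_range.2 hv)

theorem not_removable {n v : ℕ} (hv : v ∈ core G n) : ¬ Removable G (core G n) v := by
  intro h
  have h' := hv
  rw [← step_core (core_subset n hv)] at h'
  exact h'.2 ⟨hv, Or.inl ⟨h, rfl⟩⟩

/-- Absorption at `v` applies only if `v` is not removable, which is known for vertices of the core.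
-/
theorem not_absorbed {n v x : ℕ} (hv : v ∈ core G n) (hx : x ∈ core G n) :
    ¬ Absorbed G (core G n) v x := by
  intro h
  have h' := hx
  rw [← step_core (core_subset n hv)] at h'
  exact h'.2 ⟨hv, Or.inr ⟨not_removable hv, h⟩⟩

/-! ### Pendant vertices -/

variable (G)

/-- In the subgraph induced by `F`, the only neighbour of `p` is `v`. -/
def Pendant (F : Set ℕ) (v p : ℕ) : Prop :=
  v ∈ F ∧ p ∈ F ∧ G.Adj v p ∧ ∀ w ∈ F, G.Adj p w → w = v

/-- `x` is pendant, but not the least pendant vertex with the same neighbour. -/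
def Surplus (F : Set ℕ) (x : ℕ) : Prop := ∃ v y, y < x ∧ Pendant G F v x ∧ Pendant G F v y

/-- Remove the surplus pendant vertices. -/
def trim (F : Set ℕ) : Set ℕ := {x | x ∈ F ∧ ¬ Surplus G F x}

variable {G}

theorem trim_subset (F : Set ℕ) : trim G F ⊆ F := fun _ h => h.1

theorem trim_nonempty {F : Set ℕ} (h : F.Nonempty) : (trim G F).Nonempty := by
  classical
  refine ⟨Nat.find h, Nat.find_spec h, ?_⟩
  rintro ⟨v, y, hy, -, hp⟩
  exact Nat.find_min h hy hp.2.1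

section Trim

variable {F : Set ℕ}

theorem Pendant.exists_least {v p : ℕ} (h : Pendant G F v p) :
    ∃ q, Pendant G F v q ∧ q ∉ {x | Surplus G F x} := by
  classical
  have hex : ∃ q, Pendant G F v q := ⟨p, h⟩
  refine ⟨Nat.find hex, Nat.find_spec hex, ?_⟩
  rintro ⟨w, y, hy, h1, h2⟩
  obtain rfl : w = v := ((Nat.find_spec hex).2.2.2 w h1.1 h1.2.2.1.symm)
  exact Nat.find_min hex hy h2

/-- The centre of a surplus vertex has two neighbours, hence is not pendant, let alone surplus. -/
theorem Pendant.centre_mem_trim {v p : ℕ} (h : Pendant G F v p) (hp : Surplus G F p) :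
    v ∈ trim G F := by
  refine ⟨h.1, ?_⟩
  rintro ⟨w, y, -, hw, -⟩
  obtain ⟨v', y', hlt, h1, h2⟩ := hp
  obtain rfl : v' = v := h.2.2.2 v' h1.1 h1.2.2.1.symm
  have e1 := hw.2.2.2 p h.2.1 h.2.2.1
  have e2 := hw.2.2.2 y' h2.2.1 h2.2.2.1
  omega

/-- No edge of a matching cut of `F` goes to a surplus vertex iff all those vertices have the
colour of their neighbour. -/
theorem isMC_trim {M : Set (Sym2 ℕ)} :
    IsMC G (trim G F) M ↔
      IsMC G F M ∧ ∀ x, Surplus G F x → ∀ e ∈ M, x ∉ e := by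
  classical
  constructor
  · rintro ⟨c, hc, ⟨u, hu, v, hv, huv⟩, rfl⟩
    have hsp : ∀ x, Surplus G F x → ∃ v, Pendant G F v x := fun x ⟨v, _, _, h, _⟩ => ⟨v, h⟩
    choose! a ha using hsp
    -- Surplus vertices take the colour of their only neighbour, which survives trimming; so their
    -- edges stay out of the cut.
    let c' : ℕ → Bool := fun x => if Surplus G F x then c (a x) else c x
    have hcc : ∀ x ∈ trim G F, c' x = c x := fun x hx => by simp [c', hx.2]
    have hca : ∀ x, Surplus G F x → c' x = c' (a x) := by
      intro x hx
      have := ((ha x hx).centre_mem_trim hx).2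
      simp [c', hx, this]
    have hb : ∀ u ∈ F, ∀ v ∈ F, G.Adj u v → c' u ≠ c' v → u ∈ trim G F ∧ v ∈ trim G F := by
      intro u hu v hv huv hne
      refine ⟨⟨hu, fun h => hne ?_⟩, ⟨hv, fun h => hne ?_⟩⟩
      · rw [hca u h, (ha u h).2.2.2 v hv huv]
      · rw [hca v h, (ha v h).2.2.2 u hu huv.symm]
    have hcut : cutEdges G (trim G F) c = cutEdges G F c' := by
      ext e
      constructor
      · rintro ⟨u, hu, v, hv, h, hne, rfl⟩
        exact ⟨u, hu.1, v, hv.1, h, by rwa [hcc u hu, hcc v hv], rfl⟩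
      · rintro ⟨u, hu, v, hv, h, hne, rfl⟩
        obtain ⟨hu', hv'⟩ := hb u hu v hv h hne
        exact ⟨u, hu', v, hv', h, by rwa [hcc u hu', hcc v hv'] at hne, rfl⟩
    refine ⟨⟨c', ?_, ⟨u, hu.1, v, hv.1, by rwa [hcc u hu, hcc v hv]⟩, hcut⟩, ?_⟩
    · intro u hu v hv w hw huv huw hcv hcw
      obtain ⟨hu', hv'⟩ := hb u hu v hv huv hcv
      obtain ⟨-, hw'⟩ := hb u hu w hw huw hcw
      rw [hcc u hu'] at hcv hcw
      rw [hcc v hv'] at hcv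
      rw [hcc w hw'] at hcw
      exact hc u hu' v hv' w hw' huv huw hcv hcw
    · rintro x hx e ⟨u, hu, v, hv, -, -, rfl⟩ hxe
      rcases Sym2.mem_iff.1 hxe with rfl | rfl
      · exact hu.2 hx
      · exact hv.2 hx
  · rintro ⟨⟨c, hc, ⟨u, hu, v, hv, huv⟩, rfl⟩, hM⟩
    -- No edge of the cut ends in a surplus vertex, so the centre of such a vertex represents its
    -- colour in `trim`.
    have hcol : ∀ x ∈ F, ∃ y ∈ trim G F, c y = c x := by
      intro x hx
      by_cases hs : Surplus G F x
      · obtain ⟨v, -, -, h, -⟩ := id hs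
        refine ⟨v, h.centre_mem_trim hs, ?_⟩
        by_contra hne
        exact hM x hs s(v, x)
          (mem_cutEdges.2 ⟨h.1, hx, h.2.2.1, hne⟩) (by simp)
      · exact ⟨x, ⟨hx, hs⟩, rfl⟩
    obtain ⟨u', hu', hcu⟩ := hcol u hu
    obtain ⟨v', hv', hcv⟩ := hcol v hv
    refine ⟨c, hc.mono (trim_subset F), ⟨u', hu', v', hv', by rwa [hcu, hcv]⟩, ?_⟩
    ext e
    constructor
    · intro he
      have he' := he
      obtain ⟨u, hu, v, hv, h, hne, rfl⟩ := he
      exact ⟨u, ⟨hu, fun hs => hM u hs _ he' (by simp)⟩, v, ⟨hv, fun hs => hM v hs _ he' (by simp)⟩,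
        h, hne, rfl⟩
    · rintro ⟨u, hu, v, hv, h, hne, rfl⟩
      exact ⟨u, hu.1, v, hv.1, h, hne, rfl⟩

/-- Avoiding surplus vertices is inherited by subsets, so minimality among the cuts of `F` and among
those of `trim G F` agree for such a cut. -/
theorem sol_trim {M : Set (Sym2 ℕ)} :
    M ∈ Sol G (trim G F) ↔ M ∈ Sol G F ∧ ∀ x, Surplus G F x → ∀ e ∈ M, x ∉ e := by
  constructor
  · rintro ⟨h, hmin⟩
    obtain ⟨h1, h2⟩ := isMC_trim.1 h
    refine ⟨⟨h1, fun M' hM' hle => ?_⟩, h2⟩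
    exact hmin (isMC_trim.2 ⟨hM', fun x hx e he => h2 x hx e (hle he)⟩) hle
  · rintro ⟨⟨h, hmin⟩, h2⟩
    exact ⟨isMC_trim.2 ⟨h, h2⟩, fun M' hM' hle => hmin (isMC_trim.1 hM').1 hle⟩

/-- Colour `p` differently from all other vertices. -/
theorem Pendant.isMC {v p : ℕ} (h : Pendant G F v p) : IsMC G F {s(v, p)} := by
  classical
  refine ⟨fun x => decide (x = p), ?_, ⟨v, h.1, p, h.2.1, ?_⟩, ?_⟩
  · intro u hu x hx y hy hux huy h1 h2
    by_cases hup : u = p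
    · subst hup
      rw [h.2.2.2 x hx hux, h.2.2.2 y hy huy]
    · simp only [hup, decide_false, ne_eq, Bool.false_eq, decide_eq_false_iff_not, not_not] at h1 h2
      rw [h1, h2]
  · simp [h.2.2.1.ne]
  · ext e
    constructor
    · rintro rfl
      exact mem_cutEdges.2 ⟨h.1, h.2.1, h.2.2.1, by simp [h.2.2.1.ne]⟩
    · rintro ⟨u, hu, w, hw, huw, hne, rfl⟩
      by_cases hup : u = p
      · subst hup
        rw [h.2.2.2 w hw huw]
        exact Sym2.eq_swap
      · by_cases hwp : w = p
        · subst hwp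
          rw [h.2.2.2 u hu huw.symm]
          rfl
        · simp [hup, hwp] at hne

theorem Pendant.mem_sol {v p : ℕ} (h : Pendant G F v p) (hF : ¬ IsMC G F ∅) :
    {s(v, p)} ∈ Sol G F := by
  refine ⟨h.isMC, fun M' hM' hle => ?_⟩
  rcases Set.subset_singleton_iff_eq.1 hle with rfl | rfl
  · exact absurd hM' hF
  · exact subset_rfl

/-- The pendant edge alone is already a matching cut, so minimality leaves no further edge. -/
theorem Pendant.eq_of_mem {v p : ℕ} {M : Set (Sym2 ℕ)} (h : Pendant G F v p) (hM : M ∈ Sol G F)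
    (hmem : s(v, p) ∈ M) : M = {s(v, p)} :=
  (hM.2 h.isMC (Set.singleton_subset_iff.2 hmem)).antisymm (Set.singleton_subset_iff.2 hmem)

/-- The solution `{vp}`, with a surplus pendant vertex `p` of `v`, is assigned to the solution
`M = {vq}`, where `q` is the least pendant vertex of `v`. -/
def Lifts (G : SimpleGraph ℕ) (F : Set ℕ) (M : Set (Sym2 ℕ)) (p : ℕ) : Prop :=
  Surplus G F p ∧ ∃ v ∈ trim G F, ∃ q ∈ trim G F, Pendant G F v p ∧ Pendant G F v q ∧ s(v, q) ∈ M

/-- The edges of `F` at `p`. -/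
def edgesAt (G : SimpleGraph ℕ) (F : Set ℕ) (p : ℕ) : Set (Sym2 ℕ) :=
  {e | ∃ u ∈ F, ∃ v ∈ F, G.Adj u v ∧ (u = p ∨ v = p) ∧ e = s(u, v)}

theorem Pendant.edgesAt {v p : ℕ} (h : Pendant G F v p) : edgesAt G F p = {s(v, p)} := by
  ext e
  constructor
  · rintro ⟨u, hu, w, hw, huw, rfl | rfl, rfl⟩
    · rw [h.2.2.2 w hw huw]; exact Sym2.eq_swap
    · rw [h.2.2.2 u hu huw.symm]; rfl
  · rintro rfl
    exact ⟨v, h.1, p, h.2.1, h.2.2.1, Or.inr rfl, rfl⟩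

/-- The solution `M` contains an edge, so the empty set is not a cut of `F`, and a single pendant
edge is minimal. -/
theorem Lifts.mem_sol {M : Set (Sym2 ℕ)} {p : ℕ} (hM : M ∈ Sol G (trim G F))
    (h : Lifts G F M p) : edgesAt G F p ∈ Sol G F := by
  obtain ⟨-, v, -, q, -, h1, h2, h3⟩ := h
  rw [h1.edgesAt]
  refine h1.mem_sol fun h0 => ?_
  have := (sol_trim.1 hM).1
  rw [sol_eq_of_empty h0] at this
  rw [this] at h3
  exact h3

/-- A minimal cut with an edge at a surplus vertex `p` is `{vp}`; it is assigned to `{vq}`, with `q`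
the least pendant neighbour of `v`. Any other minimal cut is assigned to itself. -/
theorem exists_of_mem_sol {M : Set (Sym2 ℕ)} (hM : M ∈ Sol G F) :
    ∃ M' ∈ Sol G (trim G F), M = M' ∨ ∃ p, Lifts G F M' p ∧ M = edgesAt G F p := by
  by_cases h : ∀ x, Surplus G F x → ∀ e ∈ M, x ∉ e
  · exact ⟨M, sol_trim.2 ⟨hM, h⟩, Or.inl rfl⟩
  · push Not at h
    obtain ⟨p, hp, e, he, hpe⟩ := h
    obtain ⟨v, y, hlt, h1, h2⟩ := hp
    have he' : e = s(v, p) := by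
      obtain ⟨c, -, -, rfl⟩ := hM.1
      obtain ⟨u, hu, w, hw, huw, -, rfl⟩ := he
      rcases Sym2.mem_iff.1 hpe with rfl | rfl
      · rw [h1.2.2.2 w hw huw]; exact Sym2.eq_swap
      · rw [h1.2.2.2 u hu huw.symm]
    subst he'
    have hMe := h1.eq_of_mem hM he
    have h0 : ¬ IsMC G F ∅ := by
      intro h0
      rw [sol_eq_of_empty h0] at hM
      rw [hM] at he
      exact he
    obtain ⟨q, hq, hq'⟩ := h1.exists_least
    have hv := h1.centre_mem_trim ⟨v, y, hlt, h1, h2⟩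
    refine ⟨{s(v, q)}, sol_trim.2 ⟨hq.mem_sol h0, ?_⟩, Or.inr ⟨p, ⟨⟨v, y, hlt, h1, h2⟩, v, hv, q,
      ⟨hq.2.1, hq'⟩, h1, hq, rfl⟩, ?_⟩⟩
    · rintro x hx e rfl hxe
      rcases Sym2.mem_iff.1 hxe with rfl | rfl
      · exact hv.2 hx
      · exact hq' hx
    · rw [hMe, h1.edgesAt]

theorem Lifts.not_mem {M : Set (Sym2 ℕ)} {p : ℕ} (h : Lifts G F M p) :
    edgesAt G F p ∉ Sol G (trim G F) := by
  obtain ⟨hp, v, -, q, -, h1, h2, h3⟩ := h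
  rw [h1.edgesAt]
  intro h
  exact (sol_trim.1 h).2 p hp _ rfl (by simp)

theorem Lifts.inj {M M' : Set (Sym2 ℕ)} {p p' : ℕ} (h : Lifts G F M p) (h' : Lifts G F M' p')
    (he : edgesAt G F p = edgesAt G F p') : p = p' := by
  obtain ⟨hp, v, -, q, -, h1, h2, h3⟩ := h
  obtain ⟨hp', v', -, q', -, h1', h2', h3'⟩ := h'
  rw [h1.edgesAt, h1'.edgesAt, Set.singleton_eq_singleton_iff, Sym2.eq_iff] at he
  rcases he with ⟨-, e⟩ | ⟨e, e'⟩
  · exact e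
  -- In the crossed case `p'` would be the centre of the surplus vertex `p`, and centres are not
  -- surplus.
  · exact absurd hp' (e ▸ (h1.centre_mem_trim hp).2)

/-- The pendant vertex `p` determines its centre, and the centre has only one pendant neighbour that
is not surplus, so both solutions are the same single edge. -/
theorem Lifts.unique {M M' : Set (Sym2 ℕ)} {p : ℕ} (hM : M ∈ Sol G (trim G F))
    (hM' : M' ∈ Sol G (trim G F)) (h : Lifts G F M p) (h' : Lifts G F M' p) : M = M' := by
  obtain ⟨hp, v, -, q, hq, h1, h2, h3⟩ := h
  obtain ⟨hp', v', -, q', hq', h1', h2', h3'⟩ := h'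
  obtain rfl : v' = v := h1.2.2.2 v' h1'.1 h1'.2.2.1.symm
  obtain rfl : q = q' := by
    rcases lt_trichotomy q q' with hlt | rfl | hlt
    · exact absurd ⟨v', q, hlt, h2', h2⟩ hq'.2
    · rfl
    · exact absurd ⟨v', q', hlt, h2, h2'⟩ hq.2
  rw [h2.eq_of_mem (sol_trim.1 hM).1 h3, h2.eq_of_mem (sol_trim.1 hM').1 h3']

end Trim

end Nat

end MatchingCut

namespace MatchingCut

/-! ### Modules -/

section Modules

variable {V : Type}

/-- The vertices in `M` have the same neighbours outside `M`. -/
def IsModule (G : SimpleGraph V) (M : Set V) : Prop :=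
  ∀ a ∈ M, ∀ b ∈ M, ∀ v ∉ M, G.Adj a v → G.Adj b v

/-- Descend in the construction to the lowest substitution whose vertex set still contains `F`. The
parts that it substitutes are the required modules: a module of a part is also a module of the
whole, since vertices outside a part do not distinguish its elements. -/
theorem exists_modules {k : ℕ} {V : Type} {G : SimpleGraph V} (h : ModularConstructible k V G) :
    ∀ F : Set V, (∃ a ∈ F, ∃ b ∈ F, a ≠ b) → ∃ r ≤ k, ∃ M : Fin r → Set V,
      (∀ i, IsModule G (M i)) ∧ F ⊆ ⋃ i, M i ∧ ∀ i, ¬ F ⊆ M i := by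
  induction h with
  | single V G =>
    rintro F ⟨a, -, b, -, hab⟩
    exact absurd (Subsingleton.elim a b) hab
  | @subst r two_le le Q W H hH ih =>
    rintro F ⟨a, ha, b, hb, hab⟩
    -- Continue inside the part that contains `F`; if there is none, the parts at this node serve.
    by_cases hF : ∃ i, F ⊆ Set.range (Sigma.mk i)
    · obtain ⟨i, hi⟩ := hF
      obtain ⟨a', rfl⟩ := hi ha
      obtain ⟨b', rfl⟩ := hi hb
      obtain ⟨r', hr', M, hM, hcov, hne⟩ := ih i (Sigma.mk i ⁻¹' F)
        ⟨a', ha, b', hb, fun h => hab (by rw [h])⟩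
      refine ⟨r', hr', fun j => Sigma.mk i '' M j, ?_, ?_, ?_⟩
      · rintro j _ ⟨x, hx, rfl⟩ _ ⟨y, hy, rfl⟩ ⟨i', v⟩ hv h
        rcases h with h | ⟨h, h'⟩
        · exact Or.inl h
        · obtain rfl : i = i' := h
          refine Or.inr ⟨rfl, hM j x hx y hy v (fun hv' => hv ⟨v, hv', rfl⟩) h'⟩
      · intro x hx
        obtain ⟨x', rfl⟩ := hi hx
        obtain ⟨j, hj⟩ := Set.mem_iUnion.1 (hcov hx)
        exact Set.mem_iUnion.2 ⟨j, x', hj, rfl⟩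
      · intro j hj
        refine hne j fun x hx => ?_
        obtain ⟨y, hy, hxy⟩ := hj hx
        obtain rfl : y = x := by simpa using hxy
        exact hy
    · refine ⟨r, le, fun i => Set.range (Sigma.mk i), ?_, ?_, fun i hi => hF ⟨i, hi⟩⟩
      · rintro i _ ⟨x, rfl⟩ _ ⟨y, rfl⟩ ⟨i', v⟩ hv h
        rcases h with h | ⟨h, h'⟩
        · exact Or.inl h
        · obtain rfl : i = i' := h
          exact absurd ⟨v, rfl⟩ hv
      · rintro ⟨i, x⟩ _
        exact Set.mem_iUnion.2 ⟨i, x, rfl⟩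
  | @iso V V' G G' e hG ih =>
    rintro F ⟨a, ha, b, hb, hab⟩
    obtain ⟨r, hr, M, hM, hcov, hne⟩ := ih (e ⁻¹' F)
      ⟨e.symm a, by simpa using ha, e.symm b, by simpa using hb, fun h => hab (e.symm.injective h)⟩
    refine ⟨r, hr, fun j => e.symm ⁻¹' M j, ?_, ?_, ?_⟩
    · intro j x hx y hy v hv h
      have := hM j _ hx _ hy (e.symm v) hv (e.symm.map_rel_iff.2 h)
      exact e.symm.map_rel_iff.1 this
    · intro x hx
      obtain ⟨j, hj⟩ := Set.mem_iUnion.1 (hcov (show e.symm x ∈ e ⁻¹' F by simpa using hx))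
      exact Set.mem_iUnion.2 ⟨j, hj⟩
    · intro j hj
      refine hne j fun x hx => ?_
      simpa using hj hx

/-- Substitute single vertices into the graph itself. For one vertex no substitution is available,
nor needed. -/
theorem modularConstructible_self {n : ℕ} (hn : 0 < n) (G : SimpleGraph (Fin n)) :
    ModularConstructible n (Fin n) G := by
  rcases Nat.lt_or_ge 1 n with h | h
  · refine .iso (G := substGraph G fun _ => (⊥ : SimpleGraph Unit)) ⟨Equiv.sigmaUnique _ _, ?_⟩
      (.subst h le_rfl G _ _ fun _ => .single Unit _)
    rintro ⟨a, x⟩ ⟨b, y⟩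
    simp [substGraph]
  · obtain rfl : n = 1 := by omega
    exact .single _ G

theorem modularWidth_spec {n : ℕ} (hn : 0 < n) (G : SimpleGraph (Fin n)) :
    0 < modularWidth G ∧ ModularConstructible (modularWidth G) (Fin n) G :=
  Nat.sInf_mem (s := {k | 0 < k ∧ ModularConstructible k (Fin n) G})
    ⟨n, hn, modularConstructible_self hn G⟩

theorem modularWidth_le {n : ℕ} (hn : 0 < n) (G : SimpleGraph (Fin n)) : modularWidth G ≤ n :=
  Nat.sInf_le ⟨hn, modularConstructible_self hn G⟩

end Modules

/-! ### The size of the reduced graph -/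

section Size

variable {G : SimpleGraph ℕ} {n : ℕ}

/-- The argument distinguishes how many core vertices outside `M` are adjacent to `M`, hence to all
of it: none contradicts connectedness; one makes all core vertices of `M` pendant; with two, a
fourth vertex in `M` would be removable. -/
theorem ncard_module_le {M : Set ℕ} (hM : IsModule G M) (hcon : ¬ IsMC G (core G n) ∅)
    (hne : ¬ core G n ⊆ M) : (M ∩ trim G (core G n)).ncard ≤ 3 := by
  classical
  set F := core G n with hF
  have hfin : ∀ S ⊆ F, S.Finite := fun S hS => (finite_verts n).subset (hS.trans (core_subset n))
  rcases (M ∩ F).eq_empty_or_nonempty with h0 | ⟨m, hm, hmF⟩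
  · have : M ∩ trim G F = ∅ := Set.subset_empty_iff.1 (h0 ▸ Set.inter_subset_inter_right M (trim_subset F))
    simp [this]
  -- Otherwise membership in `M` would be a nonconstant colouring of the core without bichromatic
  -- edges.
  have hv : ∃ v ∈ F, v ∉ M ∧ ∀ a ∈ M, G.Adj a v := by
    by_contra hno
    obtain ⟨w, hw, hwM⟩ := Set.not_subset.1 hne
    have hno' : ∀ a ∈ M, ∀ v ∈ F, v ∉ M → ¬ G.Adj a v := fun a ha v hv hvM hav =>
      hno ⟨v, hv, hvM, fun b hb => hM a ha b hb v hvM hav⟩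
    refine hcon (isMC_empty_iff.2 ⟨fun x => decide (x ∈ M), fun u hu v hv huv => ?_, m, hmF, w, hw,
      by simp [hm, hwM]⟩)
    refine decide_eq_decide.2 ⟨fun h => ?_, fun h => ?_⟩
    · by_contra h'
      exact hno' u h v hv h' huv
    · by_contra h'
      exact hno' v h u hu h' huv.symm
  obtain ⟨v, hvF, hvM, hv⟩ := hv
  by_cases hv2 : ∃ w ∈ F, w ∉ M ∧ w ≠ v ∧ ∀ a ∈ M, G.Adj a w
  · obtain ⟨w, hwF, hwM, hwv, hw⟩ := hv2
    refine (Set.ncard_le_ncard (Set.inter_subset_inter_right M (trim_subset F))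
      (hfin _ Set.inter_subset_right)).trans ?_
    by_contra! hcard
    have hx := hm
    -- Three further vertices `a`, `b`, `d` form a `K_{2,3}` with `v` and `w` that avoids `m`.
    have h3 : 2 < ((M ∩ F) \ {m}).ncard := by
      rw [Set.ncard_sdiff_singleton_of_mem (show m ∈ M ∩ F from ⟨hm, hmF⟩)]; omega
    obtain ⟨a, b, d, ⟨⟨ha, haF⟩, ham⟩, ⟨⟨hb, hbF⟩, hbm⟩, ⟨⟨hd, hdF⟩, hdm⟩, hab, had, hbd⟩ :=
      (Set.two_lt_ncard_iff ((hfin _ Set.inter_subset_right).sdiff)).1 h3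
    have hvm : v ≠ m := fun h => hvM (h ▸ hm)
    have hwm : w ≠ m := fun h => hwM (h ▸ hm)
    refine not_removable hmF ⟨⟨v, hvF, w, hwF, hwv.symm, hv m hm, hw m hm⟩, v, hvF, w, hwF,
      hwv.symm, hvm, hwm, ⟨a, haF, b, hbF, d, hdF, hab, had, hbd, ham, hbm, hdm,
        (hv a ha).symm, (hv b hb).symm, (hv d hd).symm, (hw a ha).symm, (hw b hb).symm,
        (hw d hd).symm⟩, fun y hyF hmy => ?_⟩
    -- A neighbour of `m` in `M` is adjacent to both `v` and `w`. One outside is adjacent to `a` and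
    -- `b`, because `M` is a module, and these are common neighbours of `v` and `w`.
    by_cases hyM : y ∈ M
    · exact ⟨v, ⟨hvF, hvm, Or.inl rfl⟩, w, ⟨hwF, hwm, Or.inr (Or.inl rfl)⟩, hwv.symm, hv y hyM,
        hw y hyM⟩
    · exact ⟨a, ⟨haF, ham, Or.inr (Or.inr ⟨hv a ha, hw a ha⟩)⟩, b,
        ⟨hbF, hbm, Or.inr (Or.inr ⟨hv b hb, hw b hb⟩)⟩, hab, (hM m hm a ha y hyM hmy).symm,
        (hM m hm b hb y hyM hmy).symm⟩
  · have hout : ∀ a ∈ M, ∀ y ∈ F, G.Adj a y → y ≠ v → y ∈ M := by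
      intro a ha y hy hay hyv
      by_contra hyM
      exact hv2 ⟨y, hy, hyM, hyv, fun b hb => hM a ha b hb y hyM hay⟩
    have hpend : ∀ x ∈ M, x ∈ F → Pendant G F v x := by
      intro x hx hxF
      refine ⟨hvF, hxF, (hv x hx).symm, fun z hz hxz => ?_⟩
      by_contra hzv
      have hzM := hout x hx z hz hxz hzv
      -- A neighbour `z` of `x` in `M` would give a common neighbour with `v`. All core vertices
      -- other than `v` within distance two of `x` lie in `M`, hence are adjacent to `v`; so `x`
      -- would be absorbed.
      refine not_absorbed hvF hxF ⟨(hv x hx).symm, ⟨z, hz, (hv z hzM).symm, hxz⟩,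
        fun y hy hxy hyv => ?_⟩
      have hyM := hout x hx y hy hxy hyv
      exact ⟨(hv y hyM).symm, fun w hw hyw hwv => (hv w (hout y hyM w hw hyw hwv)).symm⟩
    refine le_trans ((Set.ncard_le_one (hfin _ (Set.inter_subset_right.trans
      (trim_subset F)))).2 ?_) (by omega : 1 ≤ 3)
    rintro x ⟨hxM, hxF, hx⟩ y ⟨hyM, hyF, hy⟩
    rcases lt_trichotomy x y with h | h | h
    · exact absurd ⟨v, x, h, hpend y hyM hyF, hpend x hxM hxF⟩ hy
    · exact h
    · exact absurd ⟨v, y, h, hpend x hxM hxF, hpend y hyM hyF⟩ hx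

/-- A graph on `0, …, n - 1` as a graph on all natural numbers. -/
def natGraph {n : ℕ} (G : SimpleGraph (Fin n)) : SimpleGraph ℕ where
  Adj a b := ∃ (ha : a < n) (hb : b < n), G.Adj ⟨a, ha⟩ ⟨b, hb⟩
  symm := ⟨fun _ _ ⟨ha, hb, h⟩ => ⟨hb, ha, h.symm⟩⟩
  loopless := ⟨fun _ ⟨_, _, h⟩ => G.irrefl h⟩

/-- At most `modularWidth G` modules cover the core, and each contributes at most three vertices to
the kernel. -/
theorem ncard_trim_core_le {n : ℕ} (hn : 0 < n) (G : SimpleGraph (Fin n)) :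
    (trim (natGraph G) (core (natGraph G) n)).ncard ≤ 6 * modularWidth G := by
  obtain ⟨hpos, hmw⟩ := modularWidth_spec hn G
  set G' := natGraph G
  have hfin : ∀ S ⊆ core G' n, S.Finite :=
    fun S hS => (finite_verts n).subset (hS.trans (core_subset n))
  have hle : (trim G' (core G' n)).ncard ≤ (core G' n).ncard :=
    Set.ncard_le_ncard (trim_subset _) (hfin _ subset_rfl)
  -- A disconnected input, and likewise below a core with a single vertex, leaves at most two
  -- vertices, and the width is positive.
  rcases start_cases (G := G') hn with ⟨hs, hcon⟩ | ⟨hs, -⟩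
  swap
  · have := Set.ncard_le_ncard (core_subset_start (G := G') n)
      ((finite_verts n).subset fun x hx => hx.1)
    omega
  rw [← hs, ← isMC_core] at hcon
  rcases Nat.lt_or_ge 1 (core G' n).ncard with h2 | h2
  swap
  · omega
  obtain ⟨a, b, ha, hb, hab⟩ := (Set.one_lt_ncard_iff (hfin _ subset_rfl)).1 h2
  have han := core_subset n ha
  have hbn := core_subset n hb
  obtain ⟨r, hr, M, hM, hcov, hne⟩ := exists_modules hmw (Fin.val ⁻¹' core G' n)
    ⟨⟨a, han⟩, ha, ⟨b, hbn⟩, hb, fun h => hab (Fin.mk.inj_iff.1 h)⟩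
  have hcard : ∀ i, ((Fin.val '' M i) ∩ trim G' (core G' n)).ncard ≤ 3 := by
    intro i
    refine ncard_module_le ?_ hcon ?_
    · rintro _ ⟨x, hx, rfl⟩ _ ⟨y, hy, rfl⟩ v hv h
      obtain ⟨hxn, hvn, h⟩ := h
      exact ⟨y.2, hvn, hM i x hx y hy ⟨v, hvn⟩ (fun h => hv ⟨_, h, rfl⟩) h⟩
    · intro hsub
      refine hne i fun x hx => ?_
      obtain ⟨y, hy, hyx⟩ := hsub hx
      rwa [← Fin.ext hyx]
  have hcov' : trim G' (core G' n) ⊆ ⋃ i, ((Fin.val '' M i) ∩ trim G' (core G' n)) := by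
    intro x hx
    have hxn := core_subset n hx.1
    obtain ⟨i, hi⟩ := Set.mem_iUnion.1 (hcov (show (⟨x, hxn⟩ : Fin n) ∈ _ from hx.1))
    exact Set.mem_iUnion.2 ⟨i, ⟨_, hi, rfl⟩, hx⟩
  calc (trim G' (core G' n)).ncard
      ≤ (⋃ i, ((Fin.val '' M i) ∩ trim G' (core G' n))).ncard :=
        Set.ncard_le_ncard hcov' (Set.finite_iUnion fun i => hfin _
          (Set.inter_subset_right.trans (trim_subset _)))
    _ ≤ ∑ i, ((Fin.val '' M i) ∩ trim G' (core G' n)).ncard := Set.ncard_iUnion_le_of_fintype _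
    _ ≤ ∑ _i : Fin r, 3 := Finset.sum_le_sum fun i _ => hcard i
    _ ≤ 6 * modularWidth G := by simp; omega

end Size

end MatchingCut

/-! ## The formulas of the algorithms -/

namespace Fm

/-- disjunction -/
def or (φ ψ : Fm) : Fm := not (and (not φ) (not ψ))

/-- implication -/
def imp (φ ψ : Fm) : Fm := not (and φ (not ψ))

/-- universal quantifier -/
def all (φ : Fm) : Fm := not (ex (not φ))

/-- equality -/
def eq (i j : ℕ) : Fm := and (not (lt i j)) (not (lt j i))

/-- truth -/
def top : Fm := not (lt 0 0)

/-- adjacency in the input graph -/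
def adj (i j : ℕ) : Fm := mat 0 4 5 i j

section sat

variable {A : ℕ → ℕ → ℕ} {n d : ℕ} {e : ℕ → ℕ} {φ ψ : Fm} {i j : ℕ}

theorem sat_lt : sat A n d (lt i j) e ↔ e i < e j := Iff.rfl

theorem sat_mem {b : ℕ} : sat A n d (mem b i) e ↔ A b (e i) ≠ 0 := Iff.rfl

theorem sat_mat {b r c : ℕ} : sat A n d (mat b r c i j) e ↔ A b (A r (e i) + A c (e j)) ≠ 0 :=
  Iff.rfl

theorem sat_adj : sat A n d (adj i j) e ↔ A 0 (A 4 (e i) + A 5 (e j)) ≠ 0 := Iff.rfl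

theorem sat_not : sat A n d (not φ) e ↔ ¬ sat A n d φ e := Iff.rfl

theorem sat_and : sat A n d (and φ ψ) e ↔ sat A n d φ e ∧ sat A n d ψ e := Iff.rfl

theorem sat_ex : sat A n d (ex φ) e ↔ ∃ x : Fin n, sat A n (d + 1) φ (Function.update e d x) := by
  simp [sat, Fin.exists_iff]

theorem sat_or : sat A n d (or φ ψ) e ↔ sat A n d φ e ∨ sat A n d ψ e := by
  simp only [or, sat]; tauto

theorem sat_imp : sat A n d (imp φ ψ) e ↔ (sat A n d φ e → sat A n d ψ e) := by
  simp only [imp, sat]; tauto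

theorem sat_all : sat A n d (all φ) e ↔ ∀ x : Fin n, sat A n (d + 1) φ (Function.update e d x) := by
  simp only [all, sat_not, sat_ex, not_exists, not_not]

theorem sat_eq : sat A n d (eq i j) e ↔ e i = e j := by
  simp only [eq, sat]; omega

theorem sat_top : sat A n d top e := by simp [top, sat]

end sat

end Fm

namespace MatchingCut

open Fm

/-- The input word encodes a nonempty graph. -/
def graphF : Fm :=
  .and (ex top) (.and (all (.not (adj 0 0))) (all (all (imp (adj 0 1) (adj 1 0)))))

/-- `0` is the variable `0`. -/
def zeroF : Fm := .not (ex (lt 1 0))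

/-- one round of search -/
def reachF : Fm := .or (mem 6 1) (ex (.and (mem 6 2) (adj 2 1)))

/-- membership in `start` -/
def startF : Fm :=
  .or (all (mem 6 1)) (.or zeroF (.and (.not (mem 6 0)) (all (imp (lt 1 0) (mem 6 1)))))

/-- the variable `i` is in `D` and near to the variables `3` and `4` -/
def nearF (i : ℕ) : Fm :=
  .and (mem 8 i) (.and (.not (.eq i 1)) (.or (.eq i 3) (.or (.eq i 4) (.and (adj i 3) (adj i 4)))))

/-- the variables `3` and `4` are linked -/
def linkedF : Fm :=
  ex (.and (mem 8 5) (ex (.and (mem 8 6) (ex (.and (mem 8 7)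
    (.and (.not (.eq 5 6)) (.and (.not (.eq 5 7)) (.and (.not (.eq 6 7))
    (.and (.not (.eq 5 1)) (.and (.not (.eq 6 1)) (.and (.not (.eq 7 1))
    (.and (adj 3 5) (.and (adj 3 6) (.and (adj 3 7)
    (.and (adj 4 5) (.and (adj 4 6) (adj 4 7)))))))))))))))))

/-- the variable `1` is removable -/
def removableF : Fm :=
  .and (ex (.and (mem 8 3) (ex (.and (mem 8 4) (.and (.not (.eq 3 4)) (.and (adj 1 3) (adj 1 4)))))))
    (ex (.and (mem 8 3) (ex (.and (mem 8 4) (.and (.not (.eq 3 4)) (.and (.not (.eq 3 1))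
      (.and (.not (.eq 4 1)) (.and linkedF (all (imp (mem 8 5) (imp (adj 1 5)
        (ex (.and (nearF 6) (ex (.and (nearF 7) (.and (.not (.eq 6 7))
          (.and (adj 5 6) (adj 5 7))))))))))))))))))

/-- the variable `1` absorbs the variable `2` -/
def absorbedF : Fm :=
  .and (adj 1 2) (.and (ex (.and (mem 8 3) (.and (adj 1 3) (adj 2 3))))
    (all (imp (mem 8 3) (imp (adj 2 3) (imp (.not (.eq 3 1)) (.and (adj 1 3)
      (all (imp (mem 8 4) (imp (adj 3 4) (imp (.not (.eq 4 1)) (adj 1 4)))))))))))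

/-- membership in `step` -/
def stepF : Fm :=
  .and (mem 8 2) (.not (.and (mem 8 1) (.or (.and removableF (.eq 2 1))
    (.and (.not removableF) absorbedF))))

/-- `p` is pendant at `v` -/
def pendantF (v p l : ℕ) : Fm :=
  .and (mem 8 v) (.and (mem 8 p) (.and (adj v p) (all (imp (mem 8 l) (imp (adj p l) (.eq l v))))))

/-- the variable `0` is a surplus pendant vertex -/
def surplusF : Fm := ex (ex (.and (lt 2 0) (.and (pendantF 1 0 3) (pendantF 1 2 3))))

/-- membership in `trim` -/
def trimF : Fm := .and (mem 8 0) (.not surplusF)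

/-- an edge between vertices of `trim` in the given solution -/
def solF : Fm := .and (mem 9 0) (.and (mem 9 1) (mat 2 10 11 0 1))

/-- the given solution lifts to the edge at the pendant vertex `0` -/
def liftsF : Fm :=
  .and surplusF (ex (.and (mem 9 1) (ex (.and (mem 9 2) (.and (pendantF 1 0 3)
    (.and (pendantF 1 2 3) (mat 2 10 11 1 2)))))))

/-- an edge at the pendant vertex `0` -/
def edgesAtF : Fm :=
  .and (mem 8 1) (.and (mem 8 2) (.and (adj 1 2) (.or (.eq 1 0) (.eq 2 0))))

/-! ### The meaning of the formulas in terms of the represented graph -/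

section Semantics

variable {A : ℕ → ℕ → ℕ} {n : ℕ} {G : SimpleGraph ℕ} {D : Set ℕ} {e : ℕ → ℕ}

/-- Bounded quantifiers, on the mathematical side, are brought into the form of `sat_ex` and
`sat_all`, so that both sides of the following equivalences simplify to the same statement. -/
theorem bex_fin {P : ℕ → Prop} : (∃ x, x < n ∧ P x) ↔ ∃ x : Fin n, P x := by
  simp [Fin.exists_iff]

theorem ball_fin {P : ℕ → Prop} : (∀ x, x < n → P x) ↔ ∀ x : Fin n, P x := by
  simp [Fin.forall_iff]

/-- The arrays `0`, `4` and `5` represent the graph `G`. -/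
def Represents (A : ℕ → ℕ → ℕ) (n : ℕ) (G : SimpleGraph ℕ) : Prop :=
  ∀ i < n, ∀ j < n, (A 0 (A 4 i + A 5 j) ≠ 0 ↔ G.Adj i j)

theorem Represents.fin (hA : Represents A n G) (i j : Fin n) :
    A 0 (A 4 i + A 5 j) ≠ 0 ↔ G.Adj i j := hA i i.2 j j.2

theorem sat_zeroF {x : ℕ} (hx : x < n) : zeroF.sat A n 1 (Function.update e 0 x) ↔ x = 0 := by
  simp only [zeroF, sat_not, sat_ex, sat_lt, Function.update_self,
    Function.update_of_ne, ne_eq, zero_ne_one, not_false_eq_true]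
  constructor
  · intro h
    by_contra h0
    exact h ⟨⟨0, by omega⟩, by simpa using Nat.pos_of_ne_zero h0⟩
  · rintro rfl ⟨y, hy⟩
    exact absurd hy (Nat.not_lt_zero _)

/-- The element is variable `1`, since variable `0` lives in the register of the surrounding loop
counter. -/
theorem sat_reachF (hA : Represents A n G) {R : Set ℕ} (hR : ∀ x < n, (A 6 x ≠ 0 ↔ x ∈ R)) {x : ℕ}
    (hx : x < n) : reachF.sat A n 2 (Function.update e 1 x) ↔ x ∈ reachStep G n R := by
  have hR' : ∀ x : Fin n, (A 6 x ≠ 0 ↔ (x : ℕ) ∈ R) := fun x => hR x x.2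
  lift x to Fin n using hx with x hx
  simp only [reachF, sat_or, sat_mem, sat_ex, sat_and, sat_adj, Function.update_self,
    Function.update_of_ne, ne_eq, OfNat.one_ne_ofNat, not_false_eq_true]
  simp only [hR', hA.fin, reachStep, Set.mem_ofPred_eq, bex_fin, x.2, true_and]

theorem sat_startF (hR : ∀ x < n, (A 6 x ≠ 0 ↔ x ∈ reach G n)) {x : ℕ}
    (hx : x < n) : startF.sat A n 1 (Function.update e 0 x) ↔ x ∈ start G n := by
  have hR' : ∀ x : Fin n, (A 6 x ≠ 0 ↔ (x : ℕ) ∈ reach G n) := fun x => hR x x.2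
  lift x to Fin n using hx with x hx
  simp only [startF, sat_or, sat_mem, sat_all, sat_imp, sat_lt, sat_not, sat_and, sat_zeroF x.2,
    Function.update_self, Function.update_of_ne, ne_eq, zero_ne_one, not_false_eq_true]
  simp only [hR', start, Set.mem_ofPred_eq, x.2, true_and]
  refine or_congr ball_fin.symm (or_congr Iff.rfl (and_congr Iff.rfl ?_))
  exact ⟨fun h z hz => h ⟨z, hz.trans x.2⟩ hz, fun h z hz => h z hz⟩

/-- Variable `0` is the round, variable `1` the vertex `v` of the inner loop, and variable `2` the
element to be tested; hence the condition on `e 1`. -/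
theorem sat_stepF (hA : Represents A n G) (hD : ∀ x, x ∈ D ↔ x < n ∧ A 8 x ≠ 0) {v x : ℕ}
    (hx : x < n) (hv : v < n) (he : e 1 = v) :
    stepF.sat A n 3 (Function.update e 2 x) ↔ x ∈ step G v D := by
  lift x to Fin n using hx with x hx
  lift v to Fin n using hv with v hv
  simp only [stepF, removableF, absorbedF, linkedF, nearF, sat_or, sat_mem, sat_all, sat_ex,
    sat_imp, sat_eq, sat_adj, sat_not, sat_and, Nat.reduceAdd,
    Function.update_self, Function.update_of_ne, ne_eq, OfNat.one_ne_ofNat, not_false_eq_true,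
    Nat.reduceEqDiff, he]
  simp only [hA.fin, step, Removable, Absorbed, Linked, Near, Set.mem_ofPred_eq, hD,
    and_imp, and_assoc, bex_fin, ball_fin, x.2, v.2, true_and]

/-- The bound variable must be the level `d` at which the formula is evaluated, and must not clash
with `v` or `p`. -/
theorem sat_pendantF (hA : Represents A n G) (hD : ∀ x, x ∈ D ↔ x < n ∧ A 8 x ≠ 0) {d v p l : ℕ}
    (hv : e v < n) (hp : e p < n) (hlv : v ≠ l) (hlp : p ≠ l) (hd : d = l) :
    (pendantF v p l).sat A n d e ↔ Pendant G D (e v) (e p) := by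
  subst hd
  have hA' : A 0 (A 4 (e v) + A 5 (e p)) ≠ 0 ↔ G.Adj (e v) (e p) := hA _ hv _ hp
  have hA'' : ∀ w : Fin n, A 0 (A 4 (e p) + A 5 w) ≠ 0 ↔ G.Adj (e p) w := fun w => hA _ hp _ w.2
  simp only [pendantF, sat_mem, sat_all, sat_imp, sat_eq, sat_adj, sat_and,
    Function.update_self, Function.update_of_ne hlv, Function.update_of_ne hlp]
  simp only [hA', hA'', Pendant, hD, and_imp, ball_fin, hv, hp, true_and]

theorem sat_surplusF (hA : Represents A n G) (hD : ∀ x, x ∈ D ↔ x < n ∧ A 8 x ≠ 0) {x : ℕ}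
    (hx : x < n) : surplusF.sat A n 1 (Function.update e 0 x) ↔ Surplus G D x := by
  simp only [surplusF, sat_ex, sat_and, sat_lt, Nat.reduceAdd]
  have key : ∀ v y : Fin n, ((pendantF 1 0 3).sat A n 3
      (Function.update (Function.update (Function.update e 0 x) 1 v) 2 y) ↔ Pendant G D v x) ∧
      ((pendantF 1 2 3).sat A n 3
      (Function.update (Function.update (Function.update e 0 x) 1 v) 2 y) ↔ Pendant G D v y) := by
    intro v y
    constructor
    · rw [sat_pendantF hA hD (by simp) (by simpa using hx) (by simp) (by simp) rfl]; simp
    · rw [sat_pendantF hA hD (by simp) (by simp) (by simp) (by simp) rfl]; simp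
  simp only [key]
  simp only [Function.update_self, Function.update_of_ne, ne_eq, OfNat.zero_ne_ofNat, zero_ne_one,
    not_false_eq_true]
  constructor
  · rintro ⟨v, y, h⟩
    exact ⟨v, y, h⟩
  -- In `Surplus` the witnesses range over all numbers, but pendant vertices and their centres lie
  -- in `D`, hence below `n`.
  · rintro ⟨v, y, h, h1, h2⟩
    exact ⟨⟨v, ((hD v).1 h1.1).1⟩, ⟨y, ((hD y).1 h2.2.1).1⟩, h, h1, h2⟩

theorem sat_trimF (hA : Represents A n G) (hD : ∀ x, x ∈ D ↔ x < n ∧ A 8 x ≠ 0) {x : ℕ}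
    (hx : x < n) : trimF.sat A n 1 (Function.update e 0 x) ↔ x ∈ trim G D := by
  simp only [trimF, sat_and, sat_not, sat_surplusF hA hD hx, sat_mem, Function.update_self, trim,
    Set.mem_ofPred_eq, hD, hx, true_and]

theorem sat_liftsF (hA : Represents A n G) (hD : ∀ x, x ∈ D ↔ x < n ∧ A 8 x ≠ 0)
    (hT : ∀ x, x ∈ trim G D ↔ x < n ∧ A 9 x ≠ 0) {M : Set (Sym2 ℕ)}
    (hM : ∀ i ∈ trim G D, ∀ j ∈ trim G D, (A 2 (A 10 i + A 11 j) ≠ 0 ↔ s(i, j) ∈ M)) {x : ℕ}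
    (hx : x < n) : liftsF.sat A n 1 (Function.update e 0 x) ↔ Lifts G D M x := by
  simp only [liftsF, sat_and, sat_surplusF hA hD hx, sat_ex, Nat.reduceAdd]
  have key : ∀ v y : Fin n, ((pendantF 1 0 3).sat A n 3
      (Function.update (Function.update (Function.update e 0 x) 1 v) 2 y) ↔ Pendant G D v x) ∧
      ((pendantF 1 2 3).sat A n 3
      (Function.update (Function.update (Function.update e 0 x) 1 v) 2 y) ↔ Pendant G D v y) := by
    intro v y
    constructor
    · rw [sat_pendantF hA hD (by simp) (by simpa using hx) (by simp) (by simp) rfl]; simp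
    · rw [sat_pendantF hA hD (by simp) (by simp) (by simp) (by simp) rfl]; simp
  simp only [key, sat_mem, sat_mat]
  simp only [Function.update_self, Function.update_of_ne, ne_eq, OfNat.one_ne_ofNat,
    not_false_eq_true]
  refine and_congr Iff.rfl ⟨?_, ?_⟩
  · rintro ⟨v, hv, q, hq, h1, h2, h3⟩
    have hv' := (hT v).2 ⟨v.2, hv⟩
    have hq' := (hT q).2 ⟨q.2, hq⟩
    exact ⟨v, hv', q, hq', h1, h2, (hM v hv' q hq').1 h3⟩
  · rintro ⟨v, hv, q, hq, h1, h2, h3⟩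
    have hv' := (hT v).1 hv
    have hq' := (hT q).1 hq
    exact ⟨⟨v, hv'.1⟩, hv'.2, ⟨q, hq'.1⟩, hq'.2, h1, h2, (hM v hv q hq).2 h3⟩

open Classical in
theorem sat_edgesAtF (hA : Represents A n G) (hD : ∀ x, x ∈ D ↔ x < n ∧ A 8 x ≠ 0) {p i j : ℕ}
    (hi : i < n) (hj : j < n) (he : e 0 = p) :
    edgesAtF.sat A n 3 (Function.update (Function.update e 1 i) 2 j) ↔
      s(i, j) ∈ edgesAt G D p := by
  simp only [edgesAtF, sat_and, sat_or, sat_eq, sat_mem, sat_adj, Function.update_self,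
    Function.update_of_ne, ne_eq, OfNat.one_ne_ofNat, OfNat.zero_ne_ofNat, zero_ne_one,
    not_false_eq_true, he]
  rw [← ne_eq (A 0 _), hA i hi j hj]
  constructor
  · rintro ⟨h1, h2, h3, h4⟩
    exact ⟨i, (hD i).2 ⟨hi, h1⟩, j, (hD j).2 ⟨hj, h2⟩, h3, h4, rfl⟩
  · rintro ⟨u, hu, v, hv, h3, h4, h⟩
    rw [Sym2.eq_iff] at h
    rcases h with ⟨rfl, rfl⟩ | ⟨rfl, rfl⟩
    · exact ⟨((hD _).1 hu).2, ((hD _).1 hv).2, h3, h4⟩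
    · exact ⟨((hD _).1 hv).2, ((hD _).1 hu).2, h3.symm, h4.symm⟩

end Semantics

end MatchingCut

/-! ## The programs -/

namespace MatchingCut

open Prog Fm

/-- Put into `r 3` the least `n` with `r 0 ≤ n * n`, and into `r 5` the difference. -/
def sqrtProg : Prog :=
  .seq (.const 4 0) (.seq (.add 3 0 4) (.seq (.const 6 0) (.seq (.const 7 0)
    (.seq (loop 10 (.seq (.sub 8 0 7) (.ite 8
      (.seq (.add 7 7 6) (.seq (.add 7 7 6) (.seq (.const 4 1) (.seq (.add 7 7 4) (.add 6 6 4)))))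
      (.const 4 0)))) (.seq (.const 4 0) (.seq (.add 3 6 4) (.sub 5 7 0)))))))

/-- Register `6` counts upwards with its square in register `7`, updated by `(k + 1)² = k² + 2k +
1`, until the square reaches the length. Since `l ≤ l²`, a loop of `l` rounds is long enough. -/
theorem sqrtProg_ok {s : MState} {l : ℕ} (hl : s.reg 0 = l) :
    sqrtProg.Ok s (l * 11 + 10) fun s' => s'.arr = s.arr ∧ s'.out = s.out ∧ s'.cur = s.cur ∧
      s'.reg 3 ≤ l ∧ (∀ m, m * m = l → s'.reg 3 = m) ∧
        (s'.reg 5 = 0 ↔ s'.reg 3 * s'.reg 3 = l) := by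
  have main : sqrtProg.Ok s (1 + (1 + (1 + (1 + ((l * (7 + 4) + 3) + (1 + (1 + 1)))))))
      fun s' => s'.arr = s.arr ∧ s'.out = s.out ∧ s'.cur = s.cur ∧
        s'.reg 3 ≤ l ∧ (∀ m, m * m = l → s'.reg 3 = m) ∧
          (s'.reg 5 = 0 ↔ s'.reg 3 * s'.reg 3 = l) := by
    refine Ok.seq (Ok.const (Ok.seq (Ok.add (Ok.seq (Ok.const (Ok.seq (Ok.const (Ok.seq ?_))))))))
    -- The bound on the square of the predecessor keeps register `6` from overshooting the root; the
    -- last alternative says that either every round so far was effective or the target is reached.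
    refine (loop_ok (n := l) (Tb := 7) (by omega) (by simp [hl]) (fun i s' =>
      s'.arr = s.arr ∧ s'.out = s.out ∧ s'.cur = s.cur ∧ s'.reg 0 = l ∧
      s'.reg 7 = s'.reg 6 * s'.reg 6 ∧ (s'.reg 6 = 0 ∨ (s'.reg 6 - 1) * (s'.reg 6 - 1) < l) ∧
      (i ≤ s'.reg 6 ∨ l ≤ s'.reg 7)) ?_ ?_ ?_).imp ?_
    · simp [hl]
    · rintro i s' a b ⟨h1, h2, h3, h4, h5, h6, h7⟩
      refine ⟨h1, h2, h3, ?_, ?_, ?_, ?_⟩ <;> simpa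
    · rintro i hi s' ⟨h1, h2, h3, h4, h5, h6, h7⟩ hz hn
      refine Ok.seq (T := 1) (T' := 6) (Ok.sub (Ok.ite (T := 5) (fun h => ?_) (fun h => ?_)))
      · simp only [Function.update_self] at h
        refine Ok.seq (T := 1) (T' := 4) (Ok.add (Ok.seq (T := 1) (T' := 3) (Ok.add (Ok.seq
          (T := 1) (T' := 2) (Ok.const (Ok.seq (Ok.add (Ok.add ?_))))))))
        have h0 : s'.reg 7 < l := by omega
        refine ⟨by simpa using hz, by simpa using hn, h1, h2, h3, by simpa using h4, ?_, ?_, ?_⟩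
        · simp [h5]; ring
        · right; simp [← h5, h0]
        · left; simp; omega
      · simp only [Function.update_self] at h
        refine (Ok.const (Q := _) ⟨by simpa using hz, by simpa using hn, h1, h2, h3,
          by simpa using h4, by simpa using h5, by simpa using h6, ?_⟩).le (by omega)
        right; simp; omega
    · rintro s' ⟨⟨h1, h2, h3, h4, h5, h6, h7⟩, -⟩
      refine Ok.seq (Ok.const (Ok.seq (Ok.add (Ok.sub ?_))))
      have hle : s'.reg 6 ≤ l := by
        rcases h6 with h | h
        · omega
        · have := Nat.le_mul_self (s'.reg 6 - 1)
          omega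
      have hsq : l ≤ s'.reg 6 * s'.reg 6 := by
        rcases h7 with h | h
        · exact h.trans (Nat.le_mul_self _)
        · rwa [← h5]
      refine ⟨h1, h2, h3, by simpa using hle, fun m hm => ?_, ?_⟩
      · simp only [Function.update_self, Function.update_of_ne, ne_eq, Nat.reduceEqDiff,
          not_false_eq_true, add_zero]
        rw [← hm] at h6 hsq
        have hm1 : m ≤ s'.reg 6 := Nat.mul_self_le_mul_self_iff.1 hsq
        rcases h6 with h | h
        · omega
        · have := Nat.mul_self_lt_mul_self_iff.1 h
          omega
      · simp [h4, h5]; omega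
  exact main.le (by omega)

/-! ### Programs for matrix offsets, reduction and ranks -/

/-- A bound for the time of `compr`. -/
def comprTime (n : ℕ) (φ : Fm) : ℕ := n * (φ.cost n + 5) + 3

/-- Tabulate `i * n` in the array `4` and `i` in the array `5`. -/
def setup : Prog :=
  .seq (compr 0 3 top) (.seq (.const 4 0) (.seq (.add 8 3 4) (rank 0 3 5 4)))

/-- A bound for the time of `setup`. -/
def setupTime (n : ℕ) : ℕ := comprTime n top + (1 + (1 + (n * 11 + 5)))

theorem setup_ok {s : MState} {n : ℕ} (hn : s.reg 3 = n) :
    setup.Ok s (setupTime n) fun s' => s.SameOff 0 [3, 4, 5] s' ∧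
      ∀ i < n, s'.arr 4 i = n * i ∧ s'.arr 5 i = i := by
  refine Ok.seq ((compr_ok (by decide) (by decide) hn).imp ?_)
  rintro s1 ⟨h1, h2⟩
  simp only [sat_top, iff_true] at h2
  refine Ok.seq (Ok.const (Ok.seq (Ok.add ?_)))
  have h3 : s1.reg 3 = n := (h1.reg 3 (by omega) (by omega)).trans hn
  refine (rank_ok (n := n) (m := n) (by omega) (by omega) (by omega) (by simp [h3])
    (by simp [h3])).imp ?_
  rintro s2 ⟨h4, -, h5⟩
  refine ⟨(((h1.mono le_rfl (by simp)).update (by omega)).update (by omega)).trans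
    (h4.mono le_rfl (by simp)), fun i hi => ?_⟩
  obtain ⟨h6, h7⟩ := h5 i hi
  -- Array `3` marks every number below `n`, so ranking it reproduces the numbers themselves,
  -- together with their multiples by `n`.
  have hc : Nat.count (fun x => s1.arr 3 x ≠ 0) i = i :=
    Nat.count_iff_forall.2 fun x hx => h2 x (hx.trans hi)
  simp only [hc] at h6 h7
  exact ⟨h7, h6⟩

/-- Compute `core` and `trim` in the arrays `8` and `9`. -/
def reduction : Prog :=
  .seq (compr 0 6 zeroF) (.seq (loop 10 (.seq (compr 1 7 reachF) (compr 1 6 (mem 7 1))))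
    (.seq (compr 0 8 startF) (.seq (loop 10 (loop 11 (.seq (compr 2 7 stepF) (compr 2 8 (mem 7 2)))))
      (compr 0 9 trimF))))

/-- A bound for the time of `reduction`. -/
def reductionTime (n : ℕ) : ℕ :=
  comprTime n zeroF + ((n * (comprTime n reachF + comprTime n (mem 7 1) + 4) + 3) +
    (comprTime n startF + ((n * (n * (comprTime n stepF + comprTime n (mem 7 2) + 4) + 3 + 4) + 3) +
      comprTime n trimF)))

/-- The loop invariants identify the arrays `6` and `8` with the iterates in the definitions of
`reach` and `core`; the inner loop follows the left fold in `pass`. -/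
theorem reduction_ok {s : MState} {n : ℕ} {G : SimpleGraph ℕ} (hn : s.reg 3 = n)
    (hG : Represents s.arr n G) :
    reduction.Ok s (reductionTime n) fun s' => s.SameOff 0 [6, 7, 8, 9] s' ∧
      (∀ x < n, (s'.arr 8 x ≠ 0 ↔ x ∈ core G n)) ∧
      ∀ x < n, (s'.arr 9 x ≠ 0 ↔ x ∈ trim G (core G n)) := by
  have rep : ∀ {d s'}, s.SameOff d [6, 7, 8, 9] s' → Represents s'.arr n G := by
    intro d s' h i hi j hj
    rw [h.arr 0 (by simp), h.arr 4 (by simp), h.arr 5 (by simp)]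
    exact hG i hi j hj
  have reg3 : ∀ {d s'}, s.SameOff d [6, 7, 8, 9] s' → s'.reg 3 = n :=
    fun h => (h.reg 3 (by omega) (by omega)).trans hn
  refine Ok.seq ((compr_ok (by decide) (by decide) hn).imp ?_)
  rintro s1 ⟨h1, h1'⟩
  have e1 : s.SameOff 0 [6, 7, 8, 9] s1 := h1.mono le_rfl (by simp)
  refine Ok.seq ((loop_ok (by omega) (reg3 e1) (fun i s' => s.SameOff 0 [6, 7, 8, 9] s' ∧
    ∀ x < n, (s'.arr 6 x ≠ 0 ↔ x ∈ (reachStep G n)^[i] {x | x < n ∧ x = 0}))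
    ⟨e1, fun x hx => ?_⟩ ?_ ?_).imp ?_)
  · rw [h1' x hx, sat_zeroF hx]
    simp [hx]
  · rintro i s' a b ⟨h2, h3⟩
    exact ⟨(h2.update (by omega)).update (by omega), h3⟩
  · rintro i hi s' ⟨h2, h3⟩ hz h4
    refine Ok.seq ((compr_ok (by decide) (by decide) h4).imp ?_)
    rintro s2 ⟨h5, h6⟩
    have e2 : s.SameOff 0 [6, 7, 8, 9] s2 := h2.trans (h5.mono (by omega) (by simp))
    refine (compr_ok (by decide) (by decide) (reg3 e2)).imp ?_
    rintro s3 ⟨h7, h8⟩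
    refine ⟨?_, ?_, e2.trans (h7.mono (by omega) (by simp)), fun x hx => ?_⟩
    · rw [h7.reg 10 (by omega) (by omega), h5.reg 10 (by omega) (by omega), hz]
    · exact (h7.reg 3 (by omega) (by omega)).trans (reg3 e2)
    · rw [h8 x hx, Function.iterate_succ_apply', ← sat_reachF (rep h2) h3 hx (e := s'.env), ← h6 x hx]
      simp [sat_mem]
  rintro s2 ⟨⟨h2, h3⟩, h4⟩
  refine Ok.seq ((compr_ok (by decide) (by decide) h4).imp ?_)
  rintro s3 ⟨h5, h6⟩
  have e3 : s.SameOff 0 [6, 7, 8, 9] s3 := h2.trans (h5.mono (by omega) (by simp))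
  refine Ok.seq ((loop_ok (Tb := n * (comprTime n stepF + comprTime n (mem 7 2) + 4) + 3)
    (by omega) (reg3 e3) (fun i s' => s.SameOff 0 [6, 7, 8, 9] s' ∧
      ∀ x < n, (s'.arr 8 x ≠ 0 ↔ x ∈ (pass G n)^[i] (start G n)))
    ⟨e3, fun x hx => ?_⟩ ?_ ?_).imp ?_)
  · rw [h6 x hx, sat_startF h3 hx]
    simp
  · rintro i s' a b ⟨h2, h3⟩
    exact ⟨(h2.update (by omega)).update (by omega), h3⟩
  · rintro i hi s4 ⟨h7, h8⟩ hz h9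
    have hsub : ∀ (D : Set ℕ) (v : ℕ), D ⊆ verts n → step G v D ⊆ verts n :=
      fun D v hD => (step_subset v D).trans hD
    -- An array describes a set only below `n`, so the iterates must be known to contain nothing
    -- beyond.
    have hpass : ∀ i, (pass G n)^[i] (start G n) ⊆ verts n := by
      intro i
      induction i with
      | zero => exact fun x hx => hx.1
      | succ i ih =>
        rw [Function.iterate_succ_apply']
        exact (foldl_step_subset _ _).trans ih
    refine (loop_ok (by omega) h9 (fun j s' => s4.SameOff 1 [6, 7, 8, 9] s' ∧
      ∀ x < n, (s'.arr 8 x ≠ 0 ↔ x ∈ (List.range j).foldl (fun D v => step G v D)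
        ((pass G n)^[i] (start G n)))) ⟨.refl _ _ _, h8⟩ ?_ ?_).imp ?_
    · rintro j s' a b ⟨h2, h3⟩
      exact ⟨(h2.update (by omega)).update (by omega), h3⟩
    · rintro j hj s5 ⟨h10, h11⟩ hz5 h12
      have e5 : s.SameOff 0 [6, 7, 8, 9] s5 := h7.trans (h10.mono (by omega) (by simp))
      refine Ok.seq ((compr_ok (by decide) (by decide) h12).imp ?_)
      rintro s6 ⟨h13, h14⟩
      have e6 : s.SameOff 0 [6, 7, 8, 9] s6 := e5.trans (h13.mono (by omega) (by simp))
      refine (compr_ok (by decide) (by decide) (reg3 e6)).imp ?_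
      rintro s7 ⟨h15, h16⟩
      refine ⟨?_, ?_, h10.trans ((h13.mono (by omega) (by simp)).trans
        (h15.mono (by omega) (by simp))), fun x hx => ?_⟩
      · rw [h15.reg 11 (by omega) (by omega), h13.reg 11 (by omega) (by omega), hz5]
      · exact (h15.reg 3 (by omega) (by omega)).trans (reg3 e6)
      -- The counter of the inner loop is register `11`, that is variable `1`; by `hz5` the step is
      -- performed at vertex `j`.
      · rw [h16 x hx, List.range_succ, List.foldl_append, List.foldl_cons, List.foldl_nil,
          ← sat_stepF (rep e5) (A := s5.arr) (fun y => ?_) hx hj (e := s5.env) hz5, ← h14 x hx]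
        · simp [sat_mem]
        · constructor
          · intro hy
            have hyn := (foldl_step_subset _ _).trans (hpass i) hy
            exact ⟨hyn, (h11 y hyn).2 hy⟩
          · rintro ⟨hyn, hy⟩
            exact (h11 y hyn).1 hy
    · rintro s5 ⟨⟨h10, h11⟩, h12⟩
      refine ⟨(h10.reg 10 (by omega) (by omega)).trans hz, h12,
        h7.trans (h10.mono (by omega) (by simp)), fun x hx => ?_⟩
      rw [h11 x hx, Function.iterate_succ_apply']
      rfl
  rintro s4 ⟨⟨h7, h8⟩, h9⟩
  refine (compr_ok (by decide) (by decide) h9).imp ?_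
  rintro s5 ⟨h10, h11⟩
  refine ⟨h7.trans (h10.mono (by omega) (by simp)), fun x hx => ?_, fun x hx => ?_⟩
  · rw [h10.arr 8 (by simp)]
    exact h8 x hx
  · rw [h11 x hx]
    refine sat_trimF (rep h7) (fun y => ⟨fun hy => ?_, fun ⟨hyn, hy⟩ => (h8 y hyn).1 hy⟩) hx
    exact ⟨core_subset n hy, (h8 y (core_subset n hy)).2 hy⟩

/-- Tabulate, in the arrays `10` and `11`, the positions of the vertices of `trim`. -/
def ranks : Prog :=
  .seq (.const 8 0) (.seq (rank 0 9 11 10) (.seq (.const 4 0) (.seq (.add 8 6 4) (rank 0 9 11 10))))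

/-- The first ranking, with factor `0`, only serves to find the size of the kernel; the second one
uses this size as the row length. -/
theorem ranks_ok {s : MState} {n : ℕ} (hn : s.reg 3 = n) :
    ranks.Ok s (n * 22 + 13) fun s' => s.SameOff 0 [10, 11] s' ∧
      ∀ x < n, s'.arr 11 x = Nat.count (fun x => s.arr 9 x ≠ 0) x ∧
        s'.arr 10 x = Nat.count (fun x => s.arr 9 x ≠ 0) n * Nat.count (fun x => s.arr 9 x ≠ 0) x := by
  have main : ranks.Ok s (1 + ((n * 11 + 5) + (1 + (1 + (n * 11 + 5))))) fun s' =>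
      s.SameOff 0 [10, 11] s' ∧
      ∀ x < n, s'.arr 11 x = Nat.count (fun x => s.arr 9 x ≠ 0) x ∧
        s'.arr 10 x =
          Nat.count (fun x => s.arr 9 x ≠ 0) n * Nat.count (fun x => s.arr 9 x ≠ 0) x := by
    refine Ok.seq (Ok.const (Ok.seq ((rank_ok (n := n) (m := 0) (by omega) (by omega) (by omega)
      (by simp [hn]) (by simp)).imp ?_)))
    rintro s1 ⟨h1, h2, -⟩
    have e1 : s.SameOff 0 [10, 11] s1 :=
      ((MState.SameOff.refl _ _ _).update (by omega)).trans (h1.mono le_rfl (by simp))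
    have h3 : s1.reg 3 = n := (e1.reg 3 (by omega) (by omega)).trans hn
    refine Ok.seq (Ok.const (Ok.seq (Ok.add ?_)))
    refine (rank_ok (n := n) (m := Nat.count (fun x => s.arr 9 x ≠ 0) n) (by omega) (by omega)
      (by omega) (by simp [h3]) (by simp [h2])).imp ?_
    rintro s2 ⟨h4, -, h5⟩
    refine ⟨((e1.update (by omega)).update (by omega)).trans (h4.mono le_rfl (by simp)), ?_⟩
    have h9 : s1.arr 9 = s.arr 9 := e1.arr 9 (by simp)
    simp only [h9] at h5
    exact h5
  exact main.le (by omega)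

end MatchingCut

/-! ## Words -/

namespace MatchingCut

open MCComputable

/-- `x` is the encoding of a nonempty graph. -/
def IsCode (x : Word) : Prop := ∃ (n : ℕ) (G : SimpleGraph (Fin n)), 0 < n ∧ x = encodeGraph G

theorem encodeEdges_injective {n : ℕ} : Function.Injective (encodeEdges (n := n)) := by
  intro M M' h
  refine Set.Subset.antisymm ?_ ?_ <;> rw [subset_iff, h] <;> rintro ⟨t, -, h1, h2⟩ <;>
    simp [h1] at h2

/-- The length of the word determines the number of vertices, and the bits determine the edges. -/
theorem encodeGraph_injective {n n' : ℕ} {G : SimpleGraph (Fin n)} {G' : SimpleGraph (Fin n')}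
    (h : encodeGraph G = encodeGraph G') : ∃ e : n = n', e ▸ G = G' := by
  have hl := congrArg List.length h
  simp only [encodeGraph, length_encodeEdges] at hl
  obtain rfl : n = n' := Nat.mul_self_inj.1 hl
  exact ⟨rfl, SimpleGraph.edgeSet_inj.1 (encodeEdges_injective h)⟩

theorem minimalMCSol_encodeGraph {n : ℕ} (hn : 0 < n) (G : SimpleGraph (Fin n)) :
    minimalMCSol (encodeGraph G) = {w | ∃ N, IsMinimalMatchingCut G N ∧ w = encodeEdges N} := by
  ext w
  constructor
  · rintro ⟨n', G', M, -, h, hM, rfl⟩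
    obtain ⟨rfl, rfl⟩ := encodeGraph_injective h
    exact ⟨M, hM, rfl⟩
  · rintro ⟨N, hN, rfl⟩
    exact ⟨n, G, N, hn, rfl, hN, rfl⟩

theorem modularWidthParam_encodeGraph {n : ℕ} (hn : 0 < n) (G : SimpleGraph (Fin n)) :
    modularWidthParam (encodeGraph G) = modularWidth G := by
  have : {k | ∃ (n' : ℕ) (G' : SimpleGraph (Fin n')),
      0 < n' ∧ encodeGraph G = encodeGraph G' ∧ k = modularWidth G'} = {modularWidth G} := by
    ext k
    constructor
    · rintro ⟨n', G', -, h, rfl⟩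
      obtain ⟨rfl, rfl⟩ := encodeGraph_injective h
      rfl
    · rintro rfl
      exact ⟨n, G, hn, rfl, rfl⟩
  rw [modularWidthParam, this, csInf_singleton]

theorem modularWidthParam_of_not {x : Word} (hx : ¬ IsCode x) : modularWidthParam x = 0 := by
  have : {k | ∃ (n : ℕ) (G : SimpleGraph (Fin n)),
      0 < n ∧ x = encodeGraph G ∧ k = modularWidth G} = ∅ := by
    rw [Set.eq_empty_iff_forall_notMem]
    rintro k ⟨n, G, hn, h, -⟩
    exact hx ⟨n, G, hn, h⟩
  rw [modularWidthParam, this, Nat.sInf_empty]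

theorem minimalMCSol_of_not {x : Word} (hx : ¬ IsCode x) : minimalMCSol x = ∅ := by
  rw [Set.eq_empty_iff_forall_notMem]
  rintro w ⟨n, G, M, hn, h, -⟩
  exact hx ⟨n, G, hn, h⟩

theorem not_isCode_nil : ¬ IsCode [] := by
  rintro ⟨n, G, hn, h⟩
  have := congrArg List.length h
  simp only [encodeGraph, length_encodeEdges, List.length_nil] at this
  have := Nat.mul_pos hn hn
  omega

open Classical in
/-- The matrix with the rows and columns `l` of a set of edges. -/
noncomputable def natWord (l : List ℕ) (M : Set (Sym2 ℕ)) : Word :=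
  l.flatMap fun i => l.map fun j => decide (s(i, j) ∈ M)

theorem natWord_eq {m : ℕ} {l : List ℕ} (e : Fin m → ℕ) (hl : List.ofFn e = l)
    {N : Set (Sym2 (Fin m))} {M : Set (Sym2 ℕ)} (h : ∀ i j, s(i, j) ∈ N ↔ s(e i, e j) ∈ M) :
    natWord l M = encodeEdges N := by
  classical
  subst hl
  unfold natWord encodeEdges
  rw [List.ofFn_mul, List.flatMap_def, List.map_ofFn]
  congr 2
  funext i
  simp only [Function.comp, List.map_ofFn]
  congr 1
  funext j
  have hm : 0 < m := i.pos
  have h1 : (⟨i * m + j, idx_lt i.2 j.2⟩ : Fin (m * m)).divNat = i := by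
    ext
    simp only [Fin.coe_divNat]
    rw [mul_comm, Nat.mul_add_div hm, Nat.div_eq_of_lt j.2, add_zero]
  have h2 : (⟨i * m + j, idx_lt i.2 j.2⟩ : Fin (m * m)).modNat = j := by
    ext
    simp only [Fin.coe_modNat]
    rw [mul_comm, Nat.mul_add_mod, Nat.mod_eq_of_lt j.2]
  simp only [h1, h2, h, Function.comp]

/-! ### Edge sets as matrices indexed by a list of vertices -/

section List

variable {G : SimpleGraph ℕ} {l : List ℕ}

/-- The subgraph induced by the vertices in a list. -/
def listGraph (G : SimpleGraph ℕ) (l : List ℕ) : SimpleGraph (Fin l.length) := G.comap l.get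

theorem natWord_edgeSet : natWord l G.edgeSet = encodeGraph (listGraph G l) :=
  natWord_eq l.get (List.ofFn_get l) fun _ _ => Iff.rfl

theorem natWord_image (hl : l.Nodup) (N : Set (Sym2 (Fin l.length))) :
    natWord l (Sym2.map l.get '' N) = encodeEdges N := by
  refine natWord_eq l.get (List.ofFn_get l) fun i j => ?_
  have hinj := Sym2.map.injective (List.nodup_iff_injective_get.1 hl)
  exact (hinj.mem_set_image (a := s(i, j))).symm

theorem mem_sol_list (hl : l.Nodup) {M : Set (Sym2 ℕ)} : M ∈ Sol G {x | x ∈ l} ↔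
    ∃ N, IsMinimalMatchingCut (listGraph G l) N ∧ M = Sym2.map l.get '' N := by
  have hr : {x | x ∈ l} = Set.range l.get := by
    ext x
    simp [List.mem_iff_get]
  rw [hr]
  exact mem_sol_range (List.nodup_iff_injective_get.1 hl) fun a b => Iff.rfl

/-- This ties words to sets: the kernel (`l` the surviving vertices) and the input (`l` all
vertices) both become induced subgraphs of one graph on the natural numbers. -/
theorem minimalMCSol_natWord (hl : l.Nodup) (hne : l ≠ []) :
    minimalMCSol (natWord l G.edgeSet) = {w | ∃ M ∈ Sol G {x | x ∈ l}, w = natWord l M} := by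
  rw [natWord_edgeSet, minimalMCSol_encodeGraph (List.length_pos_iff.2 hne)]
  ext w
  constructor
  · rintro ⟨N, hN, rfl⟩
    exact ⟨_, (mem_sol_list hl).2 ⟨N, hN, rfl⟩, (natWord_image hl N).symm⟩
  · rintro ⟨M, hM, rfl⟩
    obtain ⟨N, hN, rfl⟩ := (mem_sol_list hl).1 hM
    exact ⟨N, hN, natWord_image hl N⟩

theorem natWord_inj (hl : l.Nodup) {M M' : Set (Sym2 ℕ)} (hM : M ∈ Sol G {x | x ∈ l})
    (hM' : M' ∈ Sol G {x | x ∈ l}) (h : natWord l M = natWord l M') : M = M' := by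
  obtain ⟨N, -, rfl⟩ := (mem_sol_list hl).1 hM
  obtain ⟨N', -, rfl⟩ := (mem_sol_list hl).1 hM'
  rw [natWord_image hl, natWord_image hl] at h
  rw [encodeEdges_injective h]

theorem bit_natWord (hl : l.Nodup) {M : Set (Sym2 ℕ)} (hM : M ∈ Sol G {x | x ∈ l}) {a b i j : ℕ}
    (hi : l[a]? = some i) (hj : l[b]? = some j) :
    bit (natWord l M) (a * l.length + b) = true ↔ s(i, j) ∈ M := by
  classical
  obtain ⟨N, -, rfl⟩ := (mem_sol_list hl).1 hM
  obtain ⟨ha, rfl⟩ := List.getElem?_eq_some_iff.1 hi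
  obtain ⟨hb, rfl⟩ := List.getElem?_eq_some_iff.1 hj
  rw [natWord_image hl]
  have := bit_encodeEdges N ⟨a, ha⟩ ⟨b, hb⟩
  rw [this, decide_eq_true_iff]
  have hinj := Sym2.map.injective (List.nodup_iff_injective_get.1 hl)
  exact (hinj.mem_set_image (a := s((⟨a, ha⟩ : Fin l.length), ⟨b, hb⟩))).symm

end List

theorem mem_of_mem_sol {V : Type} {G : SimpleGraph V} {D : Set V} {M : Set (Sym2 V)}
    (h : M ∈ Sol G D) {u v : V} (huv : s(u, v) ∈ M) : u ∈ D ∧ v ∈ D := by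
  obtain ⟨c, -, -, rfl⟩ := h.1
  obtain ⟨h1, h2, -⟩ := mem_cutEdges.1 huv
  exact ⟨h1, h2⟩

theorem encodeGraph_eq_natWord {n : ℕ} (G : SimpleGraph (Fin n)) :
    encodeGraph G = natWord (List.range n) (natGraph G).edgeSet := by
  have : List.range n = List.ofFn (fun i : Fin n => (i : ℕ)) := by
    apply List.ext_getElem <;> simp
  refine (natWord_eq _ this.symm fun i j => ?_).symm
  simp [natGraph]

/-- The rank computed by counting is the position in the filtered list, which connects the rank
arrays with the row and column indices of the kernel matrix. -/
theorem getElem?_filter_range (p : ℕ → Prop) [DecidablePred p] {n i : ℕ} (hi : i < n) (hp : p i) :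
    ((List.range n).filter p)[Nat.count p i]? = some i := by
  induction n with
  | zero => omega
  | succ n ih =>
    rw [List.range_succ, List.filter_append]
    rcases Nat.lt_succ_iff_lt_or_eq.1 hi with h | rfl
    · have := ih h
      rw [List.getElem?_append_left (List.getElem?_eq_some_iff.1 this).1, this]
    · have : ((List.range i).filter p).length = Nat.count p i := by
        rw [Nat.count, List.countP_eq_length_filter]
      rw [List.getElem?_append_right (by omega), this]
      simp [hp]

open Classical in
/-- The vertices of the kernel. -/
noncomputable def kernelList (G : SimpleGraph ℕ) (n : ℕ) : List ℕ :=
  (List.range n).filter fun x => x ∈ trim G (core G n)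

section kernelList

variable {G : SimpleGraph ℕ} {n : ℕ}

theorem kernelList_nodup : (kernelList G n).Nodup := List.nodup_range.filter _

theorem setOf_mem_kernelList : {x | x ∈ kernelList G n} = trim G (core G n) := by
  classical
  ext x
  simp only [kernelList, Set.mem_ofPred_eq, List.mem_filter, List.mem_range, decide_eq_true_eq]
  exact ⟨fun h => h.2, fun h => ⟨core_subset n h.1, h⟩⟩

theorem kernelList_ne_nil (hn : 0 < n) : kernelList G n ≠ [] := by
  obtain ⟨x, hx⟩ := trim_nonempty (G := G) (core_nonempty (G := G) hn)
  rw [← setOf_mem_kernelList] at hx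
  exact List.ne_nil_of_mem hx

theorem length_kernelList : (kernelList G n).length = (trim G (core G n)).ncard := by
  classical
  rw [← setOf_mem_kernelList, ← List.toFinset_card_of_nodup kernelList_nodup,
    ← Set.ncard_coe_finset]
  congr 1
  ext x
  simp

end kernelList

end MatchingCut

/-! ## The kernelization and the solution-lifting algorithm -/

namespace MatchingCut

open Prog Fm MCComputable

/-- The kernelization algorithm. -/
def kernelProg : Prog :=
  .seq sqrtProg (.seq (.ite 5 (.const 4 0) (.seq setup (.seq (graphF.ev 0) (.ite 5
    (.seq reduction (printMat 0 (mem 9 0) (mem 9 1) (adj 0 1))) (.const 4 0))))) .endWord)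

/-- The solution-lifting algorithm. -/
def liftProg : Prog :=
  .seq sqrtProg (.seq setup (.seq reduction (.seq ranks (.seq (printMat 0 top top solF)
    (.seq .endWord (gloop 0 liftsF (.seq (printMat 1 top top edgesAtF) .endWord)))))))

/-- A bound for the time of `kernelProg` after the computation of the square root. -/
def kernelTime (n : ℕ) : ℕ :=
  setupTime n + (graphF.cost n + ((reductionTime n + printTime n (mem 9 0) (mem 9 1) (adj 0 1)) + 1))
    + 1 + 1

/-- A bound for the time of `liftProg` after the computation of the square root. -/
def liftTime (n : ℕ) : ℕ :=
  setupTime n + (reductionTime n + ((n * 22 + 13) + (printTime n top top solF + (1 +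
    (n * (liftsF.cost n + (printTime n top top edgesAtF + 1) + 5) + 3)))))

/-! ### Polynomial bounds -/

/-- The function is given by a polynomial. -/
def IsPoly (f : ℕ → ℕ) : Prop := ∃ p : Polynomial ℕ, ∀ n, f n = p.eval n

theorem IsPoly.add {f g : ℕ → ℕ} (hf : IsPoly f) (hg : IsPoly g) : IsPoly fun n => f n + g n := by
  obtain ⟨p, hp⟩ := hf
  obtain ⟨q, hq⟩ := hg
  exact ⟨p + q, fun n => by simp [hp, hq]⟩

theorem IsPoly.mul {f g : ℕ → ℕ} (hf : IsPoly f) (hg : IsPoly g) : IsPoly fun n => f n * g n := by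
  obtain ⟨p, hp⟩ := hf
  obtain ⟨q, hq⟩ := hg
  exact ⟨p * q, fun n => by simp [hp, hq]⟩

theorem isPoly_const (c : ℕ) : IsPoly fun _ => c := ⟨Polynomial.C c, fun n => by simp⟩

theorem isPoly_id : IsPoly fun n => n := ⟨Polynomial.X, fun n => by simp⟩

theorem isPoly_cost (φ : Fm) : IsPoly fun n => φ.cost n := exists_cost_le φ

theorem isPoly_comprTime (φ : Fm) : IsPoly fun n => comprTime n φ :=
  (isPoly_id.mul ((isPoly_cost φ).add (isPoly_const 5))).add (isPoly_const 3)

theorem isPoly_setupTime : IsPoly setupTime :=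
  (isPoly_comprTime _).add ((isPoly_const _).add ((isPoly_const _).add
    ((isPoly_id.mul (isPoly_const _)).add (isPoly_const _))))

theorem isPoly_reductionTime : IsPoly reductionTime :=
  (isPoly_comprTime _).add (((isPoly_id.mul (((isPoly_comprTime _).add (isPoly_comprTime _)).add
    (isPoly_const _))).add (isPoly_const _)).add ((isPoly_comprTime _).add
      (((isPoly_id.mul (((isPoly_id.mul (((isPoly_comprTime _).add (isPoly_comprTime _)).add
        (isPoly_const _))).add (isPoly_const _)).add (isPoly_const _))).add
          (isPoly_const _)).add (isPoly_comprTime _))))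

theorem isPoly_printTime (γ γ' χ : Fm) : IsPoly fun n => printTime n γ γ' χ :=
  (isPoly_id.mul (((isPoly_cost _).add ((isPoly_id.mul (((isPoly_cost _).add ((isPoly_cost _).add
    (isPoly_const _))).add (isPoly_const _))).add (isPoly_const _))).add (isPoly_const _))).add
      (isPoly_const _)

theorem isPoly_kernelTime : IsPoly kernelTime :=
  ((isPoly_setupTime.add ((isPoly_cost _).add ((isPoly_reductionTime.add
    (isPoly_printTime _ _ _)).add (isPoly_const _)))).add (isPoly_const _)).add (isPoly_const _)

theorem isPoly_liftTime : IsPoly liftTime :=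
  isPoly_setupTime.add (isPoly_reductionTime.add (((isPoly_id.mul (isPoly_const _)).add
    (isPoly_const _)).add ((isPoly_printTime _ _ _).add ((isPoly_const _).add
      ((isPoly_id.mul (((isPoly_cost _).add ((isPoly_printTime _ _ _).add (isPoly_const _))).add
        (isPoly_const _))).add (isPoly_const _))))))

theorem eval_mono (p : Polynomial ℕ) {a b : ℕ} (h : a ≤ b) : p.eval a ≤ p.eval b := by
  induction p using Polynomial.induction_on' with
  | add p q hp hq => simpa using Nat.add_le_add hp hq
  | monomial n c => simpa using Nat.mul_le_mul_left c (Nat.pow_le_pow_left h n)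

theorem IsPoly.exists_bound {f : ℕ → ℕ} (hf : IsPoly f) : ∃ p : Polynomial ℕ, ∀ l n m, n ≤ l → l ≤ m →
    (l * 11 + 10) + f n ≤ p.eval m := by
  obtain ⟨p, hp⟩ := hf
  refine ⟨Polynomial.X * Polynomial.C 11 + Polynomial.C 10 + p, fun l n m hn hm => ?_⟩
  have := eval_mono p (hn.trans hm)
  simp [hp]
  omega

/-! ### Correctness -/

theorem init_arr_zero (x : Word) (ws : List Word) (t : ℕ) :
    (MState.init (x :: ws)).arr 0 t ≠ 0 ↔ bit x t = true := by
  simp [MState.init, bit]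

theorem init_arr_two (x y z : Word) (t : ℕ) :
    (MState.init [x, y, z]).arr 2 t ≠ 0 ↔ bit z t = true := by
  simp [MState.init, bit]

theorem init_reg_zero (x : Word) (ws : List Word) : (MState.init (x :: ws)).reg 0 = x.length := by
  simp [MState.init]

theorem bit_encodeGraph {n : ℕ} (G : SimpleGraph (Fin n)) {i j : ℕ} (hi : i < n) (hj : j < n) :
    bit (encodeGraph G) (n * i + j) = true ↔ (natGraph G).Adj i j := by
  classical
  have := bit_encodeEdges G.edgeSet ⟨i, hi⟩ ⟨j, hj⟩
  simp only at this
  rw [mul_comm, encodeGraph, this, decide_eq_true_iff]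
  exact ⟨fun h => ⟨hi, hj, h⟩, fun ⟨_, _, h⟩ => h⟩

theorem setup_represents {n : ℕ} (G : SimpleGraph (Fin n)) (ws : List Word) {s : MState}
    (h0 : s.arr 0 = (MState.init (encodeGraph G :: ws)).arr 0)
    (h : ∀ i < n, s.arr 4 i = n * i ∧ s.arr 5 i = i) : Represents s.arr n (natGraph G) := by
  intro i hi j hj
  rw [h0, (h i hi).1, (h j hj).2, init_arr_zero, bit_encodeGraph G hi hj]

/-- The first conjunct says that there is a vertex. Symmetry is stated as an implication for all
ordered pairs, which yields equality of the two bits. -/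
theorem sat_graphF {A : ℕ → ℕ → ℕ} {n : ℕ} {x : Word} {e : ℕ → ℕ}
    (hx : ∀ t, A 0 t ≠ 0 ↔ bit x t = true) (h : ∀ i < n, A 4 i = n * i ∧ A 5 i = i)
    (hl : x.length = n * n) : graphF.sat A n 0 e ↔ IsGraphWord n x := by
  have hA : ∀ i j : Fin n, (A 0 (A 4 i + A 5 j) = 0 ↔ bit x (i * n + j) = false) := by
    intro i j
    rw [(h i i.2).1, (h j j.2).2, mul_comm, ← Bool.not_eq_true, ← hx, not_not]
  simp only [graphF, sat_and, sat_ex, sat_all, sat_not, sat_imp, sat_top, sat_adj,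
    Function.update_self, Function.update_of_ne, ne_eq, zero_ne_one, not_false_eq_true, hA, not_not,
    Nat.reduceAdd]
  constructor
  · rintro ⟨⟨y, -⟩, h1, h2⟩
    refine ⟨hl, y.pos, fun i hi => h1 ⟨i, hi⟩, fun i hi j hj => ?_⟩
    have := h2 ⟨i, hi⟩ ⟨j, hj⟩
    have := h2 ⟨j, hj⟩ ⟨i, hi⟩
    simp only [Bool.not_eq_false] at *
    exact Bool.eq_iff_iff.2 ⟨by assumption, by assumption⟩
  · rintro ⟨-, hn, h1, h2⟩
    refine ⟨⟨⟨0, hn⟩, trivial⟩, fun i => h1 i i.2, fun i j => ?_⟩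
    rw [h2 i i.2 j j.2]
    exact id

/-! ### The kernel of a word, the lifted lists, and the runs computing them -/

open Classical in
/-- The kernel of an instance. -/
noncomputable def kernelWord (x : Word) : Word :=
  if h : IsCode x then
    natWord (kernelList (natGraph h.choose_spec.choose) h.choose)
      (natGraph h.choose_spec.choose).edgeSet
  else []

theorem kernelWord_encodeGraph {n : ℕ} (hn : 0 < n) (G : SimpleGraph (Fin n)) :
    kernelWord (encodeGraph G) = natWord (kernelList (natGraph G) n) (natGraph G).edgeSet := by
  have h : IsCode (encodeGraph G) := ⟨n, G, hn, rfl⟩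
  rw [kernelWord, dif_pos h]
  -- The graph chosen in the definition of `kernelWord` equals `G`, because encodings are injective.
  have key : ∀ (n' : ℕ) (G' : SimpleGraph (Fin n')), encodeGraph G = encodeGraph G' →
      natWord (kernelList (natGraph G') n') (natGraph G').edgeSet =
        natWord (kernelList (natGraph G) n) (natGraph G).edgeSet := by
    intro n' G' h
    obtain ⟨rfl, rfl⟩ := encodeGraph_injective h
    rfl
  exact key _ _ h.choose_spec.choose_spec.2

theorem kernelWord_of_not {x : Word} (hx : ¬ IsCode x) : kernelWord x = [] := dif_neg hx

theorem kernelProg_ok (x : Word) : ∃ n ≤ x.length,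
    kernelProg.OutputsWithin [x] [kernelWord x] ((x.length * 11 + 10) + kernelTime n) := by
  classical
  obtain ⟨t, s1, hr, ht, h1, h2, h3, h4, h5, h6⟩ := sqrtProg_ok (init_reg_zero x [])
  refine ⟨s1.reg 3, h4, ?_⟩
  set n := s1.reg 3 with hn
  suffices hok : (Prog.seq (.ite 5 (.const 4 0) (.seq setup (.seq (graphF.ev 0) (.ite 5
      (.seq reduction (printMat 0 (mem 9 0) (mem 9 1) (adj 0 1))) (.const 4 0))))) .endWord).Ok s1
      (kernelTime n) fun s' => s'.out = [kernelWord x] ∧ s'.cur = [] from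
    Ok.seq ⟨t, s1, hr, ht, hok⟩
  -- If register `5` is not `0`, the length is not a square. Nothing is printed then, and the output
  -- is the empty word, which encodes no graph.
  refine Ok.seq (Ok.ite (fun h => (Ok.const (Q := _) (Ok.endWord ?_)).le (by omega)) (fun h => ?_))
  · have hnc : ¬ IsCode x := by
      rintro ⟨m, G, hm, rfl⟩
      have hl : m * m = (encodeGraph G).length := by simp [encodeGraph]
      exact h (h6.2 (by rw [h5 m hl]; exact hl))
    simp [h2, h3, MState.init, kernelWord_of_not hnc]
  have hl : x.length = n * n := (h6.1 h).symm
  refine Ok.seq ((setup_ok hn.symm).imp ?_)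
  rintro s2 ⟨h7, h8⟩
  have h32 : s2.reg 3 = n := (h7.reg 3 (by omega) (by omega)).trans hn.symm
  have h02 : s2.arr 0 = (MState.init [x]).arr 0 := by rw [h7.arr 0 (by simp), h1]
  refine Ok.seq ((ev_ok_of_eq (by decide) h32).imp ?_)
  rintro s3 ⟨h9, h10⟩
  rw [sat_graphF (fun t => by rw [h02]; exact init_arr_zero x [] t) h8 hl] at h10
  have h33 : s3.reg 3 = n := (h9.reg 3 (by omega) (by omega) (by omega)).trans h32
  refine Ok.ite (fun h' => ?_) (fun h' => (Ok.const (Q := _) (Ok.endWord ?_)).le ?_)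
  · obtain ⟨hpos, G, rfl⟩ := isGraphWord_iff.1 (h10.1 h')
    have hrep : Represents s3.arr n (natGraph G) := by
      rw [h9.arr]; exact setup_represents G [] h02 h8
    refine Ok.seq ((reduction_ok h33 hrep).imp ?_)
    rintro s4 ⟨h11, h12, h13⟩
    have h34 : s4.reg 3 = n := (h11.reg 3 (by omega) (by omega)).trans h33
    refine (printMat_ok (g := fun i => i ∈ trim (natGraph G) (core (natGraph G) n)) (by decide)
      (by decide) (by decide) h34 (fun i hi => ?_) (fun i hi j hj => ?_)).imp ?_
    · rw [sat_mem]; simpa using h13 i hi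
    · rw [sat_mem]; simpa using h13 j hj
    · rintro s5 ⟨-, h15, h16⟩
      refine Ok.endWord ?_
      rw [h15, h16, h11.out, h11.cur, h9.out, h9.cur, h7.out, h7.cur, h2, h3,
        kernelWord_encodeGraph hpos]
      refine ⟨?_, rfl⟩
      simp only [MState.init, List.nil_append]
      congr 1
      refine List.flatMap_congr fun i hi => List.map_congr_left fun j hj => ?_
      have hi' : i < n := List.mem_range.1 (List.mem_filter.1 hi).1
      have hj' : j < n := List.mem_range.1 (List.mem_filter.1 hj).1
      refine decide_eq_decide.2 ?_
      rw [sat_adj, h11.arr 0 (by simp), h11.arr 4 (by simp), h11.arr 5 (by simp)]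
      simpa using hrep i hi' j hj'
  · have hnc : ¬ IsCode x := by
      rintro ⟨m, G, hm, rfl⟩
      have hl' : m * m = (encodeGraph G).length := by simp [encodeGraph]
      obtain rfl : n = m := h5 m hl'
      exact h10.2 (isGraphWord_iff.2 ⟨hm, G, rfl⟩) h'
    simp [h9.out, h9.cur, h7.out, h7.cur, h2, h3, MState.init, kernelWord_of_not hnc]
  · unfold printTime; omega

open Classical in
/-- The solutions assigned to the solution `M` of the kernel. -/
noncomputable def liftList (G : SimpleGraph ℕ) (n : ℕ) (M : Set (Sym2 ℕ)) : List Word :=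
  natWord (List.range n) M :: ((List.range n).filter fun p => Lifts G (core G n) M p).map
    fun p => natWord (List.range n) (edgesAt G (core G n) p)

theorem foldl_append_fst {α : Type} (l : List α) (f : α → Word) (o : List Word) :
    l.foldl (fun oc i => (oc.1 ++ [oc.2 ++ f i], ([] : Word))) (o, []) = (o ++ l.map f, []) := by
  induction l generalizing o with
  | nil => simp
  | cons a l ih => simp [ih]

/-- The core and its trimming are recomputed from the graph. The bits of the kernel solution are
read through the rank arrays; after that solution itself, one word is written for every surplus
vertex assigned to it. -/
theorem liftProg_ok {n : ℕ} (G : SimpleGraph (Fin n)) (y : Word) {M : Set (Sym2 ℕ)}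
    (hM : M ∈ Sol (natGraph G) (trim (natGraph G) (core (natGraph G) n))) :
    liftProg.OutputsWithin [encodeGraph G, y, natWord (kernelList (natGraph G) n) M]
      (liftList (natGraph G) n M) (((encodeGraph G).length * 11 + 10) + liftTime n) := by
  classical
  set G' := natGraph G with hG'
  set s0 := MState.init [encodeGraph G, y, natWord (kernelList G' n) M] with hs0
  obtain ⟨t, s1, hr, ht, h1, h2, h3, h4, h5, h6⟩ :=
    sqrtProg_ok (init_reg_zero (encodeGraph G) [y, natWord (kernelList G' n) M])
  have hn : s1.reg 3 = n := h5 n (by simp [encodeGraph])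
  suffices hok : (Prog.seq setup (.seq reduction (.seq ranks (.seq (printMat 0 top top solF)
      (.seq .endWord (gloop 0 liftsF (.seq (printMat 1 top top edgesAtF) .endWord))))))).Ok s1
      (liftTime n) fun s' => s'.out = liftList G' n M ∧ s'.cur = [] from
    Ok.seq ⟨t, s1, hr, ht, hok⟩
  refine Ok.seq ((setup_ok hn).imp ?_)
  rintro s2 ⟨h7, h8⟩
  have h32 : s2.reg 3 = n := (h7.reg 3 (by omega) (by omega)).trans hn
  have hrep : Represents s2.arr n G' :=
    setup_represents G [y, natWord (kernelList G' n) M] (by rw [h7.arr 0 (by simp), h1]) h8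
  refine Ok.seq ((reduction_ok h32 hrep).imp ?_)
  rintro s3 ⟨h9, h10, h11⟩
  have h33 : s3.reg 3 = n := (h9.reg 3 (by omega) (by omega)).trans h32
  refine Ok.seq ((ranks_ok h33).imp ?_)
  rintro s4 ⟨h12, h13⟩
  have h34 : s4.reg 3 = n := (h12.reg 3 (by omega) (by omega)).trans h33
  have hrep4 : Represents s4.arr n G' := by
    intro i hi j hj
    rw [h12.arr 0 (by simp), h12.arr 4 (by simp), h12.arr 5 (by simp), h9.arr 0 (by simp),
      h9.arr 4 (by simp), h9.arr 5 (by simp)]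
    exact hrep i hi j hj
  have h8' : ∀ x, x ∈ core G' n ↔ x < n ∧ s4.arr 8 x ≠ 0 := by
    intro x
    rw [h12.arr 8 (by simp)]
    exact ⟨fun h => ⟨core_subset n h, (h10 x (core_subset n h)).2 h⟩, fun ⟨h, h'⟩ => (h10 x h).1 h'⟩
  have h9' : ∀ x, x ∈ trim G' (core G' n) ↔ x < n ∧ s4.arr 9 x ≠ 0 := by
    intro x
    rw [h12.arr 9 (by simp)]
    exact ⟨fun h => ⟨core_subset n h.1, (h11 x (core_subset n h.1)).2 h⟩,
      fun ⟨h, h'⟩ => (h11 x h).1 h'⟩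
  have hlist : (List.range n).filter (fun x => s3.arr 9 x ≠ 0) = kernelList G' n :=
    List.filter_congr fun x hx => decide_eq_decide.2 (h11 x (List.mem_range.1 hx))
  have hcount : Nat.count (fun x => s3.arr 9 x ≠ 0) n = (kernelList G' n).length := by
    rw [← hlist, Nat.count, List.countP_eq_length_filter]
  have hidx : ∀ i ∈ trim G' (core G' n),
      (kernelList G' n)[Nat.count (fun x => s3.arr 9 x ≠ 0) i]? = some i := by
    intro i hi
    rw [← hlist]
    have hin := core_subset n hi.1
    exact getElem?_filter_range _ hin ((h11 i hin).2 hi)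
  -- The bit of the pair `i`, `j` stands in the kernel matrix at the rank of `i` times the number of
  -- kernel vertices, plus the rank of `j`.
  have hsol : ∀ i ∈ trim G' (core G' n), ∀ j ∈ trim G' (core G' n),
      (s4.arr 2 (s4.arr 10 i + s4.arr 11 j) ≠ 0 ↔ s(i, j) ∈ M) := by
    intro i hi j hj
    rw [(h13 i (core_subset n hi.1)).2, (h13 j (core_subset n hj.1)).1, h12.arr 2 (by simp),
      h9.arr 2 (by simp), h7.arr 2 (by simp), h1, init_arr_two, hcount,
      mul_comm]
    exact bit_natWord kernelList_nodup (by rwa [setOf_mem_kernelList]) (hidx i hi) (hidx j hj)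
  refine Ok.seq ((printMat_ok (g := fun _ => True) (by decide) (by decide) (by decide) h34
    (fun i hi => by simp [sat_top]) (fun i hi j hj => by simp [sat_top])).imp ?_)
  rintro s5 ⟨h14, h15, h16⟩
  refine Ok.seq (Ok.endWord ?_)
  have hcur : s5.cur = natWord (List.range n) M := by
    rw [h16, h12.cur, h9.cur, h7.cur, h3]
    simp only [MState.init, List.nil_append, decide_true, List.filter_true]
    refine List.flatMap_congr fun i hi => List.map_congr_left fun j hj => ?_
    have hi' : i < n := List.mem_range.1 hi
    have hj' : j < n := List.mem_range.1 hj
    refine decide_eq_decide.2 ?_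
    simp only [solF, sat_and, sat_mem, sat_mat, Nat.reduceAdd, Function.update_self,
      Function.update_of_ne, ne_eq, zero_ne_one, not_false_eq_true]
    constructor
    · rintro ⟨ha, hb, hc⟩
      exact (hsol i ((h9' i).2 ⟨hi', ha⟩) j ((h9' j).2 ⟨hj', hb⟩)).1 hc
    · intro h
      obtain ⟨ha, hb⟩ := mem_of_mem_sol hM h
      exact ⟨((h9' i).1 ha).2, ((h9' j).1 hb).2, (hsol i ha j hb).2 h⟩
  have hout : s5.out = [] := by
    rw [h15, h12.out, h9.out, h7.out, h2]; rfl
  -- For the remaining loop only the arrays, the lower registers and the output matter.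
  suffices hrest : ∀ s5 : MState, s4.Quiet 0 s5 → s5.out = [natWord (List.range n) M] → s5.cur = [] →
      (gloop 0 liftsF (.seq (printMat 1 top top edgesAtF) .endWord)).Ok s5
        (n * (liftsF.cost n + (printTime n top top edgesAtF + 1) + 5) + 3)
        fun s' => s'.out = liftList G' n M ∧ s'.cur = [] from
    hrest _ ⟨h14.arr, h14.reg⟩ (by simp [hout, hcur]) rfl
  clear h14 h15 h16 hcur hout s5
  intro s5 h14 hout hcur
  have h35 : s5.reg 3 = n := (h14.reg 3 (by omega) (by omega) (by omega)).trans h34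
  -- Every round appends one finished word and leaves the current word empty.
  refine (gloop_ok (d := 0) (γ := liftsF) (n := n) (Tb := printTime n top top edgesAtF + 1) (by decide) h35 (by omega)
    (fun p oc => (oc.1 ++ [oc.2 ++ natWord (List.range n) (edgesAt G' (core G' n) p)], [])) ?_).imp ?_
  · intro p hp _ s6 h17 hz
    have h36 : s6.reg 3 = n := (h17.reg 3 (by omega) (by omega) (by omega)).trans h35
    have harr : s6.arr = s4.arr := h17.arr.trans h14.arr
    refine Ok.seq ((printMat_ok (g := fun _ => True) (by decide) (by decide) (by decide) h36
      (fun i hi => by simp [sat_top]) (fun i hi j hj => by simp [sat_top])).imp ?_)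
    rintro s7 ⟨h18, h19, h20⟩
    refine Ok.endWord ⟨⟨h18.arr, h18.reg⟩, ?_⟩
    simp only [h19, h20, decide_true, List.filter_true]
    congr 4
    refine List.flatMap_congr fun i hi => List.map_congr_left fun j hj => decide_eq_decide.2 ?_
    rw [harr]
    exact sat_edgesAtF hrep4 h8' (List.mem_range.1 hi) (List.mem_range.1 hj) hz
  · rintro s6 ⟨-, h17⟩
    rw [hcur, foldl_append_fst, Prod.mk.injEq] at h17
    refine ⟨?_, h17.2⟩
    rw [h17.1, hout, liftList, List.singleton_append]
    congr 2
    refine List.filter_congr fun p hp => decide_eq_decide.2 ?_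
    rw [h14.arr]
    exact sat_liftsF hrep4 h8' h9' hsol (List.mem_range.1 hp)

end MatchingCut

namespace MatchingCut

open MCComputable

/-! ### The lifted lists partition the solutions of the input -/

section Assembly

variable {n : ℕ} (G : SimpleGraph (Fin n))

theorem setOf_mem_range : {x | x ∈ List.range n} = verts n := by
  ext x; simp [verts]

theorem minimalMCSol_kernelWord (hn : 0 < n) : minimalMCSol (kernelWord (encodeGraph G)) =
    {w | ∃ M ∈ Sol (natGraph G) (trim (natGraph G) (core (natGraph G) n)),
      w = natWord (kernelList (natGraph G) n) M} := by
  rw [kernelWord_encodeGraph hn, minimalMCSol_natWord kernelList_nodup (kernelList_ne_nil hn),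
    setOf_mem_kernelList]

theorem minimalMCSol_encodeGraph' (hn : 0 < n) : minimalMCSol (encodeGraph G) =
    {w | ∃ M ∈ Sol (natGraph G) (core (natGraph G) n), w = natWord (List.range n) M} := by
  rw [encodeGraph_eq_natWord, minimalMCSol_natWord List.nodup_range (by simpa using hn.ne'),
    setOf_mem_range, sol_core hn]

variable {G}

theorem natWord_range_inj (hn : 0 < n) {M M' : Set (Sym2 ℕ)}
    (hM : M ∈ Sol (natGraph G) (core (natGraph G) n))
    (hM' : M' ∈ Sol (natGraph G) (core (natGraph G) n))
    (h : natWord (List.range n) M = natWord (List.range n) M') : M = M' := by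
  rw [sol_core hn, ← setOf_mem_range] at hM hM'
  exact natWord_inj List.nodup_range hM hM' h

theorem mem_liftList {M : Set (Sym2 ℕ)} {w : Word} : w ∈ liftList (natGraph G) n M ↔
    w = natWord (List.range n) M ∨ ∃ p, Lifts (natGraph G) (core (natGraph G) n) M p ∧
      w = natWord (List.range n) (edgesAt (natGraph G) (core (natGraph G) n) p) := by
  classical
  simp only [liftList, List.mem_cons, List.mem_map, List.mem_filter, List.mem_range,
    decide_eq_true_eq]
  refine or_congr Iff.rfl ⟨?_, ?_⟩
  · rintro ⟨p, ⟨-, hp⟩, rfl⟩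
    exact ⟨p, hp, rfl⟩
  · rintro ⟨p, hp, rfl⟩
    refine ⟨p, ⟨?_, hp⟩, rfl⟩
    obtain ⟨⟨v, y, -, h, -⟩, -⟩ := hp
    exact core_subset n h.2.1

/-- Each word in the list is the word of a solution, from which the assigned solution of the kernel
is determined. -/
theorem exists_of_mem_liftList {M : Set (Sym2 ℕ)}
    (hM : M ∈ Sol (natGraph G) (trim (natGraph G) (core (natGraph G) n))) {w : Word}
    (hw : w ∈ liftList (natGraph G) n M) :
    ∃ M' ∈ Sol (natGraph G) (core (natGraph G) n), w = natWord (List.range n) M' ∧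
      (M' = M ∨ ∃ p, Lifts (natGraph G) (core (natGraph G) n) M p ∧
        M' = edgesAt (natGraph G) (core (natGraph G) n) p) := by
  rcases mem_liftList.1 hw with rfl | ⟨p, hp, rfl⟩
  · exact ⟨M, (sol_trim.1 hM).1, rfl, Or.inl rfl⟩
  · exact ⟨_, hp.mem_sol hM, rfl, Or.inr ⟨p, hp, rfl⟩⟩

theorem liftList_nodup (hn : 0 < n) {M : Set (Sym2 ℕ)}
    (hM : M ∈ Sol (natGraph G) (trim (natGraph G) (core (natGraph G) n))) :
    (liftList (natGraph G) n M).Nodup := by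
  classical
  rw [liftList, List.nodup_cons]
  constructor
  · simp only [List.mem_map, List.mem_filter, decide_eq_true_eq, not_exists, not_and]
    rintro p ⟨-, hp⟩ h
    have := natWord_range_inj hn (hp.mem_sol hM) (sol_trim.1 hM).1 h
    exact hp.not_mem (this ▸ hM)
  · refine List.Nodup.map_on ?_ (List.nodup_range.filter _)
    intro p hp q hq h
    have hp' := of_decide_eq_true (List.mem_filter.1 hp).2
    have hq' := of_decide_eq_true (List.mem_filter.1 hq).2
    exact hp'.inj hq' (natWord_range_inj hn (hp'.mem_sol hM) (hq'.mem_sol hM) h)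

/-- A listed solution determines its origin: it is a solution of the kernel and comes from itself,
or it is an edge at a surplus vertex and `Lifts.unique` applies. `Lifts.not_mem` excludes a mixture.
-/
theorem liftList_disjoint (hn : 0 < n) {M M' : Set (Sym2 ℕ)}
    (hM : M ∈ Sol (natGraph G) (trim (natGraph G) (core (natGraph G) n)))
    (hM' : M' ∈ Sol (natGraph G) (trim (natGraph G) (core (natGraph G) n))) (hne : M ≠ M') :
    List.Disjoint (liftList (natGraph G) n M) (liftList (natGraph G) n M') := by
  intro w hw hw'
  obtain ⟨N, hN, rfl, h1⟩ := exists_of_mem_liftList hM hw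
  obtain ⟨N', hN', hNN', h2⟩ := exists_of_mem_liftList hM' hw'
  obtain rfl := natWord_range_inj hn hN hN' hNN'
  rcases h1 with rfl | ⟨p, hp, rfl⟩ <;> rcases h2 with h2 | ⟨q, hq, h2⟩
  · exact hne h2
  · exact hq.not_mem (h2 ▸ hM)
  · exact hp.not_mem (h2 ▸ hM')
  · obtain rfl := hp.inj hq h2
    exact hne (hp.unique hM hM' hq)

theorem exists_mem_liftList {M : Set (Sym2 ℕ)}
    (hM : M ∈ Sol (natGraph G) (core (natGraph G) n)) :
    ∃ M' ∈ Sol (natGraph G) (trim (natGraph G) (core (natGraph G) n)),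
      natWord (List.range n) M ∈ liftList (natGraph G) n M' := by
  obtain ⟨M', hM', h⟩ := exists_of_mem_sol hM
  refine ⟨M', hM', mem_liftList.2 ?_⟩
  rcases h with rfl | ⟨p, hp, rfl⟩
  · exact Or.inl rfl
  · exact Or.inr ⟨p, hp, rfl⟩

theorem kernel_spec (hn : 0 < n) : ∃ (m : ℕ) (H : SimpleGraph (Fin m)), 0 < m ∧
    m ≤ 6 * modularWidth G ∧ kernelWord (encodeGraph G) = encodeGraph H := by
  refine ⟨_, listGraph (natGraph G) (kernelList (natGraph G) n),
    List.length_pos_iff.2 (kernelList_ne_nil hn), ?_, ?_⟩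
  · rw [length_kernelList]
    exact ncard_trim_core_le hn G
  · rw [kernelWord_encodeGraph hn, natWord_edgeSet]

end Assembly

/-- A bound for the size and the parameter of the kernel. -/
def sizeBound (k : ℕ) : ℕ := 6 * k * (6 * k) + 6 * k

theorem computable_sizeBound : Computable sizeBound := by
  have h : Primrec fun k : ℕ => 6 * k := Primrec.nat_mul.comp (.const 6) .id
  exact (Primrec.nat_add.comp (Primrec.nat_mul.comp h h) h).to_comp

/-- With at most `6k` vertices the matrix has at most `(6k)²` bits, and the width does not exceed
the number of vertices. -/
theorem kernelWord_size (x : Word) :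
    (kernelWord x).length + modularWidthParam (kernelWord x) ≤ sizeBound (modularWidthParam x) := by
  by_cases hx : IsCode x
  · obtain ⟨n, G, hn, rfl⟩ := hx
    obtain ⟨m, H, hm, hle, he⟩ := kernel_spec (G := G) hn
    rw [he, modularWidthParam_encodeGraph hn, modularWidthParam_encodeGraph hm, encodeGraph,
      length_encodeEdges]
    exact Nat.add_le_add (Nat.mul_le_mul hle hle) ((modularWidth_le hm H).trans hle)
  · rw [kernelWord_of_not hx, modularWidthParam_of_not not_isCode_nil]
    simp

open Classical in
/-- The solutions of `x` assigned to the solution `s` of the kernel. -/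
noncomputable def liftWords (x s : Word) : List Word :=
  if h : ∃ (n : ℕ) (G : SimpleGraph (Fin n)) (M : Set (Sym2 ℕ)), 0 < n ∧ x = encodeGraph G ∧
      M ∈ Sol (natGraph G) (trim (natGraph G) (core (natGraph G) n)) ∧
      s = natWord (kernelList (natGraph G) n) M
  then liftList (natGraph h.choose_spec.choose) h.choose h.choose_spec.choose_spec.choose
  else []

theorem liftWords_eq {n : ℕ} {G : SimpleGraph (Fin n)} (hn : 0 < n) {M : Set (Sym2 ℕ)}
    (hM : M ∈ Sol (natGraph G) (trim (natGraph G) (core (natGraph G) n))) :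
    liftWords (encodeGraph G) (natWord (kernelList (natGraph G) n) M) =
      liftList (natGraph G) n M := by
  have h : ∃ (n' : ℕ) (G' : SimpleGraph (Fin n')) (M' : Set (Sym2 ℕ)), 0 < n' ∧
      encodeGraph G = encodeGraph G' ∧
      M' ∈ Sol (natGraph G') (trim (natGraph G') (core (natGraph G') n')) ∧
      natWord (kernelList (natGraph G) n) M = natWord (kernelList (natGraph G') n') M' :=
    ⟨n, G, M, hn, rfl, hM, rfl⟩
  rw [liftWords, dif_pos h]
  -- The chosen graph and kernel solution are the given ones, since graphs and solutions are
  -- determined by their words.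
  have key : ∀ (n' : ℕ) (G' : SimpleGraph (Fin n')) (M' : Set (Sym2 ℕ)),
      encodeGraph G = encodeGraph G' →
      M' ∈ Sol (natGraph G') (trim (natGraph G') (core (natGraph G') n')) →
      natWord (kernelList (natGraph G) n) M = natWord (kernelList (natGraph G') n') M' →
      liftList (natGraph G') n' M' = liftList (natGraph G) n M := by
    intro n' G' M' h hM' hMM'
    obtain ⟨rfl, rfl⟩ := encodeGraph_injective h
    rw [← setOf_mem_kernelList] at hM hM'
    rw [natWord_inj kernelList_nodup hM hM' hMM']
  obtain ⟨-, h1, h2, h3⟩ := h.choose_spec.choose_spec.choose_spec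
  exact key _ _ _ h1 h2 h3

theorem isFullyPolynomialEnumKernel :
    IsFullyPolynomialEnumKernel enumMinimalMC kernelProg liftProg := by
  obtain ⟨p, hp⟩ := isPoly_kernelTime.exists_bound
  obtain ⟨q, hq⟩ := isPoly_liftTime.exists_bound
  refine ⟨kernelWord, liftWords, p, q, sizeBound, computable_sizeBound, fun x => ⟨?_, kernelWord_size x⟩,
    fun x => ?_⟩
  · obtain ⟨n, hn, t, s, h1, h2, h3⟩ := kernelProg_ok x
    exact ⟨t, s, h1, h2.trans (hp _ _ _ hn (Nat.le_add_right _ _)), h3⟩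
  by_cases hx : IsCode x
  swap
  -- A word that encodes no graph has no solutions, and neither does its kernel, the empty word.
  · have h1 : enumMinimalMC.Sol (kernelWord x) = ∅ := by
      rw [kernelWord_of_not hx]; exact minimalMCSol_of_not not_isCode_nil
    have h2 : enumMinimalMC.Sol x = ∅ := minimalMCSol_of_not hx
    simp [h1, h2]
  obtain ⟨n, G, hn, rfl⟩ := hx
  have h1 : enumMinimalMC.Sol (kernelWord (encodeGraph G)) = _ := minimalMCSol_kernelWord G hn
  have h2 : enumMinimalMC.Sol (encodeGraph G) = _ := minimalMCSol_encodeGraph' G hn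
  rw [h1, h2]
  refine ⟨?_, ?_, ?_⟩
  · rintro _ ⟨M, hM, rfl⟩
    rw [liftWords_eq hn hM]
    refine ⟨?_, liftList_nodup hn hM, by simp [liftList], fun w hw => ?_⟩
    · obtain ⟨t, s, h3, h4, h5⟩ := liftProg_ok G (kernelWord (encodeGraph G)) hM
      refine ⟨t, s, h3, h4.trans (hq _ _ _ ?_ ?_), h5⟩
      · simpa [encodeGraph] using Nat.le_mul_self n
      · omega
    · obtain ⟨M', hM', rfl, -⟩ := exists_of_mem_liftList hM hw
      exact ⟨M', hM', rfl⟩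
  · rintro _ ⟨M, hM, rfl⟩ _ ⟨M', hM', rfl⟩ hne
    rw [liftWords_eq hn hM, liftWords_eq hn hM']
    exact liftList_disjoint hn hM hM' fun h => hne (by rw [h])
  · rintro _ ⟨M, hM, rfl⟩
    obtain ⟨M', hM', hmem⟩ := exists_mem_liftList hM
    exact ⟨_, ⟨M', hM', rfl⟩, by rwa [liftWords_eq hn hM']⟩

end MatchingCut

theorem theorem4p11 :
    ∃ A A' : Prog, IsFullyPolynomialEnumKernel enumMinimalMC A A' ∧
      ∀ (n : ℕ) (G : SimpleGraph (Fin n)), 0 < n →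
        ∃ (m : ℕ) (H : SimpleGraph (Fin m)), 0 < m ∧ m ≤ 6 * modularWidth G ∧
          A.Outputs [encodeGraph G] [encodeGraph H] := by
  refine ⟨MatchingCut.kernelProg, MatchingCut.liftProg, MatchingCut.isFullyPolynomialEnumKernel,
    fun n G hn => ?_⟩
  obtain ⟨m, H, hm, hle, he⟩ := MatchingCut.kernel_spec (G := G) hn
  obtain ⟨k, -, h⟩ := MatchingCut.kernelProg_ok (encodeGraph G)
  exact ⟨m, H, hm, hle, _, he ▸ h⟩
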